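/- Let $p$ be a prime, let $S$ be a discrete $p$-toral group (an extension of some $(\mathbb{Z}/p^\infty)^r$ by a finite $p$-group), and let $\mathcal{F}$ be a saturated fusion system over $S$, in the sense of Broto--Levi--Oliver; for instance, the fusion system of a $p$-local compact group $(S,\mathcal{F},\mathcal{L})$. For a group $A$, let $O^{p'}(A)$ be the intersection of all normal subgroups of $A$ of finite index prime to $p$. A saturated fusion subsystem $\mathcal{E}\subseteq\mathcal{F}$ over the same group $S$ has index prime to $p$ if $\operatorname{Aut}_{\mathcal{E}}(P)\geq O^{p'}(\operatorname{Aut}_{\mathcal{F}}(P))$ for all $P\leq S$. Then, among the saturated fusion subsystems of $\mathcal{F}$ of index prime to $p$, there is a smallest one, $O^{p'}(\mathcal{F})$ (the intersection of all of them), and it is a normal subsystem of $\mathcal{F}$. Here a fusion subsystem $\mathcal{F}'\subseteq\mathcal{F}$ over a subgroup $S'\leq S$ is normal in $\mathcal{F}$ if: (N1) $S'$ is strongly closed in $\mathcal{F}$: $\varphi(g)\in S'$ for all $g\in S'$ and $\varphi\in\operatorname{Hom}_{\mathcal{F}}(\langle g\rangle,S)$; (N2) for all $P\leq Q\leq S'$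 and $\gamma\in\operatorname{Hom}_{\mathcal{F}}(Q,S)$, the map $f\mapsto\gamma\circ f\circ\gamma^{-1}$ is a bijection from $\operatorname{Hom}_{\mathcal{F}'}(P,Q)$ to $\operatorname{Hom}_{\mathcal{F}'}(\gamma(P),\gamma(Q))$; (N3) $\mathcal{F}'$ is a saturated fusion system over $S'$; (N4) each $f\in\operatorname{Aut}_{\mathcal{F}'}(S')$ extends to some $\widetilde{f}\in\operatorname{Aut}_{\mathcal{F}}(S'C_S(S'))$ such that $\widetilde{f}(g)g^{-1}\in Z(S')$ for all $g\in C_S(S')$. -/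

import Mathlib

/-! All groups occurring in a fusion system are subgroups of one ambient group `G`, which plays no
role (for an abstract group `S` one takes `G = S` and the subgroup `⊤`). -/

noncomputable section

/-! ### Discrete `p`-toral groups -/

/-- The group `ℤ/p^∞`, as the group of complex numbers of modulus one and `p`-power order. -/
abbrev PruferGroup (p : ℕ) : Type := CommGroup.primaryComponent Circle p

/-- `T` is a discrete `p`-torus of rank `r`: it is isomorphic to `(ℤ/p^∞)^r`. -/
def IsDiscretePTorus (p : ℕ) (T : Type*) [Group T] (r : ℕ) : Prop :=
  Nonempty (T ≃* (Fin r → PruferGroup p))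

/-- `P` is discrete `p`-toral: an extension of a discrete `p`-torus by a finite `p`-group. -/
def IsDiscretePToral (p : ℕ) (P : Type*) [Group P] : Prop :=
  ∃ T : Subgroup P, T.Normal ∧ (∃ r, IsDiscretePTorus p T r) ∧ ∃ n : ℕ, T.index = p ^ n

/-- The identity component `P₀`: the smallest subgroup of finite index
(for a discrete `p`-toral group, its maximal torus). -/
def identityComponent (P : Type*) [Group P] : Subgroup P :=
  sInf {H : Subgroup P | H.FiniteIndex}

/-- The rank of a discrete `p`-toral group: the `r` with `P₀ ≅ (ℤ/p^∞)^r`. -/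
def toralRank (p : ℕ) (P : Type*) [Group P] : ℕ :=
  sInf {r : ℕ | IsDiscretePTorus p (identityComponent P) r}

/-- The order of a discrete `p`-toral group: the pair `(rk P, |P / P₀|)`; such pairs are
compared lexicographically. -/
def toralOrder (p : ℕ) (P : Type*) [Group P] : ℕ ×ₗ ℕ :=
  toLex (toralRank p P, (identityComponent P).index)

/-! ### Normalizers, centralizers and automizers inside `S` -/

section Ambient

variable {G : Type*} [Group G]

/-- `N_S(P)`. -/
def normalizerIn (S P : Subgroup G) : Subgroup G := S ⊓ Subgroup.normalizer (P : Set G)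

/-- `C_S(P)`. -/
def centralizerIn (S P : Subgroup G) : Subgroup G := S ⊓ Subgroup.centralizer (P : Set G)

/-- `Aut_S(P)`: the automorphisms `c_g` of `P` with `g ∈ N_S(P)`. -/
def autIn (S P : Subgroup G) : Subgroup (MulAut P) :=
  (S.subgroupOf (Subgroup.normalizer (P : Set G))).map P.normalizerMonoidHom

/-- Conjugation `c_g : P → Q`, `x ↦ g x g⁻¹`. -/
def conjHom (P Q : Subgroup G) (g : G) (h : ∀ x ∈ P, g * x * g⁻¹ ∈ Q) : P →* Q :=
  ((MulAut.conj g).toMonoidHom.comp P.subtype).codRestrict Q (fun x => h x x.2)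

/-- The image `φ(R)`, for `φ : Q → Q'` and `R ≤ Q`, as a subgroup of the ambient group. -/
def imageOf {Q Q' : Subgroup G} (φ : Q →* Q') (R : Subgroup G) : Subgroup G :=
  (R.subgroupOf Q).map (Q'.subtype.comp φ)

/-- The isomorphism `R ≅ φ(R)` induced by an injective `φ : Q → Q'`, for `R ≤ Q`. -/
def imageEquiv {Q Q' R : Subgroup G} (φ : Q →* Q') (hφ : Function.Injective φ) (hR : R ≤ Q) :
    R ≃* imageOf φ R :=
  (Subgroup.subgroupOfEquivOfLe hR).symm.trans
    ((R.subgroupOf Q).equivMapOfInjective (Q'.subtype.comp φ)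
      (Q'.subtype_injective.comp hφ))

/-- `γ ∘ f ∘ γ⁻¹ : γ(P) → γ(Q)`, for `f : P → Q` and an injective `γ` on `Q ≥ P`. -/
def conjugateHom {P Q Q' : Subgroup G} (γ : Q →* Q') (hγ : Function.Injective γ) (hP : P ≤ Q)
    (f : P →* Q) : imageOf γ P →* imageOf γ Q :=
  (imageEquiv γ hγ le_rfl).toMonoidHom.comp (f.comp (imageEquiv γ hγ hP).symm.toMonoidHom)

/-- `N_φ = {g ∈ N_S(P) | φ c_g φ⁻¹ ∈ Aut_S(φ(P))}`, for an injective `φ : P → S`. -/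
def extensionDomain {S P : Subgroup G} (φ : P →* S) (hφ : Function.Injective φ) : Subgroup G :=
  S ⊓ ((((autIn S (imageOf φ P)).comap
    (MulAut.congr (imageEquiv φ hφ le_rfl)).toMonoidHom).comap
      P.normalizerMonoidHom).map (Subgroup.normalizer (P : Set G)).subtype)

end Ambient

/-- `Inn(P)`. -/
def innerAut (P : Type*) [Group P] : Subgroup (MulAut P) := (MulAut.conj : P →* MulAut P).range

instance innerAut_normal (P : Type*) [Group P] : (innerAut P).Normal := by
  constructor
  rintro _ ⟨g, rfl⟩ α
  refine ⟨α g, ?_⟩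
  ext x
  simp [MulAut.mul_apply]

/-- The image in `Out(P) = Aut(P) / Inn(P)` of a subgroup of `Aut(P)`. -/
def outImage {P : Type*} [Group P] (A : Subgroup (MulAut P)) : Subgroup (MulAut P ⧸ innerAut P) :=
  A.map (QuotientGroup.mk' (innerAut P))

/-- `A` is a Sylow `p`-subgroup of `B`, both being subgroups of some group. -/
def IsSylowIn (p : ℕ) {X : Type*} [Group X] (A B : Subgroup X) : Prop :=
  ∃ Q : Sylow p B, (Q : Subgroup B).map B.subtype = A

/-- `O^{p'}(A)`: the intersection of all normal subgroups of finite index prime to `p`. -/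
def pPrimeResidual (p : ℕ) (A : Type*) [Group A] : Subgroup A :=
  sInf {K : Subgroup A | K.Normal ∧ K.FiniteIndex ∧ p.Coprime K.index}

/-! ### Fusion systems -/

/-- A fusion system over `S`: a category whose objects are the subgroups of `S`, whose morphism
sets satisfy `Hom_S(P, Q) ⊆ Hom(P, Q) ⊆ Inj(P, Q)`, and in which every morphism is the composite
of an isomorphism of the category and an inclusion. -/
@[ext]
structure FusionSystem {G : Type*} [Group G] (S : Subgroup G) where
  /-- The set of morphisms from `P` to `Q`; it is empty unless `P` and `Q` are subgroups of `S`. -/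
  Hom : (P Q : Subgroup G) → Set (P →* Q)
  le_of_mem : ∀ {P Q : Subgroup G} {φ : P →* Q}, φ ∈ Hom P Q → P ≤ S ∧ Q ≤ S
  injective : ∀ {P Q : Subgroup G} {φ : P →* Q}, φ ∈ Hom P Q → Function.Injective φ
  conj_mem : ∀ {P Q : Subgroup G}, P ≤ S → Q ≤ S → ∀ g ∈ S, ∀ h : ∀ x ∈ P, g * x * g⁻¹ ∈ Q,
    conjHom P Q g h ∈ Hom P Q
  comp_mem : ∀ {P Q R : Subgroup G} {ψ : Q →* R} {φ : P →* Q},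
    ψ ∈ Hom Q R → φ ∈ Hom P Q → ψ.comp φ ∈ Hom P R
  factor : ∀ {P Q : Subgroup G} {φ : P →* Q}, φ ∈ Hom P Q →
    ∃ (R : Subgroup G) (hR : R ≤ Q) (e : P ≃* R), e.toMonoidHom ∈ Hom P R ∧
      e.symm.toMonoidHom ∈ Hom R P ∧ φ = (Subgroup.inclusion hR).comp e.toMonoidHom

namespace FusionSystem

variable {G : Type*} [Group G] {S : Subgroup G}

/-- Inclusion of fusion systems over the same group. -/
instance : PartialOrder (FusionSystem S) where
  le E F := ∀ P Q, E.Hom P Q ⊆ F.Hom P Q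
  le_refl _ _ _ := subset_rfl
  le_trans _ _ _ h h' P Q := (h P Q).trans (h' P Q)
  le_antisymm E F h h' := by
    ext P Q φ
    exact ⟨fun hφ => h P Q hφ, fun hφ => h' P Q hφ⟩

theorem id_mem (F : FusionSystem S) {P : Subgroup G} (hP : P ≤ S) :
    MonoidHom.id P ∈ F.Hom P P := by
  have h := F.conj_mem hP hP 1 S.one_mem (by simp)
  convert h using 1
  ext x
  simp [conjHom]

theorem symm_mem (F : FusionSystem S) {P Q : Subgroup G} {e : P ≃* Q}
    (he : e.toMonoidHom ∈ F.Hom P Q) : e.symm.toMonoidHom ∈ F.Hom Q P := by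
  obtain ⟨R, hR, e', -, h, heq⟩ := F.factor he
  have hx : ∀ x : P, (e x : G) = e' x := fun x =>
    congrArg Subtype.val (DFunLike.congr_fun heq x)
  obtain rfl : R = Q := by
    refine le_antisymm hR fun y hy => ?_
    have := hx (e.symm ⟨y, hy⟩)
    rw [MulEquiv.apply_symm_apply] at this
    exact Set.mem_of_eq_of_mem this (e' _).2
  obtain rfl : e = e' := MulEquiv.ext fun x => Subtype.ext (hx x)
  exact h

/-- `Aut_F(P)`. -/
def aut (F : FusionSystem S) (P : Subgroup G) (hP : P ≤ S) : Subgroup (MulAut P) where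
  carrier := {α | α.toMonoidHom ∈ F.Hom P P}
  one_mem' := F.id_mem hP
  mul_mem' := fun ha hb => F.comp_mem ha hb
  inv_mem' := fun ha => F.symm_mem ha

/-- `P` and `Q` are `F`-conjugate. -/
def IsConj (F : FusionSystem S) (P Q : Subgroup G) : Prop :=
  ∃ e : P ≃* Q, e.toMonoidHom ∈ F.Hom P Q

/-- `P ≤ S` is fully centralized in `F`. -/
def FullyCentralized (p : ℕ) (F : FusionSystem S) (P : Subgroup G) : Prop :=
  P ≤ S ∧ ∀ Q, F.IsConj P Q →
    toralOrder p (centralizerIn S Q) ≤ toralOrder p (centralizerIn S P)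

/-- `P ≤ S` is fully normalized in `F`. -/
def FullyNormalized (p : ℕ) (F : FusionSystem S) (P : Subgroup G) : Prop :=
  P ≤ S ∧ ∀ Q, F.IsConj P Q →
    toralOrder p (normalizerIn S Q) ≤ toralOrder p (normalizerIn S P)

/-- Saturation of a fusion system over a discrete `p`-toral group. -/
structure Saturated (p : ℕ) (F : FusionSystem S) : Prop where
  /-- Axiom (I): fully normalized subgroups are fully centralized, with `Out_F(P)` finite and
  `Out_S(P)` one of its Sylow `p`-subgroups. -/
  sylow : ∀ (P : Subgroup G) (hP : P ≤ S), F.FullyNormalized p P →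
    F.FullyCentralized p P ∧ Finite (outImage (F.aut P hP)) ∧
      IsSylowIn p (outImage (autIn S P)) (outImage (F.aut P hP))
  /-- Axiom (II): if `φ(P)` is fully centralized, then `φ` extends to `N_φ`. -/
  extend : ∀ (P : Subgroup G) (φ : P →* S) (hφ : φ ∈ F.Hom P S),
    F.FullyCentralized p (imageOf φ P) →
    ∃ ψ ∈ F.Hom (extensionDomain φ (F.injective hφ)) S,
      ∀ (x : G) (hx : x ∈ P) (hx' : x ∈ extensionDomain φ (F.injective hφ)),
        ψ ⟨x, hx'⟩ = φ ⟨x, hx⟩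
  /-- Axiom (III): closure under unions of increasing sequences. -/
  union : ∀ (P : ℕ → Subgroup G), Monotone P → (∀ n, P n ≤ S) →
    ∀ φ : (⨆ n, P n : Subgroup G) →* S,
      (∀ n, φ.comp (Subgroup.inclusion (le_iSup P n)) ∈ F.Hom (P n) S) →
      φ ∈ F.Hom (⨆ n, P n) S

/-! ### Normal subsystems -/

/-- `P ≤ S` is strongly closed in `F`. -/
def StronglyClosed (F : FusionSystem S) (P : Subgroup G) : Prop :=
  P ≤ S ∧ ∀ g ∈ P, ∀ φ ∈ F.Hom (Subgroup.zpowers g) S,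
    (φ ⟨g, Subgroup.mem_zpowers g⟩ : G) ∈ P

/-- `(S', E)` is a subsystem of `(S, F)`. -/
def IsSubsystem {S' : Subgroup G} (E : FusionSystem S') (F : FusionSystem S) : Prop :=
  S' ≤ S ∧ ∀ P Q, E.Hom P Q ⊆ F.Hom P Q

/-- The subsystem `(S', E)` of `(S, F)` is normal in the sense of Aschbacher. -/
structure IsNormalIn (p : ℕ) {S' : Subgroup G} (E : FusionSystem S') (F : FusionSystem S) :
    Prop where
  subsystem : E.IsSubsystem F
  /-- (N1) -/
  stronglyClosed : F.StronglyClosed S'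
  /-- (N2) -/
  invariant : ∀ (P Q : Subgroup G) (hPQ : P ≤ Q), Q ≤ S' → ∀ (γ : Q →* S) (hγ : γ ∈ F.Hom Q S),
    Set.BijOn (conjugateHom γ (F.injective hγ) hPQ) (E.Hom P Q)
      (E.Hom (imageOf γ P) (imageOf γ Q))
  /-- (N3) -/
  saturated : E.Saturated p
  /-- (N4); here `Z(S') = C_{S'}(S')`. -/
  extension : ∀ f : MulAut S', f.toMonoidHom ∈ E.Hom S' S' →
    ∃ f' : MulAut (S' ⊔ centralizerIn S S' : Subgroup G),
      f'.toMonoidHom ∈ F.Hom (S' ⊔ centralizerIn S S') (S' ⊔ centralizerIn S S') ∧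
      (∀ x : S', (f' ⟨x, Subgroup.mem_sup_left x.2⟩ : G) = f x) ∧
      ∀ g : centralizerIn S S',
        (f' ⟨g, Subgroup.mem_sup_right g.2⟩ : G) * (g : G)⁻¹ ∈ centralizerIn S' S'

/-! ### Subsystems of index prime to `p` -/

/-- `E` is a saturated subsystem of `F` of index prime to `p`: it is over the same group `S`, and
`Aut_E(P) ≥ O^{p'}(Aut_F(P))` for all `P ≤ S`. -/
structure HasIndexPrimeTo (p : ℕ) (E F : FusionSystem S) : Prop where
  le : E ≤ F
  saturated : E.Saturated p
  residual_le : ∀ (P : Subgroup G) (hP : P ≤ S),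
    (pPrimeResidual p (F.aut P hP)).map (F.aut P hP).subtype ≤ E.aut P hP

/-- `O^{p'}(F)`: the intersection of all saturated subsystems of `F` of index prime to `p`. That
this intersection is itself one of them is not part of the definition. -/
def minimalIndexPrimeTo (p : ℕ) (F : FusionSystem S) : FusionSystem S where
  Hom P Q := {φ | φ ∈ F.Hom P Q ∧ ∀ E : FusionSystem S, E.HasIndexPrimeTo p F → φ ∈ E.Hom P Q}
  le_of_mem h := F.le_of_mem h.1
  injective h := F.injective h.1
  conj_mem hP hQ g hg h :=
    ⟨F.conj_mem hP hQ g hg h, fun E _ => E.conj_mem hP hQ g hg h⟩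
  comp_mem h h' := ⟨F.comp_mem h.1 h'.1, fun E hE => E.comp_mem (h.2 E hE) (h'.2 E hE)⟩
  factor := by
    rintro P Q φ ⟨hF, hE⟩
    obtain ⟨R, hR, e, h, -, rfl⟩ := F.factor hF
    have key : ∀ E : FusionSystem S, E.HasIndexPrimeTo p F → e.toMonoidHom ∈ E.Hom P R := by
      intro E hEF
      obtain ⟨R', hR', e', h', -, heq⟩ := E.factor (hE E hEF)
      have hx : ∀ x : P, (e x : G) = e' x := fun x =>
        congrArg Subtype.val (DFunLike.congr_fun heq x)
      obtain rfl : R' = R := by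
        ext y
        constructor
        · intro hy
          have := hx (e'.symm ⟨y, hy⟩)
          rw [MulEquiv.apply_symm_apply] at this
          exact Set.mem_of_eq_of_mem this.symm (e _).2
        · intro hy
          have := hx (e.symm ⟨y, hy⟩)
          rw [MulEquiv.apply_symm_apply] at this
          exact Set.mem_of_eq_of_mem this (e' _).2
      obtain rfl : e = e' := MulEquiv.ext fun x => Subtype.ext (hx x)
      exact h'
    exact ⟨R, hR, e, ⟨h, key⟩, ⟨F.symm_mem h, fun E hEF => E.symm_mem (key E hEF)⟩, rfl⟩

end FusionSystem

end

noncomputable section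

/-! ### The residual `O^{p'}` and Sylow subgroups -/

section Residual

variable {p : ℕ}

/-! The smallest subsystem is built explicitly and then shown to be saturated. Let `Estar` be the
composites of restrictions of elements of O^{p'}(Aut_F(Q)), with Q centric. A Frattini argument
(`Saturated.frattini`) writes every morphism of F as a ∘ φ with a ∈ Aut_F(S) and φ in `Estar`, and
Aut_F(S) normalizes `Estar`. It remains to see which a are forced. If E has index prime to p and a ∈
Aut_F(S) restricts to a morphism of E on one centric subgroup, then a lies in E
(`HasIndexPrimeTo.mor_self`). So `AutMin` is generated by the a whose restriction to some centric
subgroup is in `Estar`, and `minSystem` consists of the composites a ∘ φ with a in `AutMin`. Every E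
contains it, and it contains the residuals of all subgroups (`Saturated.estar_of_res`). Once
saturated, it is therefore the intersection of all E.

Saturation. Axiom (I) passes down from F, because a subgroup fully normalized in `minSystem` is so
in F by the Frattini factorization. Axiom (III) follows from finiteness of heights (see below).
Axiom (II) is the main work (`Saturated.extendsToNormalizers`). An extension in F has the form α ∘
φ, and α has to be replaced on φ(N) by a morphism of the minimal system with the same restriction to
R = φ(P). First, α|R is extended within the minimal system to the centric subgroup R C_S(R)
(`Saturated.extendsToCentralizer`), using axiom (II) for subgroups of smaller height. Then a Sylow
argument among the automorphisms of R C_S(R) which act on R like elements of φ(N) pushes the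
extension up to φ(N) (`Saturated.exists_morMin_of_extendsToCentralizer`).

Induction. Since S may be infinite, induction on the index of a subgroup is not available. Each P is
enlarged by a divisible subgroup of the torus to a closure P•. Morphisms extend uniquely to
closures, and only finitely many orders of closed subgroups occur. The `height` of P counts the
admissible orders above that of P•, and all inductions run on it. Iterated normalizers of P inside
P• need only exhaust P• in the limit; axiom (III) bridges that gap.

Normality. The subsystem lives over S itself, so (N1) and (N4) are easy, and (N2) holds because
Aut_F(S) and `Estar` both normalize the minimal system.

Morphisms are handled as functions G → G constrained only on their source (`Mor`), so that
restriction and composition involve no change of type. -/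

instance pPrimeResidual_normal (p : ℕ) (A : Type*) [Group A] : (pPrimeResidual p A).Normal := by
  constructor
  intro n hn g
  simp only [pPrimeResidual, Subgroup.mem_sInf] at hn ⊢
  exact fun K hK => hK.1.conj_mem n (hn K hK) g

theorem map_pPrimeResidual_le {A B : Type*} [Group A] [Group B] (f : A →* B) :
    (pPrimeResidual p A).map f ≤ pPrimeResidual p B := by
  rintro _ ⟨a, ha, rfl⟩
  simp only [pPrimeResidual, SetLike.mem_coe, Subgroup.mem_sInf] at ha ⊢
  rintro K ⟨hK, hfin, hcop⟩
  have hdvd : (K.comap f).index ∣ K.index := by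
    rw [Subgroup.index_comap]
    exact Subgroup.relIndex_dvd_index_of_normal K f.range
  refine ha (K.comap f) ⟨hK.comap f, ⟨?_⟩, hcop.coprime_dvd_right hdvd⟩
  intro h0
  rw [h0] at hdvd
  exact hfin.index_ne_zero (Nat.eq_zero_of_zero_dvd hdvd)

/-- In a quotient of finite order prime to p the image of a p-element has order dividing two coprime
numbers. -/
theorem IsPGroup.le_pPrimeResidual {A : Type*} [Group A] [Fact p.Prime] {U : Subgroup A}
    (hU : IsPGroup p U) : U ≤ pPrimeResidual p A := by
  intro u hu
  simp only [pPrimeResidual, Subgroup.mem_sInf]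
  rintro K ⟨hK, hfin, hcop⟩
  obtain ⟨k, hk⟩ := hU ⟨u, hu⟩
  have h1 : (u : A ⧸ K) ^ p ^ k = 1 := by
    rw [← QuotientGroup.mk_pow]
    have : u ^ p ^ k = 1 := by simpa using congrArg Subtype.val hk
    rw [this]; rfl
  have h2 : (u : A ⧸ K) ^ K.index = 1 := by
    rw [Subgroup.index_eq_card]; exact pow_card_eq_one'
  have h3 : (u : A ⧸ K) ^ (Nat.gcd (p ^ k) K.index) = 1 := by
    exact orderOf_dvd_iff_pow_eq_one.mp
      (Nat.dvd_gcd (orderOf_dvd_of_pow_eq_one h1) (orderOf_dvd_of_pow_eq_one h2))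
  rw [(hcop.pow_left k).gcd_eq_one, pow_one] at h3
  exact (QuotientGroup.eq_one_iff u).mp h3

/-- `A` has a normal `p`-subgroup of finite index. -/
def IsPByFinite (p : ℕ) (A : Type*) [Group A] : Prop :=
  ∃ I : Subgroup A, I.Normal ∧ IsPGroup p I ∧ I.FiniteIndex

theorem IsPByFinite.of_injective {A B : Type*} [Group A] [Group B] (hB : IsPByFinite p B)
    (f : A →* B) (hf : Function.Injective f) : IsPByFinite p A := by
  obtain ⟨I, hI, hp, hfin⟩ := hB
  refine ⟨I.comap f, hI.comap f, hp.comap_of_injective f hf, ⟨fun h0 => ?_⟩⟩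
  rw [Subgroup.index_comap] at h0
  have hdvd := Subgroup.relIndex_dvd_index_of_normal I f.range
  rw [h0] at hdvd
  exact hfin.index_ne_zero (Nat.eq_zero_of_zero_dvd hdvd)

theorem IsPByFinite.finite_sylow {A : Type*} [Group A] (hA : IsPByFinite p A) :
    Finite (Sylow p A) := by
  obtain ⟨I, hI, hp, hfin⟩ := hA
  have : Finite (A ⧸ I) := inferInstance
  exact Sylow.finite_of_ker_is_pGroup (f := QuotientGroup.mk' I) (by rwa [QuotientGroup.ker_mk'])

theorem IsPByFinite.finiteIndex_pPrimeResidual {A : Type*} [Group A] [Fact p.Prime]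
    (hA : IsPByFinite p A) : (pPrimeResidual p A).FiniteIndex := by
  obtain ⟨I, hI, hp, hfin⟩ := hA
  exact Subgroup.finiteIndex_of_le hp.le_pPrimeResidual

/-- An element of order p in A / O^{p'}(A), given by Cauchy, would survive in some A / K of order
prime to p. Finiteness of the quotient comes from the normal p-subgroup of finite index, which the
residual contains. -/
theorem IsPByFinite.coprime_index {A : Type*} [Group A] [hp : Fact p.Prime]
    (hA : IsPByFinite p A) : p.Coprime (pPrimeResidual p A).index := by
  have hfin := hA.finiteIndex_pPrimeResidual
  rw [Nat.Prime.coprime_iff_not_dvd hp.out]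
  intro hdvd
  rw [Subgroup.index_eq_card] at hdvd
  obtain ⟨x, hx⟩ := exists_prime_orderOf_dvd_card' p hdvd
  obtain ⟨a, rfl⟩ := QuotientGroup.mk_surjective x
  have hne : a ∉ pPrimeResidual p A := by
    intro ha
    rw [(QuotientGroup.eq_one_iff a).mpr ha, orderOf_one] at hx
    exact hp.out.one_lt.ne hx
  have hpow : a ^ p ∈ pPrimeResidual p A := by
    rw [← QuotientGroup.eq_one_iff, QuotientGroup.mk_pow]
    exact orderOf_dvd_iff_pow_eq_one.mp hx.dvd
  simp only [pPrimeResidual, Subgroup.mem_sInf] at hne hpow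
  push Not at hne
  obtain ⟨K, ⟨hK, hKf, hKc⟩, haK⟩ := hne
  have h1 : (a : A ⧸ K) ^ p = 1 := by
    rw [← QuotientGroup.mk_pow, QuotientGroup.eq_one_iff]; exact hpow K ⟨hK, hKf, hKc⟩
  have h2 : (a : A ⧸ K) ^ K.index = 1 := by
    rw [Subgroup.index_eq_card]; exact pow_card_eq_one'
  have h3 : (a : A ⧸ K) ^ (Nat.gcd p K.index) = 1 :=
    orderOf_dvd_iff_pow_eq_one.mp
      (Nat.dvd_gcd (orderOf_dvd_of_pow_eq_one h1) (orderOf_dvd_of_pow_eq_one h2))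
  rw [hKc.gcd_eq_one, pow_one] at h3
  exact haK ((QuotientGroup.eq_one_iff a).mp h3)

/-- Here O^{p'}(A) itself has finite index prime to p, so its image is one of the subgroups whose
intersection defines O^{p'}(B). -/
theorem IsPByFinite.pPrimeResidual_le_map {A B : Type*} [Group A] [Group B] [Fact p.Prime]
    (hA : IsPByFinite p A) (f : A →* B) (hf : Function.Surjective f) :
    pPrimeResidual p B ≤ (pPrimeResidual p A).map f := by
  have hfin := hA.finiteIndex_pPrimeResidual
  have hdvd : ((pPrimeResidual p A).map f).index ∣ (pPrimeResidual p A).index :=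
    Subgroup.index_map_dvd _ hf
  refine sInf_le ⟨Subgroup.Normal.map inferInstance f hf, ⟨fun h0 => ?_⟩,
    hA.coprime_index.coprime_dvd_right hdvd⟩
  rw [h0] at hdvd
  exact hfin.index_ne_zero (Nat.eq_zero_of_zero_dvd hdvd)

open scoped Pointwise in
/-- A `p`-subgroup is conjugate into any maximal `p`-subgroup, by an element of `O^{p'}`. -/
theorem IsPByFinite.exists_conj_mem {A : Type*} [Group A] [Fact p.Prime] (hA : IsPByFinite p A)
    {U V : Subgroup A} (hU : IsPGroup p U) (hV : IsPGroup p V)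
    (hmax : ∀ W : Subgroup A, IsPGroup p W → V ≤ W → W = V) :
    ∃ κ ∈ pPrimeResidual p A, ∀ u ∈ U, κ * u * κ⁻¹ ∈ V := by
  have := hA.finite_sylow
  obtain ⟨U', hU'⟩ := hU.exists_le_sylow
  let V' : Sylow p A := ⟨V, hV, fun {W} hW h => hmax W hW h⟩
  have hUO : (U' : Subgroup A) ≤ pPrimeResidual p A := U'.isPGroup'.le_pPrimeResidual
  have hVO : (V' : Subgroup A) ≤ pPrimeResidual p A := hV.le_pPrimeResidual
  -- All p-subgroups lie in the residual, so Sylow's theorem can be applied inside it; this is what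
  -- makes the conjugating element residual.
  obtain ⟨κ, hκ⟩ := MulAction.exists_smul_eq (pPrimeResidual p A)
    (U'.subtype hUO) (V'.subtype hVO)
  refine ⟨κ, κ.2, fun u hu => ?_⟩
  rw [Sylow.smul_subtype hUO] at hκ
  have h2 : κ • U' = V' := Sylow.subtype_injective hκ
  have h3 : (κ : A) * u * (κ : A)⁻¹ ∈ ((κ • U' : Sylow p A) : Subgroup A) := by
    change _ ∈ MulAut.conj (κ : A) • (U' : Subgroup A)
    rw [Subgroup.mem_pointwise_smul_iff_inv_smul_mem]
    simpa [← map_inv, mul_assoc] using hU' hu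
  rw [h2] at h3
  exact h3

/-- `O^{p'}(M)` as a subgroup of the ambient group. -/
def residualIn (p : ℕ) {X : Type*} [Group X] (M : Subgroup X) : Subgroup X :=
  (pPrimeResidual p M).map M.subtype

theorem residualIn_le {X : Type*} [Group X] (M : Subgroup X) : residualIn p M ≤ M := by
  rintro _ ⟨x, -, rfl⟩
  exact x.2

theorem residualIn_mono {X : Type*} [Group X] {M N : Subgroup X} (h : M ≤ N) :
    residualIn p M ≤ residualIn p N := by
  rintro _ ⟨x, hx, rfl⟩
  exact ⟨Subgroup.inclusion h x, map_pPrimeResidual_le _ ⟨x, hx, rfl⟩, rfl⟩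

theorem residualIn_conj_mem {X : Type*} [Group X] {M : Subgroup X} {x g : X}
    (hx : x ∈ residualIn p M) (hg : g ∈ M) : g * x * g⁻¹ ∈ residualIn p M := by
  obtain ⟨y, hy, rfl⟩ := hx
  exact ⟨⟨g, hg⟩ * y * ⟨g, hg⟩⁻¹, (pPrimeResidual_normal p M).conj_mem y hy _, rfl⟩

theorem map_mem_residualIn {X Y : Type*} [Group X] [Group Y] {M : Subgroup X} {N : Subgroup Y}
    (f : M →* Y) (hf : ∀ x, f x ∈ N) {x : X} (hx : x ∈ residualIn p M) :
    f ⟨x, residualIn_le M hx⟩ ∈ residualIn p N := by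
  obtain ⟨y, hy, rfl⟩ := hx
  exact ⟨f.codRestrict N hf y, map_pPrimeResidual_le (f.codRestrict N hf) ⟨y, hy, rfl⟩, rfl⟩

theorem IsPGroup.le_residualIn {X : Type*} [Group X] [Fact p.Prime] {U M : Subgroup X}
    (hU : IsPGroup p U) (h : U ≤ M) : U ≤ residualIn p M := by
  intro u hu
  refine ⟨⟨u, h hu⟩, ?_, rfl⟩
  exact (hU.comap_of_injective M.subtype M.subtype_injective).le_pPrimeResidual hu

theorem IsPByFinite.subgroup {X : Type*} [Group X] {M N : Subgroup X} (hN : IsPByFinite p N)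
    (h : M ≤ N) : IsPByFinite p M :=
  hN.of_injective (Subgroup.inclusion h) (Subgroup.inclusion_injective h)

/-- The source of all corrections by residual automorphisms below: a p-group of automorphisms is
moved into a chosen maximal one at the cost of an element of O^{p'}(M). -/
theorem IsPByFinite.exists_residualIn_conj {X : Type*} [Group X] [Fact p.Prime]
    {U V M : Subgroup X} (hM : IsPByFinite p M) (hU : IsPGroup p U) (hUM : U ≤ M)
    (hV : IsPGroup p V) (hVM : V ≤ M)
    (hmax : ∀ W : Subgroup X, IsPGroup p W → W ≤ M → V ≤ W → W ≤ V) :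
    ∃ κ ∈ residualIn p M, ∀ u ∈ U, κ * u * κ⁻¹ ∈ V := by
  obtain ⟨κ, hκ, h⟩ := hM.exists_conj_mem (U := U.subgroupOf M) (V := V.subgroupOf M)
    (hU.comap_of_injective _ M.subtype_injective) (hV.comap_of_injective _ M.subtype_injective)
    (by
      intro W hW hVW
      refine le_antisymm ?_ hVW
      rw [← Subgroup.map_subtype_le_map_subtype, Subgroup.subgroupOf_map_subtype,
        inf_eq_left.mpr hVM]
      refine hmax _ (hW.map _) (Subgroup.map_subtype_le W) ?_
      rintro v hv
      exact ⟨⟨v, hVM hv⟩, hVW hv, rfl⟩)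
  exact ⟨κ, ⟨κ, hκ, rfl⟩, fun u hu => h ⟨u, hUM hu⟩ hu⟩

theorem IsPGroup.exists_maximal_le {X : Type*} [Group X] {M : Subgroup X} :
    ∃ V : Subgroup X, IsPGroup p V ∧ V ≤ M ∧
      ∀ W : Subgroup X, IsPGroup p W → W ≤ M → V ≤ W → W ≤ V := by
  obtain ⟨V⟩ : Nonempty (Sylow p M) := inferInstance
  refine ⟨(V : Subgroup M).map M.subtype, V.isPGroup'.map _, Subgroup.map_subtype_le _, ?_⟩
  intro W hW hWM hVW
  have h : W.subgroupOf M = V := V.is_maximal' (hW.comap_of_injective _ M.subtype_injective)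
    (fun x hx => hVW ⟨x, hx, rfl⟩)
  intro w hw
  exact ⟨⟨w, hWM hw⟩, h ▸ hw, rfl⟩

/-- The lifting property of residuals along a surjection between subgroups. -/
theorem IsPByFinite.exists_mem_residualIn {X Y : Type*} [Group X] [Group Y] [Fact p.Prime]
    {M : Subgroup X} {N : Subgroup Y} (hM : IsPByFinite p M) (f : M →* Y) (hf : ∀ x, f x ∈ N)
    (hsurj : ∀ y ∈ N, ∃ x, f x = y) {y : Y} (hy : y ∈ residualIn p N) :
    ∃ x : M, (x : X) ∈ residualIn p M ∧ f x = y := by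
  obtain ⟨y, hy, rfl⟩ := hy
  obtain ⟨x, hx, hxy⟩ := hM.pPrimeResidual_le_map (f.codRestrict N hf) (fun z => by
    obtain ⟨x, hx⟩ := hsurj z z.2
    exact ⟨x, Subtype.ext hx⟩) hy
  exact ⟨x, ⟨x, hx, rfl⟩, congrArg Subtype.val hxy⟩

end Residual

/-! ### Restriction of automorphisms -/

section Restrict

variable {G : Type*} [Group G]

/-- The automorphisms of `Y` which restrict to automorphisms of `R`. -/
def stabilizerAut (Y R : Subgroup G) : Subgroup (MulAut Y) where
  carrier := {β | ∀ x : Y, (x : G) ∈ R ↔ (β x : G) ∈ R}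
  one_mem' := fun _ => Iff.rfl
  mul_mem' := fun {a b} ha hb x => (hb x).trans (ha (b x))
  inv_mem' := fun {a} ha x => by
    have := ha (a⁻¹ x)
    rw [MulAut.apply_inv_self] at this
    exact this.symm

/-- Restriction to `R` of the automorphisms of `Y ≥ R` stabilizing `R`. -/
def restrictAut (Y R : Subgroup G) (h : R ≤ Y) : stabilizerAut Y R →* MulAut R where
  toFun β :=
    { toFun := fun x => ⟨β.1 ⟨x, h x.2⟩, (β.2 ⟨x, h x.2⟩).mp x.2⟩
      invFun := fun x => ⟨β⁻¹.1 ⟨x, h x.2⟩, (β⁻¹.2 ⟨x, h x.2⟩).mp x.2⟩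
      left_inv := fun x => by
        apply Subtype.ext
        simp [Subtype.coe_eta]
      right_inv := fun x => by
        apply Subtype.ext
        simp [Subtype.coe_eta]
      map_mul' := fun x y => by
        apply Subtype.ext
        exact congrArg (fun z : Y => (z : G)) (map_mul β.1 ⟨x, h x.2⟩ ⟨y, h y.2⟩) }
  map_one' := rfl
  map_mul' := fun _ _ => rfl

end Restrict

end

noncomputable section

/-! ### Divisible abelian `p`-groups with finite socle -/

section Divisible

variable {p : ℕ}

/-- Write n = p^k m. Division by p^k is given, and m is invertible modulo the order p^l of the
element by Bézout. -/
theorem exists_nsmul_eq_of_divisible [hp : Fact p.Prime] {B : Type*} [AddCommGroup B]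
    (ht : ∀ b : B, ∃ k : ℕ, p ^ k • b = 0) (hd : ∀ b : B, ∃ c, p • c = b) {n : ℕ} (hn : n ≠ 0)
    (b : B) : ∃ c, n • c = b := by
  obtain ⟨k, m, hm, rfl⟩ := Nat.exists_eq_pow_mul_and_not_dvd hn p hp.out.ne_one
  have hpow : ∀ (k : ℕ) (b : B), ∃ c, p ^ k • c = b := by
    intro k
    induction k with
    | zero => exact fun b => ⟨b, by simp⟩
    | succ k ih =>
      intro b
      obtain ⟨c, rfl⟩ := hd b
      obtain ⟨d, rfl⟩ := ih c
      exact ⟨d, by rw [pow_succ', mul_smul]⟩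
  obtain ⟨c, rfl⟩ := hpow k b
  obtain ⟨l, hl⟩ := ht c
  have hcop : Nat.Coprime m (p ^ l) :=
    ((Nat.Prime.coprime_iff_not_dvd hp.out).mpr hm).symm.pow_right l
  have hb := Nat.gcd_eq_gcd_ab m (p ^ l)
  rw [hcop.gcd_eq_one] at hb
  refine ⟨(Nat.gcdA m (p ^ l)) • c, ?_⟩
  have h1 : ((m : ℤ) * Nat.gcdA m (p ^ l)) • c = c := by
    have h2 : ((m : ℤ) * Nat.gcdA m (p ^ l)) = 1 - Nat.gcdB m (p ^ l) * ((p ^ l : ℕ) : ℤ) := by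
      push_cast at hb ⊢
      linarith
    rw [h2, sub_smul, mul_smul, natCast_zsmul, hl, smul_zero, one_smul, sub_zero]
  rw [mul_smul, ← natCast_zsmul (n := m), ← mul_smul, h1]

theorem nonempty_addEquiv_of_card_eq [hp : Fact p.Prime] {V W : Type*} [AddCommGroup V]
    [AddCommGroup W] [Finite V] [Finite W] (hV : ∀ x : V, p • x = 0) (hW : ∀ x : W, p • x = 0)
    (hcard : Nat.card V = Nat.card W) : Nonempty (V ≃+ W) := by
  have key : ∀ (_ : Module (ZMod p) V) (_ : Module (ZMod p) W), Nonempty (V ≃+ W) := by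
    intro iV iW
    have h1 := FiniteField.pow_finrank_eq_natCard p V
    have h2 := FiniteField.pow_finrank_eq_natCard p W
    have h3 : Module.finrank (ZMod p) V = Module.finrank (ZMod p) W :=
      Nat.pow_right_injective hp.out.two_le (h1.trans (hcard.trans h2.symm))
    have fV : Module.Finite (ZMod p) V := Module.Finite.of_finite
    have fW : Module.Finite (ZMod p) W := Module.Finite.of_finite
    exact ⟨(@LinearEquiv.ofFinrankEq (ZMod p) V W _ _ iV _ _ iW _ _ fV fW h3).toAddEquiv⟩
  exact key (AddCommGroup.zmodModule hV) (AddCommGroup.zmodModule hW)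

/-- Divisible groups are injective, so an isomorphism of the p-torsion subgroups extends to A → B.
The extension is injective because every nonzero element has a nonzero multiple killed by p, and
surjective by induction on the exponent of the target element. -/
theorem nonempty_addEquiv_of_divisible [hp : Fact p.Prime] {A B : Type*} [AddCommGroup A]
    [AddCommGroup B] (hAt : ∀ a : A, ∃ k : ℕ, p ^ k • a = 0) (hAd : ∀ a : A, ∃ c, p • c = a)
    (hBt : ∀ b : B, ∃ k : ℕ, p ^ k • b = 0) (hBd : ∀ b : B, ∃ c, p • c = b)
    [Finite (nsmulAddMonoidHom (α := A) p).ker] [Finite (nsmulAddMonoidHom (α := B) p).ker]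
    (hcard : Nat.card (nsmulAddMonoidHom (α := A) p).ker =
      Nat.card (nsmulAddMonoidHom (α := B) p).ker) : Nonempty (A ≃+ B) := by
  let A' := (nsmulAddMonoidHom (α := A) p).ker
  let B' := (nsmulAddMonoidHom (α := B) p).ker
  obtain ⟨e⟩ : Nonempty (A' ≃+ B') := nonempty_addEquiv_of_card_eq (p := p)
    (fun x => Subtype.ext x.2) (fun x => Subtype.ext x.2) hcard
  let _ : DivisibleBy B ℕ := divisibleByOfSMulRightSurj B ℕ
    fun hn b => exists_nsmul_eq_of_divisible hBt hBd hn b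
  let _ : DivisibleBy B ℤ := AddGroup.divisibleByIntOfDivisibleByNat B
  obtain ⟨f, hf⟩ := (Module.Baer.of_divisible B).extension_property_addMonoidHom
    A'.subtype A'.subtype_injective (B'.subtype.comp e.toAddMonoidHom)
  have hfe : ∀ x : A', f x = e x := fun x => DFunLike.congr_fun hf x
  have hmin : ∀ a : A, a ≠ 0 → ∃ k : ℕ, p ^ k • a ≠ 0 ∧ p • (p ^ k • a) = 0 := by
    intro a ha
    classical
    have hk := Nat.find_spec (hAt a)
    have hk0 : Nat.find (hAt a) ≠ 0 := by
      intro h0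
      rw [h0, pow_zero, one_smul] at hk
      exact ha hk
    obtain ⟨k, hk1⟩ := Nat.exists_eq_succ_of_ne_zero hk0
    refine ⟨k, Nat.find_min (hAt a) (by omega), ?_⟩
    rw [smul_smul, ← pow_succ', ← Nat.succ_eq_add_one, ← hk1]
    exact hk
  have hinj : Function.Injective f := by
    rw [injective_iff_map_eq_zero]
    intro a ha
    by_contra hne
    obtain ⟨k, hk1, hk2⟩ := hmin a hne
    have h3 := hfe ⟨p ^ k • a, hk2⟩
    rw [map_nsmul, ha, smul_zero] at h3
    have h4 : e ⟨p ^ k • a, hk2⟩ = 0 := Subtype.ext h3.symm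
    rw [map_eq_zero_iff e e.injective] at h4
    exact hk1 (congrArg Subtype.val h4)
  have hsurj : ∀ (k : ℕ) (b : B), p ^ k • b = 0 → ∃ a, f a = b := by
    intro k
    induction k with
    | zero => exact fun b hb => ⟨0, by simpa using hb.symm⟩
    | succ k ih =>
      intro b hb
      have hb' : p • (p ^ k • b) = 0 := by rw [smul_smul, ← pow_succ', hb]
      obtain ⟨c, hc⟩ := exists_nsmul_eq_of_divisible hAt hAd (pow_ne_zero k hp.out.ne_zero)
        ((e.symm ⟨p ^ k • b, hb'⟩ : A') : A)
      have h5 : p ^ k • f c = p ^ k • b := by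
        rw [← map_nsmul, hc, hfe, AddEquiv.apply_symm_apply]
      obtain ⟨a, ha⟩ := ih (b - f c) (by rw [smul_sub, h5, sub_self])
      exact ⟨a + c, by rw [map_add, ha, sub_add_cancel]⟩
  exact ⟨AddEquiv.ofBijective f ⟨hinj, fun b => by
    obtain ⟨k, hk⟩ := hBt b
    exact hsurj k b hk⟩⟩

theorem exists_pow_eq_pruferGroup [hp : Fact p.Prime] (z : PruferGroup p) : ∃ w, w ^ p = z := by
  obtain ⟨z, k, hk⟩ := z
  obtain ⟨t, rfl⟩ := Circle.exp_surjective z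
  have h : Circle.exp (t / p) ^ p = Circle.exp t := by
    rw [← Circle.exp_nsmul, nsmul_eq_mul, mul_div_cancel₀]
    exact_mod_cast hp.out.ne_zero
  exact ⟨⟨Circle.exp (t / p), k + 1, by rw [pow_succ', pow_mul, h]; exact hk⟩, Subtype.ext h⟩

theorem card_pow_eq_one_pruferGroup [hp : Fact p.Prime] :
    Nat.card {z : PruferGroup p // z ^ p = 1} = p := by
  have : NeZero p := ⟨hp.out.ne_zero⟩
  have h : Nat.card (rootsOfUnity p Circle) = p := by
    rw [Nat.card_congr (rootsOfUnityCircleEquiv p).toEquiv, Complex.card_rootsOfUnity p]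
  conv_rhs => rw [← h]
  refine Nat.card_congr
    { toFun := fun z => ⟨toUnits z.1.1, ?_⟩
      invFun := fun z => ⟨⟨((z.1 : Circleˣ) : Circle), 1, ?_⟩, ?_⟩
      left_inv := fun z => ?_
      right_inv := fun z => ?_ }
  · rw [mem_rootsOfUnity, ← map_pow]
    have := congrArg Subtype.val z.2
    simp only [Subgroup.coe_pow, Subgroup.coe_one] at this
    rw [this, map_one]
  · have := z.2
    rw [mem_rootsOfUnity, Units.ext_iff, Units.val_pow_eq_pow_val] at this
    simpa using this
  · have := z.2
    rw [mem_rootsOfUnity, Units.ext_iff, Units.val_pow_eq_pow_val] at this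
    exact Subtype.ext this
  · rfl
  · apply Subtype.ext
    apply Units.ext
    rfl

end Divisible

end

noncomputable section

/-! ### Tori in discrete `p`-toral groups -/

section Torus

variable {G : Type*} [Group G] {p : ℕ}

/-- `D` is `p`-divisible. -/
def IsPDivisible (p : ℕ) (D : Subgroup G) : Prop := ∀ x ∈ D, ∃ y ∈ D, y ^ p = x

theorem IsPDivisible.exists_pow_eq {D : Subgroup G} (hD : IsPDivisible p D) (n : ℕ) {x : G}
    (hx : x ∈ D) : ∃ y ∈ D, y ^ p ^ n = x := by
  induction n generalizing x with
  | zero => exact ⟨x, hx, by simp⟩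
  | succ n ih =>
    obtain ⟨y, hy, rfl⟩ := hD x hx
    obtain ⟨z, hz, rfl⟩ := ih hy
    exact ⟨z, hz, by rw [pow_succ, pow_mul]⟩

/-- `T` is a normal discrete `p`-torus in `S`, of `p`-power index. -/
structure IsTorusIn (p : ℕ) (S T : Subgroup G) : Prop where
  le : T ≤ S
  conj_mem : ∀ g ∈ S, ∀ t ∈ T, g * t * g⁻¹ ∈ T
  comm : ∀ x ∈ T, ∀ y ∈ T, x * y = y * x
  divisible : IsPDivisible p T
  torsion : ∀ t ∈ T, ∃ k : ℕ, t ^ p ^ k = 1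
  finite : ∀ k : ℕ, {t | t ∈ T ∧ t ^ p ^ k = 1}.Finite
  index : ∃ m : ℕ, T.relIndex S = p ^ m

theorem finite_pow_eq_one_pruferGroup [hp : Fact p.Prime] (k : ℕ) :
    Finite {z : PruferGroup p // z ^ p ^ k = 1} := by
  have : NeZero (p ^ k) := ⟨pow_ne_zero k hp.out.ne_zero⟩
  refine Finite.of_injective
    (fun z => (⟨toUnits z.1.1, ?_⟩ : rootsOfUnity (p ^ k) Circle)) ?_
  · rw [mem_rootsOfUnity, ← map_pow]
    have := congrArg Subtype.val z.2
    simp only [Subgroup.coe_pow, Subgroup.coe_one] at this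
    rw [this, map_one]
  · intro z w h
    exact Subtype.ext (Subtype.ext (toUnits.injective (congrArg Subtype.val h)))

theorem IsDiscretePTorus.card_pow_eq_one [hp : Fact p.Prime] {X : Type*} [Group X] {r : ℕ}
    (h : IsDiscretePTorus p X r) : Nat.card {x : X // x ^ p = 1} = p ^ r := by
  obtain ⟨e⟩ := h
  have e1 : {x : X // x ^ p = 1} ≃ (Fin r → {z : PruferGroup p // z ^ p = 1}) :=
    { toFun := fun x i => ⟨e x.1 i, by
        have := congrFun (congrArg e x.2) i
        simpa using this⟩
      invFun := fun f => ⟨e.symm fun i => (f i).1, by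
        rw [← map_pow, MulEquiv.map_eq_one_iff]
        funext i
        exact (f i).2⟩
      left_inv := fun x => by simp
      right_inv := fun f => by simp }
  rw [Nat.card_congr e1, Nat.card_pi]
  simp [card_pow_eq_one_pruferGroup]

/-- The hypothesis that S is discrete p-toral enters the proof only through this elementwise list of
properties of its maximal torus. -/
theorem IsDiscretePToral.exists_isTorusIn [hp : Fact p.Prime] {S : Subgroup G}
    (hS : IsDiscretePToral p S) : ∃ T : Subgroup G, IsTorusIn p S T := by
  obtain ⟨T, hT, ⟨r, ⟨e⟩⟩, n, hn⟩ := hS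
  refine ⟨T.map S.subtype, ⟨Subgroup.map_subtype_le T, ?_, ?_, ?_, ?_, ?_, n, ?_⟩⟩
  · rintro g hg _ ⟨t, ht, rfl⟩
    exact ⟨⟨g, hg⟩ * t * ⟨g, hg⟩⁻¹, hT.conj_mem t ht _, rfl⟩
  · rintro _ ⟨x, hx, rfl⟩ _ ⟨y, hy, rfl⟩
    have : (⟨x, hx⟩ : T) * ⟨y, hy⟩ = ⟨y, hy⟩ * ⟨x, hx⟩ := by
      apply e.injective
      rw [map_mul, map_mul, mul_comm]
    exact congrArg (fun z : T => ((z : S) : G)) this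
  · rintro _ ⟨x, hx, rfl⟩
    choose w hw using fun i => exists_pow_eq_pruferGroup (e ⟨x, hx⟩ i)
    refine ⟨_, ⟨(e.symm w : T), (e.symm w).2, rfl⟩, ?_⟩
    have : (e.symm w) ^ p = ⟨x, hx⟩ := by
      rw [← map_pow, MulEquiv.symm_apply_eq]
      exact funext hw
    exact congrArg (fun z : T => ((z : S) : G)) this
  · rintro _ ⟨x, hx, rfl⟩
    choose k hk using fun i => (e ⟨x, hx⟩ i).2
    refine ⟨∑ i, k i, ?_⟩
    have : (⟨x, hx⟩ : T) ^ p ^ (∑ i, k i) = 1 := by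
      rw [← MulEquiv.map_eq_one_iff e, map_pow]
      funext i
      apply Subtype.ext
      have hdvd : p ^ k i ∣ p ^ (∑ i, k i) :=
        pow_dvd_pow p (Finset.single_le_sum (fun _ _ => Nat.zero_le _) (Finset.mem_univ i))
      obtain ⟨c, hc⟩ := hdvd
      have := hk i
      simp only [Pi.pow_apply, Subgroup.coe_pow, Pi.one_apply, Subgroup.coe_one]
      rw [hc, pow_mul, this, one_pow]
    exact congrArg (fun z : T => ((z : S) : G)) this
  · intro k
    have := finite_pow_eq_one_pruferGroup (p := p) k
    refine Set.Finite.subset (Set.finite_range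
      (fun f : Fin r → {z : PruferGroup p // z ^ p ^ k = 1} =>
        (((e.symm fun i => (f i).1 : T) : S) : G))) ?_
    rintro _ ⟨⟨x, hx, rfl⟩, hk⟩
    have h1 : (⟨x, hx⟩ : T) ^ p ^ k = 1 := Subtype.ext (Subtype.ext hk)
    refine ⟨fun i => ⟨e ⟨x, hx⟩ i, ?_⟩, ?_⟩
    · rw [← Pi.pow_apply, ← map_pow, h1, map_one, Pi.one_apply]
    · change (((e.symm (e ⟨x, hx⟩) : T) : S) : G) = x
      rw [MulEquiv.symm_apply_apply]
  · rw [Subgroup.relIndex, Subgroup.subgroupOf, Subgroup.comap_map_eq_self_of_injective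
      S.subtype_injective, hn]

namespace IsTorusIn

variable {S T : Subgroup G}

theorem subgroupOf_normal (hT : IsTorusIn p S T) : (T.subgroupOf S).Normal :=
  ⟨fun t ht g => hT.conj_mem g g.2 t ht⟩

theorem relIndex_ne_zero [hp : Fact p.Prime] (hT : IsTorusIn p S T) : T.relIndex S ≠ 0 := by
  obtain ⟨m, hm⟩ := hT.index
  rw [hm]
  exact pow_ne_zero m hp.out.ne_zero

/-- The exponent `m` with `[S : T] = p ^ m`. -/
def exponent (hT : IsTorusIn p S T) : ℕ := hT.index.choose

theorem pow_mem (hT : IsTorusIn p S T) {g : G} (hg : g ∈ S) : g ^ p ^ hT.exponent ∈ T := by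
  have := hT.subgroupOf_normal
  have h := Subgroup.pow_index_mem (H := T.subgroupOf S) ⟨g, hg⟩
  have h2 : (T.subgroupOf S).index = p ^ hT.exponent := hT.index.choose_spec
  rw [h2] at h
  exact h

theorem exists_pow_eq_one (hT : IsTorusIn p S T) {g : G} (hg : g ∈ S) :
    ∃ k : ℕ, g ^ p ^ k = 1 := by
  obtain ⟨k, hk⟩ := hT.torsion _ (hT.pow_mem hg)
  exact ⟨hT.exponent + k, by rw [pow_add, pow_mul, hk]⟩

theorem isPGroup (hT : IsTorusIn p S T) {H : Subgroup G} (hH : H ≤ S) : IsPGroup p H := by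
  intro g
  obtain ⟨k, hk⟩ := hT.exists_pow_eq_one (hH g.2)
  exact ⟨k, Subtype.ext hk⟩

/-- Every element of D is a p^m-th power in S, where p^m = [S : T], and such powers lie in T. -/
theorem le_of_divisible (hT : IsTorusIn p S T) {D : Subgroup G} (hD : IsPDivisible p D)
    (hDS : D ≤ S) : D ≤ T := by
  intro x hx
  obtain ⟨y, hy, rfl⟩ := hD.exists_pow_eq hT.exponent hx
  exact hT.pow_mem (hDS hy)

theorem mul_pow (hT : IsTorusIn p S T) {x y : G} (hx : x ∈ T) (hy : y ∈ T) (n : ℕ) :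
    (x * y) ^ n = x ^ n * y ^ n :=
  (show Commute x y from hT.comm x hx y hy).mul_pow n

/-- The subgroup of `n`-th powers of elements of a subgroup of the torus. -/
def powSubgroup (hT : IsTorusIn p S T) {A : Subgroup G} (hA : A ≤ T) (n : ℕ) : Subgroup G where
  carrier := {y | ∃ a ∈ A, a ^ n = y}
  one_mem' := ⟨1, A.one_mem, one_pow n⟩
  mul_mem' := by
    rintro _ _ ⟨a, ha, rfl⟩ ⟨b, hb, rfl⟩
    exact ⟨a * b, A.mul_mem ha hb, hT.mul_pow (hA ha) (hA hb) n⟩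
  inv_mem' := by
    rintro _ ⟨a, ha, rfl⟩
    exact ⟨a⁻¹, A.inv_mem ha, inv_pow a n⟩

theorem powSubgroup_le (hT : IsTorusIn p S T) {A : Subgroup G} (hA : A ≤ T) (n : ℕ) :
    hT.powSubgroup hA n ≤ A := by
  rintro _ ⟨a, ha, rfl⟩
  exact A.pow_mem ha n

/-- The elements killed by p in A^{p^n} form a decreasing sequence of finite sets, hence a
stationary one. From that point on, each of them has p-power roots of every order in A^{p^k}, and
divisibility follows by induction on the order of the element. -/
theorem exists_isPDivisible_powSubgroup (hT : IsTorusIn p S T)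
    {A : Subgroup G} (hA : A ≤ T) : ∃ n, ∀ k ≥ n, IsPDivisible p (hT.powSubgroup hA (p ^ k)) := by
  let s : ℕ → Set G := fun n => {t | t ∈ hT.powSubgroup hA (p ^ n) ∧ t ^ p = 1}
  have hanti : ∀ m n, m ≤ n → s n ⊆ s m := by
    rintro m n hmn _ ⟨⟨a, ha, rfl⟩, h1⟩
    refine ⟨⟨a ^ p ^ (n - m), A.pow_mem ha _, ?_⟩, h1⟩
    rw [← pow_mul, ← pow_add, Nat.sub_add_cancel hmn]
  have hfin : ∀ n, (s n).Finite := by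
    intro n
    refine (hT.finite 1).subset ?_
    rintro t ⟨ht, h1⟩
    exact ⟨hA (hT.powSubgroup_le hA _ ht), by rwa [pow_one]⟩
  obtain ⟨n, hn⟩ : ∃ n, ∀ m, (s n).ncard ≤ (s m).ncard := by
    have hne : (Set.range fun n => (s n).ncard).Nonempty := ⟨_, 0, rfl⟩
    obtain ⟨n, hn⟩ := Nat.sInf_mem hne
    exact ⟨n, fun m => by
      have : sInf (Set.range fun n => (s n).ncard) ≤ (s m).ncard := Nat.sInf_le ⟨m, rfl⟩
      exact hn.trans_le this⟩
  have hstab : ∀ m, n ≤ m → s m = s n := fun m hm =>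
    Set.eq_of_subset_of_ncard_le (hanti n m hm) (hn m) (hfin n)
  refine ⟨n, fun k hk => ?_⟩
  have key : ∀ (l : ℕ) (x : G), x ∈ hT.powSubgroup hA (p ^ k) → x ^ p ^ l = 1 →
      ∃ y ∈ hT.powSubgroup hA (p ^ k), y ^ p = x := by
    intro l
    induction l with
    | zero =>
      intro x _ hx
      exact ⟨1, Subgroup.one_mem _, by simpa using hx.symm⟩
    | succ l ih =>
      intro x hx hxl
      have h1 : x ^ p ^ l ∈ s k := ⟨Subgroup.pow_mem _ hx _, by rw [← pow_mul, ← pow_succ, hxl]⟩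
      -- By stability, x^{p^l} is a p^{k+l+1}-th power in A. Hence it is y^{p^{l+1}} with y in
      -- A^{p^k}, and x y^{-p} has smaller order.
      rw [hstab k hk, ← hstab (k + (l + 1)) (by omega)] at h1
      obtain ⟨⟨a, ha, hal⟩, -⟩ := h1
      let y := a ^ p ^ k
      have hy : y ∈ hT.powSubgroup hA (p ^ k) := ⟨a, ha, rfl⟩
      have hyx : y ^ p ^ (l + 1) = x ^ p ^ l := by
        rw [← hal, ← pow_mul, ← pow_add]
      have hxT : x ∈ T := hA (hT.powSubgroup_le hA _ hx)
      have hyT : y ∈ T := hA (hT.powSubgroup_le hA _ hy)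
      obtain ⟨z, hz, hzx⟩ := ih (x * (y ^ p)⁻¹)
        (Subgroup.mul_mem _ hx (Subgroup.inv_mem _ (Subgroup.pow_mem _ hy _))) (by
          rw [hT.mul_pow hxT (T.inv_mem (T.pow_mem hyT p)), inv_pow, ← pow_mul, ← pow_succ', hyx,
            mul_inv_cancel])
      refine ⟨z * y, Subgroup.mul_mem _ hz hy, ?_⟩
      rw [hT.mul_pow (hA (hT.powSubgroup_le hA _ hz)) hyT, hzx, inv_mul_cancel_right]
  intro x hx
  obtain ⟨l, hl⟩ := hT.torsion x (hA (hT.powSubgroup_le hA _ hx))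
  exact key l x hx hl

end IsTorusIn

end Torus

end

noncomputable section

universe u

/-! ### Comparison of orders of discrete p-toral groups -/

section Torus

variable {G : Type*} [Group G] {p : ℕ}

namespace IsTorusIn

variable {S T : Subgroup G}

/-- Each coset of D in A contains an element killed by p^n: divide a by a p^n-th root in D of
a^{p^n}. -/
theorem relIndex_le_ncard (hT : IsTorusIn p S T) {D A : Subgroup G} (hDA : D ≤ A) (hA : A ≤ T)
    (hD : IsPDivisible p D) {n : ℕ} (hpow : ∀ a ∈ A, a ^ p ^ n ∈ D) :
    D.relIndex A ≠ 0 ∧ D.relIndex A ≤ {t | t ∈ T ∧ t ^ p ^ n = 1}.ncard := by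
  have hfin := hT.finite n
  let s : Set G := {t | t ∈ A ∧ t ^ p ^ n = 1}
  have hs : s ⊆ {t | t ∈ T ∧ t ^ p ^ n = 1} := fun t ht => ⟨hA ht.1, ht.2⟩
  have hsf : s.Finite := hfin.subset hs
  have : Finite s := hsf
  let f : s → A ⧸ D.subgroupOf A := fun t => ((⟨t, t.2.1⟩ : A) : A ⧸ D.subgroupOf A)
  have hf : Function.Surjective f := by
    intro x
    obtain ⟨a, rfl⟩ := QuotientGroup.mk_surjective x
    obtain ⟨d, hd, hda⟩ := hD.exists_pow_eq n (hpow a a.2)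
    have hdT := hA (hDA hd)
    refine ⟨⟨a * d⁻¹, A.mul_mem a.2 (A.inv_mem (hDA hd)), ?_⟩, ?_⟩
    · rw [hT.mul_pow (hA a.2) (T.inv_mem hdT), inv_pow, hda, mul_inv_cancel]
    · apply QuotientGroup.eq.mpr
      rw [Subgroup.mem_subgroupOf]
      simpa using hd
  have hfin' : Finite (A ⧸ D.subgroupOf A) := Finite.of_surjective f hf
  constructor
  · have : (D.subgroupOf A).FiniteIndex := Subgroup.finiteIndex_of_finite_quotient
    exact this.index_ne_zero
  · calc D.relIndex A = Nat.card (A ⧸ D.subgroupOf A) := rfl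
      _ ≤ Nat.card s := Nat.card_le_card_of_surjective f hf
      _ = s.ncard := rfl
      _ ≤ _ := Set.ncard_le_ncard hs hfin

/-- A divisible p-group inside the torus has no proper subgroup of finite index: each element is a
root raised to the index, which is a power of p. -/
theorem divisible_le_of_relIndex_ne_zero [Fact p.Prime] (hT : IsTorusIn p S T)
    {D K : Subgroup G} (hD : IsPDivisible p D) (hDS : D ≤ S) (hK : K.relIndex D ≠ 0) : D ≤ K := by
  have hDT := hT.le_of_divisible hD hDS
  have hn : (K.subgroupOf D).Normal := ⟨fun k hk g => by
    have : g * k * g⁻¹ = k := by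
      apply Subtype.ext
      change (g : G) * k * (g : G)⁻¹ = k
      rw [hT.comm g (hDT g.2) k (hDT k.2), mul_inv_cancel_right]
    rwa [this]⟩
  have : (K.subgroupOf D).FiniteIndex := ⟨hK⟩
  obtain ⟨a, ha⟩ := (hT.isPGroup hDS).index (K.subgroupOf D)
  intro x hx
  obtain ⟨y, hy, rfl⟩ := hD.exists_pow_eq a hx
  have h := Subgroup.pow_index_mem (H := K.subgroupOf D) ⟨y, hy⟩
  rw [ha] at h
  exact h

theorem identityComponent_eq [Fact p.Prime] (hT : IsTorusIn p S T) {D H : Subgroup G}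
    (hHS : H ≤ S) (hDH : D ≤ H) (hD : IsPDivisible p D) (hi : D.relIndex H ≠ 0) :
    identityComponent H = D.subgroupOf H := by
  apply le_antisymm
  · exact sInf_le (show (D.subgroupOf H).FiniteIndex from ⟨hi⟩)
  · refine le_sInf fun K hK => ?_
    have hK' : K.FiniteIndex := hK
    have h : (K.map H.subtype).relIndex D ≠ 0 := by
      intro h0
      have h1 : (K.map H.subtype).relIndex H ≠ 0 := by
        rw [Subgroup.relIndex, Subgroup.subgroupOf,
          Subgroup.comap_map_eq_self_of_injective H.subtype_injective]
        exact hK'.index_ne_zero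
      exact h1 (Subgroup.relIndex_eq_zero_of_le_right hDH h0)
    have h2 := hT.divisible_le_of_relIndex_ne_zero hD (hDH.trans hHS) h
    intro x hx
    obtain ⟨y, hy, hyx⟩ := h2 hx
    rwa [← Subtype.ext hyx]

/-- The witness is the group of p^n-th powers in H ⊓ T for n large; it is the identity component of
H. -/
theorem exists_divisible [hp : Fact p.Prime] (hT : IsTorusIn p S T) {H : Subgroup G}
    (hHS : H ≤ S) : ∃ D ≤ H, IsPDivisible p D ∧ D.relIndex H ≠ 0 := by
  have hA : H ⊓ T ≤ T := inf_le_right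
  obtain ⟨n, hn⟩ := hT.exists_isPDivisible_powSubgroup hA
  have hD := hn n le_rfl
  have hle := hT.powSubgroup_le hA (p ^ n)
  refine ⟨_, hle.trans inf_le_left, hD, ?_⟩
  have h1 := (hT.relIndex_le_ncard hle hA hD (n := n) fun a ha => ⟨a, ha, rfl⟩).1
  rw [← Subgroup.relIndex_mul_relIndex _ _ _ hle inf_le_left]
  refine mul_ne_zero h1 ?_
  rw [Subgroup.inf_relIndex_left]
  exact fun h0 => hT.relIndex_ne_zero (Subgroup.relIndex_eq_zero_of_le_right hHS h0)

/-- The p-torsion of D is finite of some order p^s, as is that of (ℤ/p^∞)^s, and divisible p-groups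
are classified by it. -/
theorem isDiscretePTorus_of_divisible [hp : Fact p.Prime] (hT : IsTorusIn p S T)
    {D : Subgroup G} (hDS : D ≤ S) (hD : IsPDivisible p D) : ∃ s, IsDiscretePTorus p D s := by
  have hDT := hT.le_of_divisible hD hDS
  let _ : CommGroup D := { (inferInstance : Group D) with
    mul_comm := fun x y => Subtype.ext (hT.comm x (hDT x.2) y (hDT y.2)) }
  let K := (nsmulAddMonoidHom (α := Additive D) p).ker
  have hKfin : Finite K := by
    have hfin : Finite {t | t ∈ T ∧ t ^ p ^ 1 = 1} := hT.finite 1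
    refine Finite.of_injective (fun x : K =>
      (⟨((x : Additive D).toMul : G), hDT (x : Additive D).toMul.2, ?_⟩ :
        {t | t ∈ T ∧ t ^ p ^ 1 = 1})) ?_
    · rw [pow_one]
      exact congrArg (fun z : Additive D => (z.toMul : G)) x.2
    · intro x y hxy
      exact Subtype.ext (Subtype.ext (congrArg
        (fun z : {t | t ∈ T ∧ t ^ p ^ 1 = 1} => (z : G)) hxy))
  obtain ⟨s, hs⟩ : ∃ s, Nat.card K = p ^ s := by
    have hpg : IsPGroup p (Multiplicative K) := by
      intro x
      refine ⟨1, ?_⟩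
      rw [pow_one]
      exact Subtype.ext x.toAdd.2
    exact (IsPGroup.iff_card (p := p) (G := Multiplicative K)).mp hpg
  let B := Fin s → PruferGroup p
  have hBtor : IsDiscretePTorus p B s := ⟨MulEquiv.refl _⟩
  have hBcard : Nat.card (nsmulAddMonoidHom (α := Additive B) p).ker = p ^ s :=
    hBtor.card_pow_eq_one
  have hBfin : Finite (nsmulAddMonoidHom (α := Additive B) p).ker := by
    apply Nat.finite_of_card_ne_zero
    rw [hBcard]
    exact pow_ne_zero s hp.out.ne_zero
  obtain ⟨e⟩ := nonempty_addEquiv_of_divisible (p := p) (A := Additive D) (B := Additive B)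
    (fun a => by
      obtain ⟨k, hk⟩ := hT.torsion _ (hDT a.toMul.2)
      exact ⟨k, Subtype.ext hk⟩)
    (fun a => by
      obtain ⟨y, hy, hyx⟩ := hD _ a.toMul.2
      exact ⟨Additive.ofMul ⟨y, hy⟩, Subtype.ext hyx⟩)
    (fun b => by
      choose k hk using fun i => (b.toMul i).2
      refine ⟨∑ i, k i, ?_⟩
      change b.toMul ^ p ^ (∑ i, k i) = 1
      funext i
      apply Subtype.ext
      have hdvd : p ^ k i ∣ p ^ (∑ i, k i) :=
        pow_dvd_pow p (Finset.single_le_sum (fun _ _ => Nat.zero_le _) (Finset.mem_univ i))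
      obtain ⟨c, hc⟩ := hdvd
      change (b.toMul i : Circle) ^ _ = 1
      rw [hc, pow_mul, hk i, one_pow])
    (fun b => by
      choose w hw using fun i => exists_pow_eq_pruferGroup (b.toMul i)
      exact ⟨Additive.ofMul w, funext hw⟩)
    (hs.trans hBcard.symm)
  exact ⟨s, ⟨(AddEquiv.toMultiplicative e : Multiplicative (Additive D) ≃* _)⟩⟩

end IsTorusIn

/-- Isomorphic groups have the same order. -/
theorem toralOrder_congr {X Y : Type u} [Group X] [Group Y] (e : X ≃* Y) :
    toralOrder p X = toralOrder p Y := by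
  have hfin : ∀ {X Y : Type u} [Group X] [Group Y] (e : X ≃* Y) (K : Subgroup Y),
      K.FiniteIndex → (K.comap e.toMonoidHom).FiniteIndex := by
    intro X Y _ _ e K hK
    exact ⟨by rw [Subgroup.index_comap_of_surjective K e.surjective]; exact hK.index_ne_zero⟩
  have h : (identityComponent Y).comap e.toMonoidHom = identityComponent X := by
    ext x
    simp only [identityComponent, Subgroup.mem_comap, Subgroup.mem_sInf, Set.mem_ofPred_eq]
    constructor
    · intro hx K hK
      simpa using hx (K.comap e.symm.toMonoidHom) (hfin e.symm K hK)
    · intro hx K hK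
      exact hx _ (hfin e K hK)
  have hi : (identityComponent X).index = (identityComponent Y).index := by
    rw [← h]
    exact Subgroup.index_comap_of_surjective _ e.surjective
  have h' : (identityComponent X).map e.toMonoidHom = identityComponent Y := by
    rw [← h]
    exact Subgroup.map_comap_eq_self_of_surjective e.surjective _
  let e' : identityComponent X ≃* identityComponent Y :=
    (e.subgroupMap (identityComponent X)).trans (MulEquiv.subgroupCongr h')
  have hr : toralRank p X = toralRank p Y := by
    unfold toralRank IsDiscretePTorus
    congr 1
    ext r
    exact ⟨fun ⟨f⟩ => ⟨e'.symm.trans f⟩, fun ⟨f⟩ => ⟨e'.trans f⟩⟩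
  rw [toralOrder, toralOrder, hr, hi]

namespace IsTorusIn

variable {S T : Subgroup G}

/-- The order becomes a matter of counting: the rank is read off from the number of elements of D
killed by p, and the number of components is an index. -/
theorem toralOrder_eq [hp : Fact p.Prime] (hT : IsTorusIn p S T) {D H : Subgroup G}
    (hHS : H ≤ S) (hDH : D ≤ H) (hD : IsPDivisible p D) (hi : D.relIndex H ≠ 0) :
    ∃ r, toralOrder p H = toLex (r, D.relIndex H) ∧ p ^ r = {x | x ∈ D ∧ x ^ p = 1}.ncard := by
  have hcomp := hT.identityComponent_eq hHS hDH hD hi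
  obtain ⟨s, ⟨e⟩⟩ := hT.isDiscretePTorus_of_divisible (hDH.trans hHS) hD
  have hs : IsDiscretePTorus p (identityComponent H) s := by
    rw [hcomp]
    exact ⟨(Subgroup.subgroupOfEquivOfLe hDH).trans e⟩
  have hr : toralRank p H = s := by
    have h1 : IsDiscretePTorus p (identityComponent H) (toralRank p H) :=
      Nat.sInf_mem (s := {r | IsDiscretePTorus p (identityComponent H) r}) ⟨s, hs⟩
    exact Nat.pow_right_injective hp.out.two_le (h1.card_pow_eq_one.symm.trans hs.card_pow_eq_one)
  refine ⟨s, ?_, ?_⟩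
  · rw [toralOrder, hr, hcomp]
    rfl
  · have h2 : IsDiscretePTorus p D s := ⟨e⟩
    rw [← h2.card_pow_eq_one, ← Nat.card_coe_set_eq]
    exact Nat.card_congr
      { toFun := fun x => ⟨x.1, x.1.2, congrArg Subtype.val x.2⟩
        invFun := fun x => ⟨⟨x.1, x.2.1⟩, Subtype.ext x.2.2⟩
        left_inv := fun _ => rfl
        right_inv := fun _ => rfl }

/-- Induct on the order of x: the power of x killed by p lies in D, so dividing x by a suitable root
in D lowers its order. -/
theorem eq_of_socle_le (hT : IsTorusIn p S T) {D E : Subgroup G} (hD : IsPDivisible p D)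
    (hDE : D ≤ E) (hE : E ≤ T) (h : ∀ x ∈ E, x ^ p = 1 → x ∈ D) : D = E := by
  refine le_antisymm hDE fun x hx => ?_
  obtain ⟨k, hk⟩ := hT.torsion x (hE hx)
  induction k generalizing x with
  | zero =>
    rw [pow_zero, pow_one] at hk
    exact hk ▸ D.one_mem
  | succ k ih =>
    have h1 := h (x ^ p ^ k) (E.pow_mem hx _) (by rw [← pow_mul, ← pow_succ, hk])
    obtain ⟨y, hy, hyx⟩ := hD.exists_pow_eq k h1
    have h2 := ih (x * y⁻¹) (E.mul_mem hx (E.inv_mem (hDE hy))) (by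
      rw [hT.mul_pow (hE hx) (T.inv_mem (hE (hDE hy))), inv_pow, hyx, mul_inv_cancel])
    simpa using D.mul_mem h2 hy

/-- For equal ranks, the identity components of H and K have the same finite p-torsion and so
coincide; the orders then compare as the indices of this common subgroup. The second half replaces
cardinality arguments for finite groups: a subgroup of the same order is the whole group. -/
theorem toralOrder_mono_and_eq [hp : Fact p.Prime] (hT : IsTorusIn p S T) {H K : Subgroup G}
    (hHK : H ≤ K) (hKS : K ≤ S) : toralOrder p H ≤ toralOrder p K ∧
      (toralOrder p K ≤ toralOrder p H → H = K) := by
  obtain ⟨D, hDH, hD, hDi⟩ := hT.exists_divisible (hHK.trans hKS)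
  obtain ⟨E, hEK, hE, hEi⟩ := hT.exists_divisible hKS
  have hDE : D ≤ E := by
    refine hT.divisible_le_of_relIndex_ne_zero hD (hDH.trans (hHK.trans hKS)) fun h0 => ?_
    exact hEi (Subgroup.relIndex_eq_zero_of_le_right (hDH.trans hHK) h0)
  have hET : E ≤ T := hT.le_of_divisible hE (hEK.trans hKS)
  obtain ⟨r, hr, hr'⟩ := hT.toralOrder_eq (hHK.trans hKS) hDH hD hDi
  obtain ⟨s, hs, hs'⟩ := hT.toralOrder_eq hKS hEK hE hEi
  have hfin : {x | x ∈ E ∧ x ^ p = 1}.Finite :=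
    (hT.finite 1).subset fun x hx => ⟨hET hx.1, by rw [pow_one]; exact hx.2⟩
  have hsub : {x | x ∈ D ∧ x ^ p = 1} ⊆ {x | x ∈ E ∧ x ^ p = 1} :=
    fun x hx => ⟨hDE hx.1, hx.2⟩
  have hrs : r ≤ s := by
    refine (Nat.pow_le_pow_iff_right hp.out.one_lt).mp ?_
    rw [hr', hs']
    exact Set.ncard_le_ncard hsub hfin
  rw [hr, hs]
  rcases hrs.lt_or_eq with hlt | rfl
  · exact ⟨(Prod.Lex.toLex_le_toLex.mpr (Or.inl hlt)), fun h => absurd h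
      (not_le_of_gt (Prod.Lex.toLex_lt_toLex.mpr (Or.inl hlt)))⟩
  · have heq := Set.eq_of_subset_of_ncard_le hsub (by rw [← hr', ← hs']) hfin
    obtain rfl : D = E := hT.eq_of_socle_le hD hDE hET fun x hx h1 => by
      have : x ∈ {x | x ∈ E ∧ x ^ p = 1} := ⟨hx, h1⟩
      rw [← heq] at this
      exact this.1
    have hmul := Subgroup.relIndex_mul_relIndex D H K hDH hHK
    have hne : H.relIndex K ≠ 0 := by
      intro h0
      rw [h0, mul_zero] at hmul
      exact hEi hmul.symm
    constructor
    · refine Prod.Lex.toLex_le_toLex.mpr (Or.inr ⟨rfl, ?_⟩)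
      change D.relIndex H ≤ D.relIndex K
      rw [← hmul]
      exact Nat.le_mul_of_pos_right _ (Nat.pos_of_ne_zero hne)
    · intro h
      rcases Prod.Lex.toLex_le_toLex.mp h with h | ⟨-, h⟩
      · exact absurd h (lt_irrefl _)
      · change D.relIndex K ≤ D.relIndex H at h
        rw [← hmul] at h
        have h1 : H.relIndex K ≤ 1 := by
          have := Nat.pos_of_ne_zero hDi
          by_contra hc
          push Not at hc
          nlinarith
        have h2 : H.relIndex K = 1 := by omega
        exact le_antisymm hHK (Subgroup.relIndex_eq_one.mp h2)

theorem toralOrder_mono [Fact p.Prime] (hT : IsTorusIn p S T) {H K : Subgroup G}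
    (hHK : H ≤ K) (hKS : K ≤ S) : toralOrder p H ≤ toralOrder p K :=
  (hT.toralOrder_mono_and_eq hHK hKS).1

theorem eq_of_toralOrder_le [Fact p.Prime] (hT : IsTorusIn p S T) {H K : Subgroup G}
    (hHK : H ≤ K) (hKS : K ≤ S) (h : toralOrder p K ≤ toralOrder p H) : H = K :=
  (hT.toralOrder_mono_and_eq hHK hKS).2 h

/-- A bound for the number of components of a subgroup. -/
theorem toralOrder_snd_le [hp : Fact p.Prime] (hT : IsTorusIn p S T) {D H : Subgroup G}
    (hHS : H ≤ S) (hDH : D ≤ H) (hD : IsPDivisible p D) {n : ℕ}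
    (hpow : ∀ a ∈ H ⊓ T, a ^ p ^ n ∈ D) :
    (ofLex (toralOrder p H)).2 ≤ {t | t ∈ T ∧ t ^ p ^ n = 1}.ncard * T.relIndex S := by
  have hDT := hT.le_of_divisible hD (hDH.trans hHS)
  obtain ⟨h0, h1⟩ := hT.relIndex_le_ncard (le_inf hDH hDT) inf_le_right hD hpow
  have h2 : (H ⊓ T).relIndex H ≠ 0 ∧ (H ⊓ T).relIndex H ≤ T.relIndex S := by
    rw [Subgroup.inf_relIndex_left]
    have := hT.relIndex_ne_zero
    refine ⟨fun h0 => this (Subgroup.relIndex_eq_zero_of_le_right hHS h0), ?_⟩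
    exact Subgroup.relIndex_le_of_le_right hHS this
  have hmul := Subgroup.relIndex_mul_relIndex D (H ⊓ T) H (le_inf hDH hDT) inf_le_left
  have hne : D.relIndex H ≠ 0 := by
    rw [← hmul]
    exact mul_ne_zero h0 h2.1
  obtain ⟨r, hr, -⟩ := hT.toralOrder_eq hHS hDH hD hne
  rw [hr]
  change D.relIndex H ≤ _
  rw [← hmul]
  exact Nat.mul_le_mul h1 h2.2

end IsTorusIn

end Torus

end

noncomputable section

/-! ### Growth of normalizers in discrete p-toral groups -/

section Torus

variable {G : Type*} [Group G] {p : ℕ}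

/-- For infinite P, conjugating P into itself need not give equality. It does when g has finite
order, since then g⁻¹ is a nonnegative power of g. -/
theorem mem_normalizer_of_pow_eq_one {P : Subgroup G} {g : G} {n : ℕ} (hn : n ≠ 0)
    (hg : g ^ n = 1) (h : ∀ x ∈ P, g * x * g⁻¹ ∈ P) : g ∈ Subgroup.normalizer (P : Set G) := by
  have hpow : ∀ (k : ℕ) (x : G), x ∈ P → g ^ k * x * (g ^ k)⁻¹ ∈ P := by
    intro k
    induction k with
    | zero => intro x hx; simpa using hx
    | succ k ih =>
      intro x hx
      have := h _ (ih x hx)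
      rw [pow_succ']
      simpa [mul_assoc] using this
  have hinv : g⁻¹ = g ^ (n - 1) := by
    rw [inv_eq_iff_mul_eq_one, ← pow_succ', Nat.sub_add_cancel (Nat.pos_of_ne_zero hn), hg]
  rw [Subgroup.mem_normalizer_iff]
  refine fun x => ⟨h x, fun hx => ?_⟩
  have := hpow (n - 1) _ hx
  rw [← hinv] at this
  simpa [mul_assoc] using this

theorem mem_normalizer_of_isPGroup [hp : Fact p.Prime] {P H : Subgroup G} (hH : IsPGroup p H)
    {g : G} (hg : g ∈ H) (h : ∀ x ∈ P, g * x * g⁻¹ ∈ P) :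
    g ∈ Subgroup.normalizer (P : Set G) := by
  obtain ⟨k, hk⟩ := hH ⟨g, hg⟩
  exact mem_normalizer_of_pow_eq_one (pow_ne_zero k hp.out.ne_zero) (congrArg Subtype.val hk) h

namespace IsTorusIn

variable {S T : Subgroup G}

/-- A `p`-group normalizing two finite subgroups `B < A` of the torus centralizes a nontrivial
element of `A / B`. -/
theorem exists_commutator_mem [hp : Fact p.Prime] (hT : IsTorusIn p S T) {P A B : Subgroup G}
    (hP : P ≤ S) (hA : A ≤ T) [Finite A] (hAB : ¬ A ≤ B) (hPA : ∀ x ∈ P, ∀ a ∈ A, x * a * x⁻¹ ∈ A)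
    (hPB : ∀ x ∈ P, ∀ a ∈ A, a ∈ B → x * a * x⁻¹ ∈ B) :
    ∃ a ∈ A, a ∉ B ∧ ∀ x ∈ P, a * x * a⁻¹ * x⁻¹ ∈ B := by
  let _ : MulAction P A :=
    { smul := fun x a => ⟨x * a * (x : G)⁻¹, hPA x x.2 a a.2⟩
      one_smul := fun a => Subtype.ext (by
        change ((1 : P) : G) * a * ((1 : P) : G)⁻¹ = a
        simp)
      mul_smul := fun x y a => Subtype.ext (by
        change ((x * y : P) : G) * a * ((x * y : P) : G)⁻¹ = x * (y * a * (y : G)⁻¹) * (x : G)⁻¹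
        simp [mul_assoc]) }
  have hsmul : ∀ (x : P) (a : A), ((x • a : A) : G) = x * a * (x : G)⁻¹ := fun _ _ => rfl
  have hq : MulAction.QuotientAction P (B.subgroupOf A) := ⟨fun x a a' h => by
    rw [Subgroup.mem_subgroupOf] at h ⊢
    have := hPB x x.2 _ (a⁻¹ * a').2 h
    convert this using 1
    simp [hsmul, mul_assoc]⟩
  have hdvd : p ∣ Nat.card (A ⧸ B.subgroupOf A) := by
    obtain ⟨n, hn⟩ := (hT.isPGroup (hA.trans hT.le)).index (B.subgroupOf A)
    rw [← Subgroup.index_eq_card, hn]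
    refine dvd_pow_self p fun h0 => hAB ?_
    rw [h0, pow_zero] at hn
    exact Subgroup.relIndex_eq_one.mp hn
  -- The p-group P acts on A / (A ⊓ B), of order a nontrivial power of p, and fixes the trivial
  -- coset; hence it fixes another one.
  obtain ⟨b, hb, hb1⟩ := (hT.isPGroup hP).exists_fixed_point_of_prime_dvd_card_of_fixed_point
    (A ⧸ B.subgroupOf A) hdvd (a := ((1 : A) : A ⧸ B.subgroupOf A)) (by
      intro x
      change ((x • (1 : A) : A) : A ⧸ B.subgroupOf A) = _
      congr 1
      apply Subtype.ext
      rw [hsmul]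
      simp)
  obtain ⟨a, rfl⟩ := QuotientGroup.mk_surjective b
  refine ⟨a, a.2, fun haB => hb1 ?_, fun x hx => ?_⟩
  · apply QuotientGroup.eq.mpr
    rw [Subgroup.mem_subgroupOf]
    simpa using haB
  · have h1 := hb ⟨x, hx⟩
    have h2 := QuotientGroup.eq.mp (show (((⟨x, hx⟩ : P) • a : A) : A ⧸ B.subgroupOf A) = a from h1)
    rw [Subgroup.mem_subgroupOf] at h2
    have h3 : ((((⟨x, hx⟩ : P) • a)⁻¹ * a : A) : G) = a * x * (a : G)⁻¹ * x⁻¹ := by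
      have hc := hT.comm a (hA a.2) (x * (a : G)⁻¹ * x⁻¹) (hA (by
        have := A.inv_mem (hPA x hx a a.2)
        simpa [mul_assoc] using this))
      calc ((((⟨x, hx⟩ : P) • a)⁻¹ * a : A) : G) = (x * (a : G)⁻¹ * x⁻¹) * a := by
            simp [hsmul, mul_assoc]
        _ = a * (x * (a : G)⁻¹ * x⁻¹) := hc.symm
        _ = _ := by group
    rwa [h3] at h2

theorem finite_torsion (hT : IsTorusIn p S T) {A : Subgroup G} (hA : A ≤ T) (n : ℕ) :
    ∃ B : Subgroup G, Finite B ∧ ∀ x, x ∈ B ↔ x ∈ A ∧ x ^ p ^ n = 1 := by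
  let B : Subgroup G :=
    { carrier := {x | x ∈ A ∧ x ^ p ^ n = 1}
      one_mem' := ⟨A.one_mem, one_pow _⟩
      mul_mem' := fun {x y} hx hy => ⟨A.mul_mem hx.1 hy.1, by
        rw [hT.mul_pow (hA hx.1) (hA hy.1), hx.2, hy.2, one_mul]⟩
      inv_mem' := fun {x} hx => ⟨A.inv_mem hx.1, by rw [inv_pow, hx.2, inv_one]⟩ }
  refine ⟨B, ?_, fun x => Iff.rfl⟩
  exact ((hT.finite n).subset fun x hx => ⟨hA hx.1, hx.2⟩ : (B : Set G).Finite)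

/-- Proper subgroups of discrete `p`-toral groups are properly contained in their normalizers. -/
theorem exists_mem_normalizer [hp : Fact p.Prime] (hT : IsTorusIn p S T) {P N : Subgroup G}
    (hPN : P ≤ N) (hne : ¬ N ≤ P) (hN : N ≤ S) :
    ∃ g ∈ N, g ∉ P ∧ g ∈ Subgroup.normalizer (P : Set G) := by
  -- If P contains the torus part of N, its index in N is finite and the fixed points of P on N / P
  -- settle the matter as for finite p-groups.
  by_cases hA : N ⊓ T ≤ P
  · have hfin : (P.subgroupOf N).FiniteIndex := by
      constructor
      have h1 : (N ⊓ T).relIndex N ≠ 0 := by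
        rw [Subgroup.inf_relIndex_left]
        exact fun h0 => hT.relIndex_ne_zero (Subgroup.relIndex_eq_zero_of_le_right hN h0)
      intro h0
      exact h1 (Subgroup.relIndex_eq_zero_of_le_left hA h0)
    have hpN := hT.isPGroup hN
    have hdvd : p ∣ Nat.card (N ⧸ P.subgroupOf N) := by
      obtain ⟨n, hn⟩ := hpN.index (P.subgroupOf N)
      rw [← Subgroup.index_eq_card, hn]
      refine dvd_pow_self p fun h0 => hne ?_
      rw [h0, pow_zero] at hn
      exact Subgroup.relIndex_eq_one.mp hn
    obtain ⟨b, hb, hb1⟩ :=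
      (hpN.to_subgroup (P.subgroupOf N)).exists_fixed_point_of_prime_dvd_card_of_fixed_point
        (N ⧸ P.subgroupOf N) hdvd (a := ((1 : N) : N ⧸ P.subgroupOf N)) (by
          intro x
          change (((x : N) * 1 : N) : N ⧸ P.subgroupOf N) = _
          apply QuotientGroup.eq.mpr
          simp)
    obtain ⟨a, rfl⟩ := QuotientGroup.mk_surjective b
    refine ⟨a⁻¹, N.inv_mem a.2, fun ha => hb1 ?_, ?_⟩
    · apply QuotientGroup.eq.mpr
      rw [Subgroup.mem_subgroupOf]
      simpa using ha
    · refine mem_normalizer_of_isPGroup hpN (N.inv_mem a.2) fun x hx => ?_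
      have h1 := hb ⟨⟨x⁻¹, N.inv_mem (hPN hx)⟩, P.inv_mem hx⟩
      have h2 := QuotientGroup.eq.mp
        (show (((⟨x⁻¹, N.inv_mem (hPN hx)⟩ : N) * a : N) : N ⧸ P.subgroupOf N) = a from h1)
      rw [Subgroup.mem_subgroupOf] at h2
      simpa [mul_assoc] using h2
  -- Otherwise a finite torsion subgroup of N ⊓ T not contained in P supplies an element outside P
  -- commuting with P modulo P.
  · obtain ⟨a, ⟨haN, haT⟩, haP⟩ : ∃ a ∈ N ⊓ T, a ∉ P := by
      by_contra hc
      push Not at hc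
      exact hA hc
    obtain ⟨k, hk⟩ := hT.torsion a haT
    obtain ⟨A, hfin, hmem⟩ := hT.finite_torsion (A := N ⊓ T) inf_le_right k
    have hAT : A ≤ T := fun x hx => ((hmem x).mp hx).1.2
    obtain ⟨b, hb, hbP, hbx⟩ := hT.exists_commutator_mem (P := P) (A := A) (B := P)
      (hPN.trans hN) hAT (fun h => haP (h ((hmem a).mpr ⟨⟨haN, haT⟩, hk⟩)))
      (fun x hx y hy => by
        obtain ⟨⟨hyN, hyT⟩, hyk⟩ := (hmem y).mp hy
        refine (hmem _).mpr ⟨⟨N.mul_mem (N.mul_mem (hPN hx) hyN) (N.inv_mem (hPN hx)),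
          hT.conj_mem x (hN (hPN hx)) y hyT⟩, ?_⟩
        rw [conj_pow, hyk, mul_one, mul_inv_cancel])
      (fun x hx y _ hy => P.mul_mem (P.mul_mem hx hy) (P.inv_mem hx))
    have hbN : b ∈ N := ((hmem b).mp hb).1.1
    refine ⟨b, hbN, hbP, mem_normalizer_of_isPGroup (hT.isPGroup hN) hbN fun x hx => ?_⟩
    simpa using P.mul_mem (hbx x hx) hx

/-- Iterated normalizers of `P` in `P D`, for `D` in the torus, exhaust `P D`. -/
theorem le_iSup_of_normalizer [hp : Fact p.Prime] (hT : IsTorusIn p S T) {P D B : Subgroup G}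
    (hP : P ≤ S) (hD : D ≤ T) (hPD : ∀ x ∈ P, ∀ d ∈ D, x * d * x⁻¹ ∈ D)
    (hB : ∀ g, g ∈ B ↔ ∃ x ∈ P, ∃ d ∈ D, g = x * d) (X : ℕ → Subgroup G) (hX0 : X 0 = P)
    (hmono : Monotone X) (hXB : ∀ n, X n ≤ B)
    (hsucc : ∀ n, ∀ g ∈ B, g ∈ Subgroup.normalizer (X n : Set G) → g ∈ X (n + 1)) :
    B = ⨆ n, X n := by
  have hdir : Directed (· ≤ ·) X := hmono.directed_le
  have hmemU : ∀ g, g ∈ ⨆ n, X n ↔ ∃ n, g ∈ X n := fun g => Subgroup.mem_iSup_of_directed hdir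
  have hPX : ∀ n, P ≤ X n := fun n => hX0 ▸ hmono (Nat.zero_le n)
  have hDB : D ≤ B := fun d hd => (hB d).mpr ⟨1, P.one_mem, d, hd, by simp⟩
  refine le_antisymm ?_ (iSup_le hXB)
  suffices hDU : D ≤ ⨆ n, X n by
    intro g hg
    obtain ⟨x, hx, d, hd, rfl⟩ := (hB g).mp hg
    exact Subgroup.mul_mem _ (le_iSup X 0 (hPX 0 hx)) (hDU hd)
  by_contra hcon
  obtain ⟨a, haD, haU⟩ : ∃ a ∈ D, a ∉ ⨆ n, X n := by
    by_contra hc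
    push Not at hc
    exact hcon hc
  obtain ⟨k, hk⟩ := hT.torsion a (hD haD)
  obtain ⟨A, hfin, hmem⟩ := hT.finite_torsion hD k
  have hAT : A ≤ T := fun x hx => hD ((hmem x).mp hx).1
  obtain ⟨b, hb, hbU, hbx⟩ := hT.exists_commutator_mem (P := P) (A := A) (B := ⨆ n, X n) hP hAT
    (fun h => haU (h ((hmem a).mpr ⟨haD, hk⟩)))
    (fun x hx y hy => by
      obtain ⟨hyD, hyk⟩ := (hmem y).mp hy
      refine (hmem _).mpr ⟨hPD x hx y hyD, ?_⟩
      rw [conj_pow, hyk, mul_one, mul_inv_cancel])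
    (fun x hx y _ hy => by
      have hxU := le_iSup X 0 (hPX 0 hx)
      exact Subgroup.mul_mem _ (Subgroup.mul_mem _ hxU hy) (Subgroup.inv_mem _ hxU))
  -- Since A is finite, one X n already contains all of A that lies in the union. The commutators of
  -- b with P lie in A and in the union, hence in X n, so b normalizes X n.
  obtain ⟨n, hn⟩ : ∃ n, ∀ y ∈ A, y ∈ ⨆ n, X n → y ∈ X n := by
    choose f hf using fun y : {y : A // (y : G) ∈ ⨆ n, X n} => (hmemU y.1).mp y.2
    obtain ⟨n, hn⟩ := (Set.finite_range f).bddAbove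
    exact ⟨n, fun y hy hyU => hmono (hn ⟨⟨⟨y, hy⟩, hyU⟩, rfl⟩) (hf ⟨⟨y, hy⟩, hyU⟩)⟩
  have hbD : b ∈ D := ((hmem b).mp hb).1
  have hbS : b ∈ S := hT.le (hD hbD)
  refine hbU ((hmemU b).mpr ⟨n + 1, hsucc n b (hDB hbD) ?_⟩)
  refine mem_normalizer_of_isPGroup (hT.isPGroup le_rfl) hbS fun g hg => ?_
  obtain ⟨x, hx, d, hd, rfl⟩ := (hB g).mp (hXB n hg)
  have hc : b * x * b⁻¹ * x⁻¹ ∈ A := by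
    have h1 : x * b⁻¹ * x⁻¹ ∈ A := by
      have h2 := A.inv_mem ((hmem (x * b * x⁻¹)).mpr ⟨hPD x hx b hbD, by
        rw [conj_pow, ((hmem b).mp hb).2, mul_one, mul_inv_cancel]⟩)
      simpa [mul_assoc] using h2
    have := A.mul_mem hb h1
    simpa [mul_assoc] using this
  have h3 : b * (x * d) * b⁻¹ = (b * x * b⁻¹ * x⁻¹) * (x * d) := by
    have h4 : d * b⁻¹ = b⁻¹ * d := hT.comm d (hD hd) b⁻¹ (T.inv_mem (hD hbD))
    calc b * (x * d) * b⁻¹ = b * x * (d * b⁻¹) := by group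
      _ = b * x * (b⁻¹ * d) := by rw [h4]
      _ = _ := by group
  rw [h3]
  exact (X n).mul_mem (hn _ hc (hbx x hx)) hg

end IsTorusIn

end Torus

end

noncomputable section

/-! ### Morphisms as functions on the ambient group -/

section Functions

variable {G : Type*} [Group G]

/-- The subgroup generated by `f(P)`; it equals `f(P)` when `f` is multiplicative on `P`. -/
def img (f : G → G) (P : Subgroup G) : Subgroup G := Subgroup.closure (f '' P)

theorem mem_img_of_mem (f : G → G) {P : Subgroup G} {x : G} (hx : x ∈ P) : f x ∈ img f P :=
  Subgroup.subset_closure ⟨x, hx, rfl⟩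

theorem img_mono (f : G → G) {P Q : Subgroup G} (h : P ≤ Q) : img f P ≤ img f Q :=
  Subgroup.closure_mono (Set.image_mono h)

theorem img_congr {f g : G → G} {P : Subgroup G} (h : Set.EqOn f g P) : img f P = img g P := by
  rw [img, img, h.image_eq]

open Classical in
/-- A homomorphism between subgroups, extended by `1` to the ambient group. -/
def extendFun {P Q : Subgroup G} (φ : P →* Q) : G → G := fun x => if h : x ∈ P then φ ⟨x, h⟩ else 1

theorem extendFun_apply {P Q : Subgroup G} (φ : P →* Q) {x : G} (hx : x ∈ P) :
    extendFun φ x = φ ⟨x, hx⟩ := by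
  rw [extendFun, dif_pos hx]

@[simp]
theorem extendFun_coe {P Q : Subgroup G} (φ : P →* Q) (x : P) : extendFun φ x = φ x :=
  extendFun_apply φ x.2

end Functions

namespace FusionSystem

variable {G : Type*} [Group G] {S : Subgroup G} {F : FusionSystem S}

/-- The function `f` restricts to a morphism of `F` from `P` to `S`. -/
def Mor (F : FusionSystem S) (P : Subgroup G) (f : G → G) : Prop :=
  ∃ φ ∈ F.Hom P S, ∀ x : P, (φ x : G) = f x

theorem inclusion_mem (F : FusionSystem S) {P Q : Subgroup G} (h : P ≤ Q) (hQ : Q ≤ S) :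
    Subgroup.inclusion h ∈ F.Hom P Q := by
  have := F.conj_mem (h.trans hQ) hQ 1 S.one_mem (by simpa using fun x hx => h hx)
  convert this using 1
  ext x
  simp [conjHom]

theorem mor_of_mem {P Q : Subgroup G} {φ : P →* Q} (h : φ ∈ F.Hom P Q) {f : G → G}
    (hf : ∀ x : P, (φ x : G) = f x) : F.Mor P f :=
  ⟨_, F.comp_mem (F.inclusion_mem (F.le_of_mem h).2 le_rfl) h, hf⟩

namespace Mor

variable {P Q : Subgroup G} {f g : G → G}

theorem le (h : F.Mor P f) : P ≤ S := by
  obtain ⟨φ, hφ, -⟩ := h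
  exact (F.le_of_mem hφ).1

theorem map_mul (h : F.Mor P f) {x y : G} (hx : x ∈ P) (hy : y ∈ P) : f (x * y) = f x * f y := by
  obtain ⟨φ, -, hf⟩ := h
  have h1 := hf ⟨x, hx⟩
  have h2 := hf ⟨y, hy⟩
  have h3 := hf (⟨x, hx⟩ * ⟨y, hy⟩)
  rw [_root_.map_mul] at h3
  simp only at h1 h2
  rw [← h1, ← h2]
  exact h3.symm

theorem map_one (h : F.Mor P f) : f 1 = 1 := by
  have := h.map_mul P.one_mem P.one_mem
  simpa using this

theorem map_inv (h : F.Mor P f) {x : G} (hx : x ∈ P) : f x⁻¹ = (f x)⁻¹ := by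
  rw [eq_inv_iff_mul_eq_one, ← h.map_mul (P.inv_mem hx) hx, inv_mul_cancel, h.map_one]

theorem map_conj (h : F.Mor P f) {x y : G} (hx : x ∈ P) (hy : y ∈ P) :
    f (x * y * x⁻¹) = f x * f y * (f x)⁻¹ := by
  rw [h.map_mul (P.mul_mem hx hy) (P.inv_mem hx), h.map_mul hx hy, h.map_inv hx]

theorem map_pow (h : F.Mor P f) {x : G} (hx : x ∈ P) (n : ℕ) : f (x ^ n) = f x ^ n := by
  induction n with
  | zero => simpa using h.map_one
  | succ n ih => rw [pow_succ, h.map_mul (P.pow_mem hx n) hx, ih, pow_succ]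

theorem eq_of_eq (h : F.Mor P f) {x y : G} (hx : x ∈ P) (hy : y ∈ P) (hxy : f x = f y) :
    x = y := by
  obtain ⟨φ, hφ, hf⟩ := h
  have : φ ⟨x, hx⟩ = φ ⟨y, hy⟩ := Subtype.ext (by rw [hf, hf]; exact hxy)
  exact congrArg Subtype.val (F.injective hφ this)

theorem mem (h : F.Mor P f) {x : G} (hx : x ∈ P) : f x ∈ S := by
  obtain ⟨φ, hφ, hf⟩ := h
  rw [← hf ⟨x, hx⟩]
  exact (φ _).2

theorem congr (h : F.Mor P f) (hfg : Set.EqOn g f P) : F.Mor P g := by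
  obtain ⟨φ, hφ, hf⟩ := h
  exact ⟨φ, hφ, fun x => by rw [hf, hfg x.2]⟩

theorem mono (h : F.Mor Q f) (hPQ : P ≤ Q) : F.Mor P f := by
  obtain ⟨φ, hφ, hf⟩ := h
  exact ⟨_, F.comp_mem hφ (F.inclusion_mem hPQ (F.le_of_mem hφ).1), fun x => hf ⟨x, hPQ x.2⟩⟩

theorem mem_img (h : F.Mor P f) {y : G} : y ∈ img f P ↔ ∃ x ∈ P, f x = y := by
  constructor
  · intro hy
    induction hy using Subgroup.closure_induction with
    | mem y hy => exact hy
    | one => exact ⟨1, P.one_mem, h.map_one⟩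
    | mul a b _ _ ha hb =>
      obtain ⟨x, hx, rfl⟩ := ha
      obtain ⟨y, hy, rfl⟩ := hb
      exact ⟨x * y, P.mul_mem hx hy, h.map_mul hx hy⟩
    | inv a _ ha =>
      obtain ⟨x, hx, rfl⟩ := ha
      exact ⟨x⁻¹, P.inv_mem hx, h.map_inv hx⟩
  · rintro ⟨x, hx, rfl⟩
    exact mem_img_of_mem f hx

theorem img_le (h : F.Mor P f) : img f P ≤ S := by
  intro y hy
  obtain ⟨x, hx, rfl⟩ := h.mem_img.mp hy
  exact h.mem hx

theorem img_le_iff (h : F.Mor P f) : img f P ≤ Q ↔ ∀ x ∈ P, f x ∈ Q := by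
  constructor
  · exact fun hq x hx => hq (mem_img_of_mem f hx)
  · intro hq y hy
    obtain ⟨x, hx, rfl⟩ := h.mem_img.mp hy
    exact hq x hx

theorem mem_img_iff (h : F.Mor P f) {x : G} (hx : x ∈ P) (hQP : Q ≤ P) : f x ∈ img f Q ↔ x ∈ Q := by
  constructor
  · intro hy
    obtain ⟨y, hy, hyx⟩ := (h.mono hQP).mem_img.mp hy
    rwa [← h.eq_of_eq (hQP hy) hx hyx]
  · exact mem_img_of_mem f

theorem exists_mulEquiv (h : F.Mor P f) :
    ∃ e : P ≃* img f P, e.toMonoidHom ∈ F.Hom P (img f P) ∧ ∀ x : P, (e x : G) = f x := by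
  have hS := h
  obtain ⟨φ, hφ, hf⟩ := h
  obtain ⟨R, hR, e, he, -, rfl⟩ := F.factor hφ
  have hx : ∀ x : P, (e x : G) = f x := hf
  obtain rfl : R = img f P := by
    ext y
    rw [hS.mem_img]
    constructor
    · intro hy
      exact ⟨e.symm ⟨y, hy⟩, (e.symm _).2, by rw [← hx, e.apply_symm_apply]⟩
    · rintro ⟨x, hx', rfl⟩
      rw [← hx ⟨x, hx'⟩]
      exact (e _).2
  exact ⟨e, he, hx⟩

theorem exists_inv (h : F.Mor P f) : ∃ g, F.Mor (img f P) g ∧ (∀ x ∈ P, g (f x) = x) ∧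
    (∀ y ∈ img f P, g y ∈ P ∧ f (g y) = y) := by
  obtain ⟨e, he, hf⟩ := h.exists_mulEquiv
  have hg : ∀ x ∈ P, extendFun e.symm.toMonoidHom (f x) = x := by
    intro x hx
    have h1 : f x = e ⟨x, hx⟩ := (hf ⟨x, hx⟩).symm
    rw [h1, extendFun_coe]
    change ((e.symm (e ⟨x, hx⟩) : P) : G) = x
    rw [e.symm_apply_apply]
  refine ⟨extendFun e.symm.toMonoidHom, mor_of_mem (F.symm_mem he) (fun x => (extendFun_coe _ x).symm),
    hg, fun y hy => ?_⟩
  obtain ⟨x, hx, rfl⟩ := h.mem_img.mp hy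
  rw [hg x hx]
  exact ⟨hx, rfl⟩

theorem hom_mem (h : F.Mor P f) (hQ : Q ≤ S) (φ : P →* Q) (hφ : ∀ x : P, (φ x : G) = f x) :
    φ ∈ F.Hom P Q := by
  obtain ⟨e, he, hf⟩ := h.exists_mulEquiv
  have hle : img f P ≤ Q := h.img_le_iff.mpr fun x hx => by
    rw [← hφ ⟨x, hx⟩]
    exact (φ _).2
  have := F.comp_mem (F.inclusion_mem hle hQ) he
  convert this using 1
  ext x
  rw [hφ, ← hf]
  rfl

theorem comp (h : F.Mor P f) (h' : F.Mor Q g) (hm : ∀ x ∈ P, f x ∈ Q) : F.Mor P (g ∘ f) := by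
  obtain ⟨e, he, hf⟩ := h.exists_mulEquiv
  obtain ⟨φ, hφ, hg⟩ := h'.mono (h.img_le_iff.mpr hm)
  exact ⟨_, F.comp_mem hφ he, fun x => by
    change ((φ (e x)) : G) = _
    rw [hg, hf]
    rfl⟩

theorem img_comp (h : F.Mor P f) (h' : F.Mor Q g) (hm : ∀ x ∈ P, f x ∈ Q) :
    img (g ∘ f) P = img g (img f P) := by
  ext y
  rw [(h.comp h' hm).mem_img, (h'.mono (h.img_le_iff.mpr hm)).mem_img]
  constructor
  · rintro ⟨x, hx, rfl⟩
    exact ⟨f x, mem_img_of_mem f hx, rfl⟩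
  · rintro ⟨z, hz, rfl⟩
    obtain ⟨x, hx, rfl⟩ := h.mem_img.mp hz
    exact ⟨x, hx, rfl⟩

theorem img_eq (h : F.Mor P f) (h1 : ∀ x ∈ P, f x ∈ Q) (h2 : ∀ y ∈ Q, ∃ x ∈ P, f x = y) :
    img f P = Q := by
  ext y
  rw [h.mem_img]
  exact ⟨fun ⟨x, hx, hy⟩ => hy ▸ h1 x hx, h2 y⟩

theorem conj (F : FusionSystem S) (hP : P ≤ S) {s : G} (hs : s ∈ S) :
    F.Mor P (fun x => s * x * s⁻¹) :=
  mor_of_mem (F.conj_mem hP le_rfl s hs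
    fun _ hx => S.mul_mem (S.mul_mem hs (hP hx)) (S.inv_mem hs)) (fun _ => rfl)

theorem id (F : FusionSystem S) (hP : P ≤ S) : F.Mor P (fun x => x) := by
  simpa using Mor.conj F hP S.one_mem

theorem toralOrder_img {p : ℕ} (h : F.Mor P f) : toralOrder p (img f P) = toralOrder p P := by
  obtain ⟨e, -, -⟩ := h.exists_mulEquiv
  exact (toralOrder_congr e).symm

end Mor

theorem img_id (P : Subgroup G) : img (fun x => x) P = P := by simp [img]

theorem isConj_iff {P Q : Subgroup G} : F.IsConj P Q ↔ ∃ f, F.Mor P f ∧ img f P = Q := by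
  constructor
  · rintro ⟨e, he⟩
    have hm : F.Mor P (extendFun e.toMonoidHom) :=
      mor_of_mem he (fun x => (extendFun_coe _ x).symm)
    refine ⟨_, hm, hm.img_eq (fun x hx => ?_) (fun y hy => ?_)⟩
    · rw [extendFun_apply _ hx]
      exact (e _).2
    · exact ⟨e.symm ⟨y, hy⟩, (e.symm _).2, by
        rw [extendFun_coe]
        change ((e (e.symm ⟨y, hy⟩) : Q) : G) = y
        rw [e.apply_symm_apply]⟩
  · rintro ⟨f, hf, rfl⟩
    obtain ⟨e, he, -⟩ := hf.exists_mulEquiv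
    exact ⟨e, he⟩

theorem mem_aut_iff {P : Subgroup G} (hP : P ≤ S) {α : MulAut P} :
    α ∈ F.aut P hP ↔ F.Mor P (extendFun α.toMonoidHom) :=
  ⟨fun h => mor_of_mem (show α.toMonoidHom ∈ F.Hom P P from h) (fun x => (extendFun_coe _ x).symm),
    fun h => h.hom_mem hP _ (fun x => (extendFun_coe _ x).symm)⟩

theorem Mor.mem_aut {P : Subgroup G} {f : G → G} (h : F.Mor P f) {α : MulAut P}
    (hα : ∀ x : P, (α x : G) = f x) : α ∈ F.aut P h.le :=
  h.hom_mem h.le α.toMonoidHom hα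

theorem mor_of_mem_aut {P : Subgroup G} {hP : P ≤ S} {α : MulAut P} (h : α ∈ F.aut P hP)
    {f : G → G} (hα : ∀ x : P, (α x : G) = f x) : F.Mor P f :=
  mor_of_mem (show α.toMonoidHom ∈ F.Hom P P from h) hα

theorem Mor.exists_aut {P : Subgroup G} {f : G → G} (h : F.Mor P f) (hP : img f P = P) :
    ∃ α ∈ F.aut P h.le, ∀ x : P, (α x : G) = f x := by
  obtain ⟨e, he, hf⟩ := h.exists_mulEquiv
  let α : MulAut P := e.trans (MulEquiv.subgroupCongr hP)
  have hα : ∀ x : P, (α x : G) = f x := hf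
  exact ⟨α, h.mem_aut hα, hα⟩

theorem mem_autIn_iff {P : Subgroup G} {α : MulAut P} : α ∈ autIn S P ↔
    ∃ g ∈ S, g ∈ Subgroup.normalizer (P : Set G) ∧ ∀ x : P, (α x : G) = g * x * g⁻¹ := by
  constructor
  · rintro ⟨g, hg, rfl⟩
    exact ⟨g, hg, g.2, fun x => rfl⟩
  · rintro ⟨g, hg, hgn, h⟩
    refine ⟨⟨g, hgn⟩, hg, ?_⟩
    ext x
    rw [h]
    rfl

theorem mem_extensionDomain_iff {P : Subgroup G} {φ : P →* S} (hφ : Function.Injective φ) {g : G} :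
    g ∈ extensionDomain φ hφ ↔ g ∈ S ∧ ∃ hg : g ∈ Subgroup.normalizer (P : Set G),
      ∃ h ∈ S, ∀ x : P, (φ ⟨g * x * g⁻¹, (Subgroup.mem_normalizer_iff.mp hg x).mp x.2⟩ : G) =
        h * φ x * h⁻¹ := by
  have himg : ∀ x : P, ((imageEquiv φ hφ le_rfl x : imageOf φ P) : G) = φ x := fun x => rfl
  have hmem : ∀ x : P, (φ x : G) ∈ imageOf φ P := fun x => (imageEquiv φ hφ le_rfl x).2
  constructor
  · rintro ⟨hS, ⟨g, hg, rfl⟩⟩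
    refine ⟨hS, g.2, ?_⟩
    obtain ⟨h, hh, -, hx⟩ := mem_autIn_iff.mp (show _ ∈ autIn S (imageOf φ P) from hg)
    refine ⟨h, hh, fun x => ?_⟩
    have := hx (imageEquiv φ hφ le_rfl x)
    rw [himg] at this
    rw [← this]
    change _ = ((imageEquiv φ hφ le_rfl (P.normalizerMonoidHom g
      ((imageEquiv φ hφ le_rfl).symm (imageEquiv φ hφ le_rfl x))) : imageOf φ P) : G)
    rw [MulEquiv.symm_apply_apply, himg]
    rfl
  · rintro ⟨hS, hg, h, hh, hx⟩
    refine ⟨hS, ⟨⟨g, hg⟩, ?_, rfl⟩⟩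
    have hy : ∀ y ∈ imageOf φ P, ∃ x : P, (φ x : G) = y := by
      intro y hy
      exact ⟨(imageEquiv φ hφ le_rfl).symm ⟨y, hy⟩, by
        rw [← himg, MulEquiv.apply_symm_apply]⟩
    refine (mem_autIn_iff.mpr ⟨h, hh, ?_, ?_⟩ : _ ∈ autIn S (imageOf φ P))
    · rw [Subgroup.mem_normalizer_iff]
      intro y
      constructor
      · intro hyP
        obtain ⟨x, rfl⟩ := hy y hyP
        rw [← hx]
        exact hmem _
      · intro hyP
        obtain ⟨x, hxy⟩ := hy _ hyP
        have hg' : g⁻¹ * x * g ∈ P := by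
          have := (Subgroup.mem_normalizer_iff.mp (Subgroup.inv_mem _ hg) x).mp x.2
          simpa using this
        have h2 := hx ⟨g⁻¹ * x * g, hg'⟩
        have h3 : (⟨g * ((⟨g⁻¹ * x * g, hg'⟩ : P) : G) * g⁻¹,
            (Subgroup.mem_normalizer_iff.mp hg _).mp hg'⟩ : P) = x :=
          Subtype.ext (by simp [mul_assoc])
        rw [h3, hxy] at h2
        have h4 : y = φ ⟨g⁻¹ * x * g, hg'⟩ := by
          simpa using h2
        rw [h4]
        exact hmem _
    · intro y
      obtain ⟨x, rfl⟩ := (imageEquiv φ hφ le_rfl).surjective y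
      change ((imageEquiv φ hφ le_rfl (P.normalizerMonoidHom ⟨g, hg⟩
        ((imageEquiv φ hφ le_rfl).symm (imageEquiv φ hφ le_rfl x))) : imageOf φ P) : G) = _
      rw [MulEquiv.symm_apply_apply, himg, himg, ← hx]
      rfl

end FusionSystem

end

noncomputable section

/-! ### The saturation axioms for functions on the ambient group -/

namespace FusionSystem

variable {G : Type*} [Group G] {S T : Subgroup G} {F : FusionSystem S} {p : ℕ}

theorem fullyCentralized_iff {P : Subgroup G} : F.FullyCentralized p P ↔
    P ≤ S ∧ ∀ f, F.Mor P f →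
      toralOrder p (centralizerIn S (img f P)) ≤ toralOrder p (centralizerIn S P) := by
  refine and_congr_right fun _ => ⟨fun h f hf => h _ (isConj_iff.mpr ⟨f, hf, rfl⟩), ?_⟩
  intro h Q hQ
  obtain ⟨f, hf, rfl⟩ := isConj_iff.mp hQ
  exact h f hf

theorem fullyNormalized_iff {P : Subgroup G} : F.FullyNormalized p P ↔
    P ≤ S ∧ ∀ f, F.Mor P f →
      toralOrder p (normalizerIn S (img f P)) ≤ toralOrder p (normalizerIn S P) := by
  refine and_congr_right fun _ => ⟨fun h f hf => h _ (isConj_iff.mpr ⟨f, hf, rfl⟩), ?_⟩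
  intro h Q hQ
  obtain ⟨f, hf, rfl⟩ := isConj_iff.mp hQ
  exact h f hf

theorem mem_centralizerIn {P : Subgroup G} {g : G} :
    g ∈ centralizerIn S P ↔ g ∈ S ∧ ∀ x ∈ P, x * g = g * x := by
  rw [centralizerIn, Subgroup.mem_inf, Subgroup.mem_centralizer_iff]
  rfl

theorem conj_mem_of_mem_normalizerIn {P : Subgroup G} {g x : G} (hg : g ∈ normalizerIn S P)
    (hx : x ∈ P) : g * x * g⁻¹ ∈ P :=
  (Subgroup.mem_normalizer_iff.mp hg.2 x).mp hx

theorem le_normalizerIn {P : Subgroup G} (hP : P ≤ S) : P ≤ normalizerIn S P :=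
  le_inf hP Subgroup.le_normalizer

theorem normalizerIn_le {P : Subgroup G} : normalizerIn S P ≤ S := inf_le_left

theorem centralizerIn_le {P : Subgroup G} : centralizerIn S P ≤ S := inf_le_left

theorem centralizerIn_anti {P Q : Subgroup G} (h : P ≤ Q) :
    centralizerIn S Q ≤ centralizerIn S P := by
  intro g hg
  rw [mem_centralizerIn] at hg ⊢
  exact ⟨hg.1, fun x hx => hg.2 x (h hx)⟩

theorem centralizerIn_le_normalizerIn {P : Subgroup G} :
    centralizerIn S P ≤ normalizerIn S P := by
  intro g hg
  rw [mem_centralizerIn] at hg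
  refine ⟨hg.1, Subgroup.mem_normalizer_iff.mpr fun x => ?_⟩
  constructor
  · intro hx
    rw [← hg.2 x hx, mul_inv_cancel_right]
    exact hx
  · intro hx
    have h1 := hg.2 _ hx
    have h2 : x = g * x * g⁻¹ := by
      have h3 : g * x * g⁻¹ * g = g * (g * x * g⁻¹) := h1
      rw [inv_mul_cancel_right] at h3
      exact mul_left_cancel h3
    rwa [h2]

theorem mem_normalizerIn_of_forall [Fact p.Prime] (hT : IsTorusIn p S T) {P : Subgroup G} {g : G}
    (hg : g ∈ S) (h : ∀ x ∈ P, g * x * g⁻¹ ∈ P) : g ∈ normalizerIn S P :=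
  ⟨hg, mem_normalizer_of_isPGroup (hT.isPGroup le_rfl) hg h⟩

/-- Axiom (II) for functions. -/
theorem Saturated.exists_extension (hF : F.Saturated p) {P N : Subgroup G} {f : G → G}
    (h : F.Mor P f) (hfc : F.FullyCentralized p (img f P)) (hPN : P ≤ N) (hNS : N ≤ S)
    (hN : ∀ g ∈ N, ∀ x ∈ P, g * x * g⁻¹ ∈ P)
    (hc : ∀ g ∈ N, ∃ s ∈ S, ∀ x ∈ P, f (g * x * g⁻¹) = s * f x * s⁻¹) :
    ∃ f', F.Mor N f' ∧ Set.EqOn f' f P := by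
  have h' := h
  obtain ⟨φ, hφ, hf⟩ := h
  have himg : imageOf φ P = img f P := by
    ext y
    rw [h'.mem_img]
    constructor
    · rintro ⟨x, hx, rfl⟩
      exact ⟨x, x.2, (hf x).symm⟩
    · rintro ⟨x, hx, rfl⟩
      exact ⟨⟨x, hx⟩, hx, hf ⟨x, hx⟩⟩
  obtain ⟨ψ, hψ, hext⟩ := hF.extend P φ hφ (himg ▸ hfc)
  have hle : N ≤ extensionDomain φ (F.injective hφ) := by
    intro g hg
    have hgn : g ∈ Subgroup.normalizer (P : Set G) := by
      rw [Subgroup.mem_normalizer_iff]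
      refine fun x => ⟨hN g hg x, fun hx => ?_⟩
      have := hN g⁻¹ (N.inv_mem hg) _ hx
      simpa [mul_assoc] using this
    obtain ⟨s, hs, hsx⟩ := hc g hg
    refine (mem_extensionDomain_iff _).mpr ⟨hNS hg, hgn, s, hs, fun x => ?_⟩
    rw [hf, hf]
    exact hsx x x.2
  have hm : F.Mor _ (extendFun ψ) := mor_of_mem hψ (fun x => (extendFun_coe ψ x).symm)
  refine ⟨extendFun ψ, hm.mono hle, fun x hx => ?_⟩
  rw [extendFun_apply ψ (hle (hPN hx)), hext x hx, hf]

theorem mem_sup_centralizerIn {P : Subgroup G} {g : G} :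
    g ∈ P ⊔ centralizerIn S P ↔ ∃ x ∈ P, ∃ c ∈ centralizerIn S P, g = x * c := by
  have hle : centralizerIn S P ≤ Subgroup.normalizer (P : Set G) :=
    centralizerIn_le_normalizerIn.trans inf_le_right
  rw [← SetLike.mem_coe, Subgroup.coe_mul_of_right_le_normalizer_left P _ hle]
  simp only [Set.mem_mul, SetLike.mem_coe]
  constructor
  · rintro ⟨x, hx, c, hc, rfl⟩
    exact ⟨x, hx, c, hc, rfl⟩
  · rintro ⟨x, hx, c, hc, rfl⟩
    exact ⟨x, hx, c, hc, rfl⟩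

theorem sup_centralizerIn_le {P : Subgroup G} (hP : P ≤ S) : P ⊔ centralizerIn S P ≤ S :=
  sup_le hP centralizerIn_le

theorem sup_centralizerIn_le_normalizerIn {P : Subgroup G} (hP : P ≤ S) :
    P ⊔ centralizerIn S P ≤ normalizerIn S P :=
  sup_le (le_normalizerIn hP) centralizerIn_le_normalizerIn

/-- Extension of a morphism to `P C_S(P)`. -/
theorem Saturated.exists_extension_centralizerIn (hF : F.Saturated p) {P : Subgroup G} {f : G → G}
    (h : F.Mor P f) (hfc : F.FullyCentralized p (img f P)) :
    ∃ f', F.Mor (P ⊔ centralizerIn S P) f' ∧ Set.EqOn f' f P := by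
  refine hF.exists_extension h hfc le_sup_left (sup_centralizerIn_le h.le) ?_ ?_
  · intro g hg x hx
    exact conj_mem_of_mem_normalizerIn (sup_centralizerIn_le_normalizerIn h.le hg) hx
  · intro g hg
    obtain ⟨y, hy, c, hc, rfl⟩ := mem_sup_centralizerIn.mp hg
    -- The factor c centralizes P, so y c acts on P as y does.
    refine ⟨f y, h.mem hy, fun x hx => ?_⟩
    rw [← h.map_conj hy hx]
    have := (mem_centralizerIn.mp hc).2 x hx
    congr 1
    rw [mul_inv_rev, mul_assoc y c x, ← this]
    group

/-! ### The maximal torus -/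

theorem Mor.isPDivisible_img {D : Subgroup G} {f : G → G} (h : F.Mor D f)
    (hD : IsPDivisible p D) : IsPDivisible p (img f D) := by
  intro y hy
  obtain ⟨x, hx, rfl⟩ := h.mem_img.mp hy
  obtain ⟨z, hz, rfl⟩ := hD x hx
  exact ⟨f z, mem_img_of_mem f hz, (h.map_pow hz p).symm⟩

/-- The image is divisible, hence contained in T, and it has the order of T. -/
theorem Mor.img_torus [Fact p.Prime] (hT : IsTorusIn p S T) {w : G → G} (h : F.Mor T w) :
    img w T = T := by
  refine hT.eq_of_toralOrder_le ?_ hT.le h.toralOrder_img.ge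
  exact hT.le_of_divisible (h.isPDivisible_img hT.divisible) h.img_le

theorem Mor.torus_mem [Fact p.Prime] (hT : IsTorusIn p S T) {w : G → G} (h : F.Mor T w) {t : G}
    (ht : t ∈ T) : w t ∈ T :=
  h.img_torus hT ▸ mem_img_of_mem w ht

theorem fullyNormalized_torus [Fact p.Prime] (hT : IsTorusIn p S T) : F.FullyNormalized p T :=
  fullyNormalized_iff.mpr ⟨hT.le, fun f hf => by rw [hf.img_torus hT]⟩

/-- The torus is fully normalized and abelian, so axiom (I) gives finiteness of Aut_F(T) itself. -/
theorem Saturated.finite_aut_torus [Fact p.Prime] (hF : F.Saturated p) (hT : IsTorusIn p S T) :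
    Finite (F.aut T hT.le) := by
  obtain ⟨-, hfin, -⟩ := hF.sylow T hT.le (fullyNormalized_torus hT)
  refine Finite.of_injective (fun α : F.aut T hT.le =>
    (⟨QuotientGroup.mk' (innerAut T) α, α, α.2, rfl⟩ : outImage (F.aut T hT.le))) ?_
  intro α β hαβ
  have h1 := congrArg Subtype.val hαβ
  have h2 := QuotientGroup.eq.mp h1
  obtain ⟨t, ht⟩ := h2
  apply Subtype.ext
  have h3 : (MulAut.conj t : MulAut T) = 1 := by
    ext x
    change ((t * x * t⁻¹ : T) : G) = x
    have := hT.comm t t.2 x x.2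
    simp [this]
  rw [h3] at ht
  exact (inv_mul_eq_one.mp ht.symm)

/-- The subgroup of the torus fixed by a set of automorphisms. -/
def fixedIn {hle : T ≤ S} (W : Set (F.aut T hle)) : Subgroup G where
  carrier := {t | ∃ ht : t ∈ T, ∀ α ∈ W, (α : MulAut T) ⟨t, ht⟩ = ⟨t, ht⟩}
  one_mem' := ⟨T.one_mem, fun α _ => map_one (α : MulAut T)⟩
  mul_mem' := by
    rintro x y ⟨hx, hx'⟩ ⟨hy, hy'⟩
    refine ⟨T.mul_mem hx hy, fun α hα => ?_⟩
    have := map_mul (α : MulAut T) ⟨x, hx⟩ ⟨y, hy⟩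
    rw [hx' α hα, hy' α hα] at this
    exact this
  inv_mem' := by
    rintro x ⟨hx, hx'⟩
    refine ⟨T.inv_mem hx, fun α hα => ?_⟩
    have := map_inv (α : MulAut T) ⟨x, hx⟩
    rw [hx' α hα] at this
    exact this

theorem fixedIn_le {hle : T ≤ S} (W : Set (F.aut T hle)) : fixedIn W ≤ T := fun _ ht => ht.1

/-- Since Aut_F(T) is finite, only finitely many fixed subgroups occur, so one exponent serves for
all. This uniformity underlies the bounds on orders below. -/
theorem Saturated.exists_divisible_fixedIn [Fact p.Prime] (hF : F.Saturated p)
    (hT : IsTorusIn p S T) : ∃ c, ∀ W : Set (F.aut T hT.le),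
      IsPDivisible p (hT.powSubgroup (fixedIn_le W) (p ^ c)) := by
  have := hF.finite_aut_torus hT
  choose n hn using fun W : Set (F.aut T hT.le) =>
    hT.exists_isPDivisible_powSubgroup (fixedIn_le W)
  obtain ⟨c, hc⟩ := (Set.finite_range n).bddAbove
  exact ⟨c, fun W => hn W c (hc ⟨W, rfl⟩)⟩

end FusionSystem

end

noncomputable section

/-! ### The norm argument and existence of fully normalized conjugates -/

section Torus

variable {G : Type*} [Group G] {S T : Subgroup G} {p : ℕ}

theorem IsTorusIn.conj_eq_of_mem (hT : IsTorusIn p S T) {x y t : G} (h : x⁻¹ * y ∈ T)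
    (ht : t ∈ T) : x * t * x⁻¹ = y * t * y⁻¹ := by
  have h1 := hT.comm _ h t ht
  have h2 : y = x * (x⁻¹ * y) := by group
  rw [h2, mul_assoc x (x⁻¹ * y) t, h1]
  group

/-- The norm argument: if `t` normalizes `Q`, a power of `t` is the product of an element
centralizing `Q` and an element of `Q`. -/
theorem IsTorusIn.exists_pow_eq_mul [hp : Fact p.Prime] (hT : IsTorusIn p S T) {Q : Subgroup G}
    (hQ : Q ≤ S) {t : G} (ht : t ∈ T) (hn : ∀ x ∈ Q, x * t * x⁻¹ * t⁻¹ ∈ Q) :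
    ∃ c ∈ T, (∀ x ∈ Q, x * c * x⁻¹ = c) ∧ ∃ a ∈ Q ⊓ T, t ^ p ^ hT.exponent = c * a := by
  let _ : CommGroup T := { (inferInstance : Group T) with
    mul_comm := fun x y => Subtype.ext (hT.comm x x.2 y y.2) }
  let U := T.subgroupOf Q
  have hUi : T.relIndex Q ∣ p ^ hT.exponent := by
    have := hT.subgroupOf_normal
    have h1 : T.relIndex Q = (T.subgroupOf S).relIndex (Q.subgroupOf S) :=
      (Subgroup.relIndex_subgroupOf hQ).symm
    have h2 : (T.subgroupOf S).index = p ^ hT.exponent := hT.index.choose_spec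
    rw [h1, ← h2]
    exact Subgroup.relIndex_dvd_index_of_normal _ _
  have hUfin : U.FiniteIndex := ⟨fun h0 => by
    have h1 : T.relIndex Q = 0 := h0
    rw [h1] at hUi
    exact pow_ne_zero _ hp.out.ne_zero (Nat.eq_zero_of_zero_dvd hUi)⟩
  let _ : Fintype (Q ⧸ U) := Fintype.ofFinite _
  let τ : T := ⟨t, ht⟩
  let cj : Q → T → T := fun x u => ⟨x * u * (x : G)⁻¹, hT.conj_mem x (hQ x.2) u u.2⟩
  have hcj : ∀ (x y : Q) (u : T), (x : Q ⧸ U) = y → cj x u = cj y u := by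
    intro x y u h
    apply Subtype.ext
    refine hT.conj_eq_of_mem ?_ u.2
    exact (QuotientGroup.eq.mp h : x⁻¹ * y ∈ U)
  -- The norm of t: conjugation by x ∈ Q on T depends only on the coset of x modulo Q ⊓ T, and Q
  -- permutes the factors.
  let N : T := ∏ q : Q ⧸ U, cj q.out τ
  have hN : ∀ x : Q, cj x N = N := by
    intro x
    let cx : T →* T :=
      { toFun := cj x
        map_one' := Subtype.ext (by simp [cj])
        map_mul' := fun u v => Subtype.ext (by simp [cj, mul_assoc]) }
    have h1 : cj x N = ∏ q : Q ⧸ U, cj x (cj q.out τ) := map_prod cx _ _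
    rw [h1]
    refine Fintype.prod_equiv (MulAction.toPerm x) _ _ fun q => ?_
    have h2 : cj x (cj q.out τ) = cj (x * q.out) τ := Subtype.ext (by simp [cj, mul_assoc])
    rw [h2]
    apply hcj
    rw [QuotientGroup.out_eq']
    conv_rhs => rw [MulAction.toPerm_apply, ← QuotientGroup.out_eq' q]
    rfl
  -- Each factor of N is t times a commutator of t with an element of Q, which lies in Q because t
  -- normalizes Q in the sense of `hn`. The exponent [Q : Q ⊓ T] divides p^m, and a further power
  -- adjusts it.
  have hNa : ∃ a ∈ Q ⊓ T, (N : G) = t ^ T.relIndex Q * a := by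
    have h1 : N = τ ^ (Fintype.card (Q ⧸ U)) * ∏ q : Q ⧸ U, (τ⁻¹ * cj q.out τ) := by
      rw [Finset.prod_mul_distrib, Finset.prod_const, Finset.card_univ, inv_pow,
        mul_inv_cancel_left]
    have h2 : Fintype.card (Q ⧸ U) = T.relIndex Q := Nat.card_eq_fintype_card.symm
    refine ⟨((∏ q : Q ⧸ U, (τ⁻¹ * cj q.out τ) : T) : G), ⟨?_, Subtype.prop _⟩, ?_⟩
    · suffices h : (∏ q : Q ⧸ U, (τ⁻¹ * cj q.out τ) : T) ∈ Q.subgroupOf T from h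
      refine Subgroup.prod_mem _ fun q _ => ?_
      rw [Subgroup.mem_subgroupOf, mul_comm]
      exact hn _ q.out.2
    · conv_lhs => rw [h1, h2]
      rfl
  obtain ⟨a, ha, hNa⟩ := hNa
  obtain ⟨k, hk⟩ := hUi
  refine ⟨(N : G) ^ k, T.pow_mem N.2 k, fun x hx => ?_, a⁻¹ ^ k,
    Subgroup.pow_mem _ (Subgroup.inv_mem _ ha) k, ?_⟩
  · rw [← conj_pow]
    congr 1
    exact congrArg Subtype.val (hN ⟨x, hx⟩)
  · have h1 : t ^ T.relIndex Q = N * a⁻¹ := by rw [hNa, mul_inv_cancel_right]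
    rw [hk, pow_mul, h1, hT.mul_pow N.2 (T.inv_mem ha.2)]

theorem IsTorusIn.mem_sup {A B : Subgroup G} (hT : IsTorusIn p S T) (hA : A ≤ T) (hB : B ≤ T)
    {g : G} : g ∈ A ⊔ B ↔ ∃ a ∈ A, ∃ b ∈ B, g = a * b := by
  have hle : A ≤ Subgroup.normalizer (B : Set G) := by
    intro a ha
    rw [Subgroup.mem_normalizer_iff]
    intro b
    constructor
    · intro hb
      rw [hT.comm a (hA ha) b (hB hb), mul_inv_cancel_right]
      exact hb
    · intro hb
      have := hT.comm _ (hB hb) a (hA ha)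
      rw [inv_mul_cancel_right] at this
      have h2 := mul_left_cancel this
      rwa [h2]
  rw [← SetLike.mem_coe, Subgroup.coe_mul_of_left_le_normalizer_right A B hle]
  simp only [Set.mem_mul, SetLike.mem_coe]
  constructor
  · rintro ⟨x, hx, c, hc, rfl⟩
    exact ⟨x, hx, c, hc, rfl⟩
  · rintro ⟨x, hx, c, hc, rfl⟩
    exact ⟨x, hx, c, hc, rfl⟩

theorem IsTorusIn.isPDivisible_sup {A B : Subgroup G} (hT : IsTorusIn p S T) (hA : A ≤ T)
    (hB : B ≤ T) (hAd : IsPDivisible p A) (hBd : IsPDivisible p B) : IsPDivisible p (A ⊔ B) := by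
  intro g hg
  obtain ⟨a, ha, b, hb, rfl⟩ := (hT.mem_sup hA hB).mp hg
  obtain ⟨a, ha', rfl⟩ := hAd a ha
  obtain ⟨b, hb', rfl⟩ := hBd b hb
  exact ⟨a * b, (hT.mem_sup hA hB).mpr ⟨a, ha', b, hb', rfl⟩, hT.mul_pow (hA ha') (hB hb') p⟩

theorem exists_max_of_bounded {s : Set (ℕ ×ₗ ℕ)} (hne : s.Nonempty) {a b : ℕ}
    (h : ∀ o ∈ s, (ofLex o).1 ≤ a ∧ (ofLex o).2 ≤ b) : ∃ o ∈ s, ∀ o' ∈ s, o' ≤ o := by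
  have hfin : s.Finite := by
    refine Set.Finite.subset (((Set.finite_Iic a).prod (Set.finite_Iic b)).image toLex) ?_
    intro o ho
    exact ⟨ofLex o, ⟨(h o ho).1, (h o ho).2⟩, rfl⟩
  exact Set.exists_max_image s id hfin hne

theorem IsTorusIn.toralOrder_fst_le [Fact p.Prime] (hT : IsTorusIn p S T) {H : Subgroup G}
    (hH : H ≤ S) : (ofLex (toralOrder p H)).1 ≤ (ofLex (toralOrder p S)).1 := by
  rcases Prod.Lex.le_iff.mp (hT.toralOrder_mono hH le_rfl) with h | h
  · exact h.le
  · exact h.1.le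

end Torus

namespace FusionSystem

variable {G : Type*} [Group G] {S T : Subgroup G} {F : FusionSystem S} {p : ℕ}

/-- A subgroup may have infinitely many conjugates Q, so a maximum of the orders of N_S(Q) needs a
uniform bound. The rank is bounded by that of S. For the components, p^K-th powers of elements of
N_S(Q) ⊓ T lie in a divisible subgroup of N_S(Q), with K independent of Q. -/
theorem Saturated.exists_fullyNormalized [hp : Fact p.Prime] (hF : F.Saturated p)
    (hT : IsTorusIn p S T) {P : Subgroup G} (hP : P ≤ S) :
    ∃ f, F.Mor P f ∧ F.FullyNormalized p (img f P) := by
  obtain ⟨c, hc⟩ := hF.exists_divisible_fixedIn hT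
  obtain ⟨e, he⟩ := hT.exists_isPDivisible_powSubgroup (A := P ⊓ T) inf_le_right
  have hD := he e le_rfl
  have hDP : hT.powSubgroup (A := P ⊓ T) inf_le_right (p ^ e) ≤ P :=
    (hT.powSubgroup_le _ _).trans inf_le_left
  set D := hT.powSubgroup (A := P ⊓ T) inf_le_right (p ^ e) with hDdef
  have hPD : ∀ x ∈ P, x ^ p ^ (hT.exponent + e) ∈ D := by
    intro x hx
    refine ⟨x ^ p ^ hT.exponent, ⟨P.pow_mem hx _, hT.pow_mem (hP hx)⟩, ?_⟩
    rw [← pow_mul, ← pow_add]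
  -- The first summand is the power in the norm argument, c sends elements of T fixed by Q into a
  -- divisible group, and the rest sends elements of P into its divisible part D.
  let K := hT.exponent + (c + (hT.exponent + e))
  obtain ⟨o, ⟨f, hf, rfl⟩, hmax⟩ := exists_max_of_bounded
    (s := {o | ∃ f, F.Mor P f ∧ o = toralOrder p (normalizerIn S (img f P))})
    ⟨_, _, Mor.id F hP, rfl⟩ (a := (ofLex (toralOrder p S)).1)
    (b := {t | t ∈ T ∧ t ^ p ^ K = 1}.ncard * T.relIndex S) (by
      rintro _ ⟨f, hf, rfl⟩
      refine ⟨hT.toralOrder_fst_le normalizerIn_le, ?_⟩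
      set Q := img f P with hQ
      have hfD := hf.mono hDP
      -- W consists of the automorphisms of T induced by Q, so its fixed subgroup C is the
      -- centralizer of Q in T.
      let W : Set (F.aut T hT.le) := {α | ∃ x ∈ Q, ∀ t : T, ((α : MulAut T) t : G) = x * t * x⁻¹}
      let C := fixedIn W
      have hCdiv := hc W
      set DC := hT.powSubgroup (fixedIn_le W) (p ^ c) with hDC
      have hC : ∀ t ∈ T, (∀ x ∈ Q, x * t * x⁻¹ = t) ↔ t ∈ C := by
        intro t ht
        constructor
        · intro h
          refine ⟨ht, fun α hα => ?_⟩
          obtain ⟨x, hx, hαx⟩ := hα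
          apply Subtype.ext
          rw [hαx]
          exact h x hx
        · rintro ⟨ht', h⟩ x hx
          have hmor := Mor.conj F hT.le (hf.img_le hx)
          obtain ⟨α, hα, hαx⟩ := hmor.exists_aut (hmor.img_torus hT)
          have := h ⟨α, hα⟩ ⟨x, hx, hαx⟩
          have h2 := hαx ⟨t, ht⟩
          simp only at h2 this
          rw [← h2, this]
      have hDQ : IsPDivisible p (img f D) := hfD.isPDivisible_img hD
      have hDQQ : img f D ≤ Q := img_mono f hDP
      have hDQT : img f D ≤ T := hT.le_of_divisible hDQ hfD.img_le
      have hDCC : DC ≤ C := hT.powSubgroup_le _ _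
      have hDCT : DC ≤ T := hDCC.trans (fixedIn_le W)
      have hCN : C ≤ normalizerIn S Q := by
        intro t ht
        refine centralizerIn_le_normalizerIn (mem_centralizerIn.mpr ⟨hT.le ht.1, fun x hx => ?_⟩)
        have := (hC t ht.1).mpr ht x hx
        exact mul_inv_eq_iff_eq_mul.mp this
      refine hT.toralOrder_snd_le (D := DC ⊔ img f D) normalizerIn_le
        (sup_le (hDCC.trans hCN) (hDQQ.trans (le_normalizerIn hf.img_le)))
        (hT.isPDivisible_sup hDCT hDQT hCdiv hDQ) ?_
      rintro t ⟨htN, htT⟩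
      obtain ⟨u, huT, huc, a, ha, hua⟩ := hT.exists_pow_eq_mul hf.img_le htT (fun x hx => by
        have h1 := conj_mem_of_mem_normalizerIn htN (Q.inv_mem hx)
        have h2 := Q.mul_mem hx h1
        simpa [mul_assoc] using h2)
      have huC : u ∈ C := (hC u huT).mp huc
      rw [pow_add, pow_mul, hua, hT.mul_pow huT ha.2]
      refine (hT.mem_sup hDCT hDQT).mpr ⟨_, ?_, _, ?_, rfl⟩
      · rw [pow_add, pow_mul]
        exact DC.pow_mem ⟨u, huC, rfl⟩ _
      · rw [pow_add, mul_comm, pow_mul]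
        refine Subgroup.pow_mem _ ?_ _
        obtain ⟨x, hx, hxa⟩ := hf.mem_img.mp ha.1
        rw [← hxa, ← hf.map_pow hx]
        exact mem_img_of_mem f (hPD x hx))
  refine ⟨f, hf, fullyNormalized_iff.mpr ⟨hf.img_le, fun g hg => ?_⟩⟩
  have h1 := hmax _ ⟨g ∘ f, hf.comp hg (fun x hx => mem_img_of_mem f hx), rfl⟩
  rwa [hf.img_comp hg (fun x hx => mem_img_of_mem f hx)] at h1

theorem Saturated.fullyCentralized (hF : F.Saturated p) {P : Subgroup G}
    (hP : F.FullyNormalized p P) : F.FullyCentralized p P :=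
  (hF.sylow P hP.1 hP).1

end FusionSystem

end

noncomputable section

namespace FusionSystem

variable {G : Type*} [Group G] {S T : Subgroup G} {F : FusionSystem S} {p : ℕ}

/-! ### Automorphism groups -/

theorem autIn_le_aut (F : FusionSystem S) {P : Subgroup G} (hP : P ≤ S) :
    autIn S P ≤ F.aut P hP := by
  intro α hα
  obtain ⟨g, hg, -, hx⟩ := mem_autIn_iff.mp hα
  exact (Mor.conj F hP hg).mem_aut hx

theorem isPGroup_autIn (hT : IsTorusIn p S T) (P : Subgroup G) : IsPGroup p (autIn S P) := by
  rintro ⟨_, ⟨g, hg, rfl⟩⟩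
  obtain ⟨k, hk⟩ := hT.exists_pow_eq_one (show (g : G) ∈ S from hg)
  refine ⟨k, Subtype.ext ?_⟩
  change (P.normalizerMonoidHom g) ^ p ^ k = 1
  rw [← map_pow, show g ^ p ^ k = 1 from Subtype.ext hk, map_one]

theorem innerAut_le_autIn {P : Subgroup G} (hP : P ≤ S) : innerAut P ≤ autIn S P := by
  rintro _ ⟨g, rfl⟩
  exact mem_autIn_iff.mpr ⟨g, hP g.2, Subgroup.le_normalizer g.2, fun x => rfl⟩

/-- Axiom (I) is a Sylow statement in Out_F(P). As Inn(P) ≤ Aut_S(P), it lifts to maximality of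
Aut_S(P) among the p-subgroups of Aut_F(P). -/
theorem Saturated.le_autIn_of_isPGroup (hF : F.Saturated p) {P : Subgroup G}
    (hP : F.FullyNormalized p P) {W : Subgroup (MulAut P)} (hW : IsPGroup p W)
    (hWF : W ≤ F.aut P hP.1) (h : autIn S P ≤ W) : W ≤ autIn S P := by
  obtain ⟨-, -, Q, hQ⟩ := hF.sylow P hP.1 hP
  have h1 : (outImage W).subgroupOf (outImage (F.aut P hP.1)) = Q := by
    refine Q.is_maximal' ((hW.map _).comap_of_injective _ (Subgroup.subtype_injective _)) ?_
    intro x hx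
    have : (x : MulAut P ⧸ innerAut P) ∈ outImage (autIn S P) := hQ ▸ ⟨x, hx, rfl⟩
    exact Subgroup.map_mono h this
  intro w hw
  have h2 : QuotientGroup.mk' (innerAut P) w ∈ outImage (autIn S P) := by
    rw [← hQ]
    exact ⟨⟨_, w, hWF hw, rfl⟩, h1 ▸ ⟨w, hw, rfl⟩, rfl⟩
  obtain ⟨a, ha, haw⟩ := h2
  have h3 := innerAut_le_autIn hP.1 (QuotientGroup.eq.mp haw)
  have := mul_mem ha h3
  rwa [mul_inv_cancel_left] at this

theorem Saturated.isPByFinite_aut_of_fullyNormalized (hF : F.Saturated p) (hT : IsTorusIn p S T)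
    {P : Subgroup G} (hP : F.FullyNormalized p P) : IsPByFinite p (F.aut P hP.1) := by
  obtain ⟨-, hfin, -⟩ := hF.sylow P hP.1 hP
  refine ⟨(innerAut P).subgroupOf (F.aut P hP.1), inferInstance, ?_, ?_⟩
  · exact ((isPGroup_autIn hT P).to_le (innerAut_le_autIn hP.1)).comap_of_injective _
      (Subgroup.subtype_injective _)
  · let φ : F.aut P hP.1 →* outImage (F.aut P hP.1) :=
      ((QuotientGroup.mk' (innerAut P)).comp (F.aut P hP.1).subtype).codRestrict _
        (fun α => ⟨α, α.2, rfl⟩)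
    have hker : φ.ker = (innerAut P).subgroupOf (F.aut P hP.1) := by
      ext α
      rw [MonoidHom.mem_ker, Subtype.ext_iff]
      exact QuotientGroup.eq_one_iff (α : MulAut P)
    rw [← hker]
    exact Subgroup.finiteIndex_ker φ

/-- Conjugation by a morphism. -/
theorem Mor.congr_mem_aut {P : Subgroup G} {f : G → G} (h : F.Mor P f) {e : P ≃* img f P}
    (he : ∀ x : P, (e x : G) = f x) {α : MulAut P} (hα : α ∈ F.aut P h.le) :
    MulAut.congr e α ∈ F.aut (img f P) h.img_le := by
  obtain ⟨e', he', hx⟩ := h.exists_mulEquiv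
  obtain rfl : e = e' := MulEquiv.ext fun x => Subtype.ext ((he x).trans (hx x).symm)
  have h1 : α.toMonoidHom ∈ F.Hom P P := hα
  exact F.comp_mem he' (F.comp_mem h1 (F.symm_mem he'))

/-- Conjugation by a morphism onto a fully normalized subgroup embeds Aut_F(P) in a group where
axiom (I) applies: Inn is a p-group of finite index there. -/
theorem Saturated.isPByFinite_aut [Fact p.Prime] (hF : F.Saturated p) (hT : IsTorusIn p S T)
    {P : Subgroup G} (hP : P ≤ S) : IsPByFinite p (F.aut P hP) := by
  obtain ⟨f, hf, hfn⟩ := hF.exists_fullyNormalized hT hP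
  obtain ⟨e, he, hx⟩ := hf.exists_mulEquiv
  refine (hF.isPByFinite_aut_of_fullyNormalized hT hfn).of_injective
    (((MulAut.congr e).toMonoidHom.comp (F.aut P hP).subtype).codRestrict _
      (fun α => hf.congr_mem_aut hx α.2)) ?_
  intro α β h
  exact Subtype.ext ((MulAut.congr e).injective (congrArg Subtype.val h))

/-- The function `κ` restricts to an element of `O^{p'}(Aut_F(P))`. -/
def Res (p : ℕ) (F : FusionSystem S) (P : Subgroup G) (κ : G → G) : Prop :=
  ∃ hP : P ≤ S, ∃ α ∈ residualIn p (F.aut P hP), ∀ x : P, (α x : G) = κ x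

namespace Res

variable {P : Subgroup G} {κ κ' f : G → G}

theorem mor (h : F.Res p P κ) : F.Mor P κ := by
  obtain ⟨hP, α, hα, hx⟩ := h
  exact mor_of_mem_aut (residualIn_le _ hα) hx

theorem mem (h : F.Res p P κ) {x : G} (hx : x ∈ P) : κ x ∈ P := by
  obtain ⟨hP, α, hα, h⟩ := h
  rw [← h ⟨x, hx⟩]
  exact (α _).2

theorem img_eq (h : F.Res p P κ) : img κ P = P := by
  refine h.mor.img_eq (fun x hx => h.mem hx) fun y hy => ?_
  obtain ⟨hP, α, hα, h⟩ := h
  refine ⟨α.symm ⟨y, hy⟩, (α.symm _).2, ?_⟩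
  rw [← h, MulEquiv.apply_symm_apply]

theorem congr (h : F.Res p P κ) (hc : Set.EqOn κ' κ P) : F.Res p P κ' := by
  obtain ⟨hP, α, hα, h⟩ := h
  exact ⟨hP, α, hα, fun x => by rw [h, hc x.2]⟩

theorem exists_inv (h : F.Res p P κ) :
    ∃ κ', F.Res p P κ' ∧ (∀ x ∈ P, κ' (κ x) = x) ∧ ∀ x ∈ P, κ (κ' x) = x := by
  obtain ⟨hP, α, hα, h⟩ := h
  refine ⟨extendFun (α⁻¹).toMonoidHom, ⟨hP, α⁻¹, inv_mem hα, fun x => (extendFun_coe (α⁻¹).toMonoidHom x).symm⟩,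
    fun x hx => ?_, fun x hx => ?_⟩
  · have := h ⟨x, hx⟩
    simp only at this
    rw [← this, extendFun_coe]
    change ((α⁻¹ (α ⟨x, hx⟩) : P) : G) = x
    rw [MulAut.inv_apply_self]
  · rw [extendFun_apply _ hx, ← h]
    change ((α (α⁻¹ ⟨x, hx⟩) : P) : G) = x
    rw [MulAut.apply_inv_self]

theorem transport (h : F.Res p P κ) (hf : F.Mor P f) :
    ∃ κ', F.Res p (img f P) κ' ∧ ∀ x ∈ P, κ' (f x) = f (κ x) := by
  obtain ⟨hP, α, hα, h⟩ := h
  obtain ⟨e, he, hx⟩ := hf.exists_mulEquiv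
  have h1 := map_mem_residualIn (N := F.aut (img f P) hf.img_le)
    ((MulAut.congr e).toMonoidHom.comp (F.aut P hP).subtype)
    (fun α => hf.congr_mem_aut hx α.2) hα
  refine ⟨extendFun (MulAut.congr e α).toMonoidHom,
    ⟨hf.img_le, _, h1, fun x => (extendFun_coe (MulAut.congr e α).toMonoidHom x).symm⟩, fun x hxP => ?_⟩
  have h2 := hx ⟨x, hxP⟩
  simp only at h2
  rw [← h2, extendFun_coe]
  change ((e (α (e.symm (e ⟨x, hxP⟩))) : img f P) : G) = _
  rw [MulEquiv.symm_apply_apply, hx, h]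

theorem conj [Fact p.Prime] (F : FusionSystem S) (hT : IsTorusIn p S T) (hP : P ≤ S) {s : G}
    (hs : s ∈ normalizerIn S P) : F.Res p P (fun x => s * x * s⁻¹) := by
  have h1 : P.normalizerMonoidHom ⟨s, hs.2⟩ ∈ autIn S P := ⟨⟨s, hs.2⟩, hs.1, rfl⟩
  exact ⟨hP, _, (isPGroup_autIn hT P).le_residualIn (autIn_le_aut F hP) h1, fun x => rfl⟩

end Res

/-- A morphism onto a fully normalized subgroup extends to the normalizer, after composition with
an automorphism in the residual. -/
theorem Saturated.exists_res_extension [Fact p.Prime] (hF : F.Saturated p) (hT : IsTorusIn p S T)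
    {P : Subgroup G} {f : G → G} (hf : F.Mor P f) (hfn : F.FullyNormalized p (img f P)) :
    ∃ κ, F.Res p (img f P) κ ∧ ∃ g, F.Mor (normalizerIn S P) g ∧ Set.EqOn g (κ ∘ f) P := by
  obtain ⟨e, he, hx⟩ := hf.exists_mulEquiv
  -- U = f Aut_S(P) f⁻¹ is a p-subgroup of Aut_F(f(P)). A residual α moves it into Aut_S(f(P)), and
  -- then every element of N_S(P) satisfies the condition of axiom (II) for α ∘ f.
  let U := (autIn S P).map (MulAut.congr e).toMonoidHom
  obtain ⟨α, hα, hconj⟩ := (hF.isPByFinite_aut hT hf.img_le).exists_residualIn_conj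
    (U := U) ((isPGroup_autIn hT P).map _)
    (by
      rintro _ ⟨a, ha, rfl⟩
      exact hf.congr_mem_aut hx (autIn_le_aut F hf.le ha))
    (isPGroup_autIn hT (img f P)) (autIn_le_aut F hf.img_le)
    (fun W hW hWF h => hF.le_autIn_of_isPGroup hfn hW hWF h)
  have hκ : F.Res p (img f P) (extendFun α.toMonoidHom) :=
    ⟨hf.img_le, α, hα, fun x => (extendFun_coe α.toMonoidHom x).symm⟩
  refine ⟨_, hκ, ?_⟩
  have hcomp := hf.comp hκ.mor (fun x hx => mem_img_of_mem f hx)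
  have himg : img (extendFun α.toMonoidHom ∘ f) P = img f P := by
    rw [hf.img_comp hκ.mor (fun x hx => mem_img_of_mem f hx), hκ.img_eq]
  refine hF.exists_extension hcomp (by rw [himg]; exact hF.fullyCentralized hfn)
    (le_normalizerIn hf.le) normalizerIn_le
    (fun g hg x hx => conj_mem_of_mem_normalizerIn hg hx) ?_
  intro g hg
  have h1 : P.normalizerMonoidHom ⟨g, hg.2⟩ ∈ autIn S P := ⟨⟨g, hg.2⟩, hg.1, rfl⟩
  obtain ⟨s, hs, hsn, hsx⟩ := mem_autIn_iff.mp (hconj _ ⟨_, h1, rfl⟩)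
  refine ⟨s, hs, fun x hxP => ?_⟩
  have hfx : ∀ y (hy : y ∈ P), (extendFun α.toMonoidHom ∘ f) y = α (e ⟨y, hy⟩) := by
    intro y hy
    have h2 := hx ⟨y, hy⟩
    simp only at h2
    rw [Function.comp_apply, ← h2, extendFun_coe]
    rfl
  have hgx := conj_mem_of_mem_normalizerIn hg hxP
  rw [hfx _ hxP, hfx _ hgx, ← hsx]
  change _ = ((α (e (P.normalizerMonoidHom ⟨g, hg.2⟩ (e.symm (α⁻¹ (α (e ⟨x, hxP⟩)))))) :
    img f P) : G)
  rw [MulAut.inv_apply_self, MulEquiv.symm_apply_apply]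
  rfl

theorem Saturated.exists_extension_normalizerIn [Fact p.Prime] (hF : F.Saturated p)
    (hT : IsTorusIn p S T) {P : Subgroup G} {f : G → G} (hf : F.Mor P f)
    (hfn : F.FullyNormalized p (img f P)) :
    ∃ g, F.Mor (normalizerIn S P) g ∧ img g P = img f P := by
  obtain ⟨κ, hκ, g, hg, hgx⟩ := hF.exists_res_extension hT hf hfn
  refine ⟨g, hg, ?_⟩
  rw [img_congr hgx, hf.img_comp hκ.mor (fun x hx => mem_img_of_mem f hx), hκ.img_eq]

/-- Morphisms between subgroups of the maximal torus extend to it. -/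
theorem Saturated.exists_extension_torus [Fact p.Prime] (hF : F.Saturated p)
    (hT : IsTorusIn p S T) {A : Subgroup G} {f : G → G} (hf : F.Mor A f) (hA : A ≤ T)
    (hfA : img f A ≤ T) : ∃ w, F.Mor T w ∧ Set.EqOn w f A := by
  have hTC : ∀ B : Subgroup G, B ≤ T → T ≤ B ⊔ centralizerIn S B := fun B hB t ht =>
    Subgroup.mem_sup_right (mem_centralizerIn.mpr
      ⟨hT.le ht, fun x hx => hT.comm x (hB hx) t ht⟩)
  -- Centralizers of subgroups of T contain T. So ρ ∘ f and ρ both extend to T for a fully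
  -- normalized target of ρ, and the second extension is inverted.
  obtain ⟨ρ, hρ, hfn⟩ := hF.exists_fullyNormalized hT hf.img_le
  have hm : ∀ x ∈ A, f x ∈ img f A := fun x hx => mem_img_of_mem f hx
  obtain ⟨g, hg, hgx⟩ := hF.exists_extension_centralizerIn (hf.comp hρ hm)
    (by rw [hf.img_comp hρ hm]; exact hF.fullyCentralized hfn)
  obtain ⟨h, hh, hhx⟩ := hF.exists_extension_centralizerIn hρ (hF.fullyCentralized hfn)
  have hg := hg.mono (hTC A hA)
  have hh := hh.mono (hTC _ hfA)
  obtain ⟨k, hk, hkh, -⟩ := hh.exists_inv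
  rw [hh.img_torus hT] at hk
  refine ⟨k ∘ g, hg.comp hk (fun x hx => hg.torus_mem hT hx), fun x hx => ?_⟩
  rw [Function.comp_apply, hgx hx, Function.comp_apply, ← hhx (hm x hx), hkh _ (hfA (hm x hx))]

theorem Saturated.mor_iSup (hF : F.Saturated p) {X : ℕ → Subgroup G} (hX : Monotone X) {f : G → G}
    (h : ∀ n, F.Mor (X n) f) : F.Mor (⨆ n, X n) f := by
  have hmem : ∀ x ∈ ⨆ n, X n, ∃ n, x ∈ X n := fun x hx =>
    (Subgroup.mem_iSup_of_directed hX.directed_le).mp hx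
  let φ : (⨆ n, X n : Subgroup G) →* S :=
    MonoidHom.mk' (fun x => ⟨f x, by
      obtain ⟨n, hn⟩ := hmem x x.2
      exact (h n).mem hn⟩) (by
      intro x y
      obtain ⟨m, hm⟩ := hmem x x.2
      obtain ⟨n, hn⟩ := hmem y y.2
      exact Subtype.ext ((h (max m n)).map_mul (hX (le_max_left m n) hm)
        (hX (le_max_right m n) hn)))
  refine ⟨φ, hF.union X hX (fun n => (h n).le) φ fun n => ?_, fun x => rfl⟩
  exact (h n).hom_mem le_rfl _ (fun x => rfl)

end FusionSystem

end

noncomputable section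

namespace FusionSystem

variable {G : Type*} [Group G] {S T : Subgroup G} {F : FusionSystem S} {p : ℕ}

/-! ### The closure operation `P ↦ P•` -/

theorem Mor.exists_inv_torus [Fact p.Prime] (hT : IsTorusIn p S T) {w : G → G} (hw : F.Mor T w) :
    ∃ v, F.Mor T v ∧ (∀ t ∈ T, v (w t) = t) ∧ ∀ t ∈ T, w (v t) = t := by
  obtain ⟨v, hv, h1, h2⟩ := hw.exists_inv
  rw [hw.img_torus hT] at hv h2
  exact ⟨v, hv, h1, fun t ht => (h2 t ht).2⟩

theorem img_conj_eq (F : FusionSystem S) {P : Subgroup G} (hP : P ≤ S) {s : G} (hs : s ∈ normalizerIn S P) :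
    img (fun x => s * x * s⁻¹) P = P := by
  refine (Mor.conj F hP hs.1).img_eq (fun x hx => conj_mem_of_mem_normalizerIn hs hx)
    fun y hy => ⟨s⁻¹ * y * s, ?_, by group⟩
  have := conj_mem_of_mem_normalizerIn ((normalizerIn S P).inv_mem hs) hy
  simpa using this

/-- The elements of the torus fixed by all its automorphisms which fix the `p^m`-th powers of the
elements of `P`, where `p^m` is the index of the torus. -/
def fixedTorus (F : FusionSystem S) (hT : IsTorusIn p S T) (P : Subgroup G) : Subgroup G :=
  fixedIn (F := F) (hle := hT.le)
    {α | ∀ t : T, (∃ x ∈ P, x ^ p ^ hT.exponent = t) → (α : MulAut T) t = t}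

theorem fixedTorus_le (hT : IsTorusIn p S T) (P : Subgroup G) : F.fixedTorus hT P ≤ T :=
  fixedIn_le _

theorem mem_fixedTorus [Fact p.Prime] (hT : IsTorusIn p S T) {P : Subgroup G} (hP : P ≤ S)
    {t : G} : t ∈ F.fixedTorus hT P ↔ t ∈ T ∧ ∀ w, F.Mor T w →
      (∀ x ∈ P, w (x ^ p ^ hT.exponent) = x ^ p ^ hT.exponent) → w t = t := by
  constructor
  · rintro ⟨ht, h⟩
    refine ⟨ht, fun w hw hx => ?_⟩
    obtain ⟨α, hα, hαw⟩ := hw.exists_aut (hw.img_torus hT)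
    have h1 := h ⟨α, hα⟩ (by
      rintro s ⟨x, hxP, hxs⟩
      apply Subtype.ext
      rw [hαw, ← hxs, hx x hxP])
    have h2 := hαw ⟨t, ht⟩
    simp only at h1 h2
    rw [← h2, h1]
  · rintro ⟨ht, h⟩
    refine ⟨ht, fun α hα => ?_⟩
    have hm : F.Mor T (extendFun (α : MulAut T).toMonoidHom) := (mem_aut_iff hT.le).mp α.2
    have h1 := h _ hm (by
      intro x hx
      have hxT := hT.pow_mem (hP hx)
      rw [extendFun_apply _ hxT]
      exact congrArg Subtype.val (hα ⟨_, hxT⟩ ⟨x, hx, rfl⟩))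
    rw [extendFun_apply _ ht] at h1
    exact Subtype.ext h1

theorem fixedTorus_mono (hT : IsTorusIn p S T) {P Q : Subgroup G} (h : P ≤ Q) :
    F.fixedTorus hT P ≤ F.fixedTorus hT Q := by
  rintro t ⟨ht, ht'⟩
  refine ⟨ht, fun α hα => ht' α ?_⟩
  rintro s ⟨x, hx, hxs⟩
  exact hα s ⟨x, h hx, hxs⟩

/-- The elements of P ⊓ T with image in T form a subgroup, and on it f extends to the torus. A
morphism need not send all of P ⊓ T into T, whence the restriction. -/
theorem Saturated.exists_torus_match [Fact p.Prime] (hF : F.Saturated p) (hT : IsTorusIn p S T)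
    {P : Subgroup G} {f : G → G} (hf : F.Mor P f) :
    ∃ w, F.Mor T w ∧ ∀ x ∈ P, x ∈ T → f x ∈ T → w x = f x := by
  let A : Subgroup G :=
    { carrier := {x | x ∈ P ∧ x ∈ T ∧ f x ∈ T}
      one_mem' := ⟨P.one_mem, T.one_mem, by rw [hf.map_one]; exact T.one_mem⟩
      mul_mem' := fun {x y} hx hy => ⟨P.mul_mem hx.1 hy.1, T.mul_mem hx.2.1 hy.2.1, by
        rw [hf.map_mul hx.1 hy.1]; exact T.mul_mem hx.2.2 hy.2.2⟩
      inv_mem' := fun {x} hx => ⟨P.inv_mem hx.1, T.inv_mem hx.2.1, by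
        rw [hf.map_inv hx.1]; exact T.inv_mem hx.2.2⟩ }
  have hA : F.Mor A f := hf.mono fun x hx => hx.1
  obtain ⟨w, hw, hwx⟩ := hF.exists_extension_torus hT hA (fun x hx => hx.2.1)
    (hA.img_le_iff.mpr fun x hx => hx.2.2)
  exact ⟨w, hw, fun x hx hxT hfx => hwx ⟨hx, hxT, hfx⟩⟩

/-- The torus morphism `w` agrees with `f` on the `p^m`-th powers of elements of `P`. -/
def TorusMatch (F : FusionSystem S) (hT : IsTorusIn p S T) (P : Subgroup G) (f w : G → G) : Prop :=
  F.Mor T w ∧ ∀ x ∈ P, w (x ^ p ^ hT.exponent) = f (x ^ p ^ hT.exponent)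

theorem Saturated.exists_torusMatch [Fact p.Prime] (hF : F.Saturated p) (hT : IsTorusIn p S T)
    {P : Subgroup G} {f : G → G} (hf : F.Mor P f) : ∃ w, F.TorusMatch hT P f w := by
  obtain ⟨w, hw, hwx⟩ := hF.exists_torus_match hT hf
  refine ⟨w, hw, fun x hx => hwx _ (P.pow_mem hx _) (hT.pow_mem (hf.le hx)) ?_⟩
  rw [hf.map_pow hx]
  exact hT.pow_mem (hf.mem hx)

namespace TorusMatch

variable {hT : IsTorusIn p S T} {P : Subgroup G} {f w : G → G}

theorem conj (F : FusionSystem S) (hT : IsTorusIn p S T) (P : Subgroup G) {s : G} (hs : s ∈ S) :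
    F.TorusMatch hT P (fun x => s * x * s⁻¹) (fun x => s * x * s⁻¹) :=
  ⟨Mor.conj F hT.le hs, fun _ _ => rfl⟩

theorem mono (h : F.TorusMatch hT P f w) {Q : Subgroup G} (hQ : Q ≤ P) : F.TorusMatch hT Q f w :=
  ⟨h.1, fun x hx => h.2 x (hQ hx)⟩

theorem congr (h : F.TorusMatch hT P f w) {g : G → G} (hg : Set.EqOn g f P) :
    F.TorusMatch hT P g w :=
  ⟨h.1, fun x hx => by rw [h.2 x hx, hg (P.pow_mem hx _)]⟩

theorem comp [Fact p.Prime] (h : F.TorusMatch hT P f w) (hf : F.Mor P f) {g v : G → G}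
    (h' : F.TorusMatch hT (img f P) g v) : F.TorusMatch hT P (g ∘ f) (v ∘ w) := by
  refine ⟨h.1.comp h'.1 (fun x hx => h.1.torus_mem hT hx), fun x hx => ?_⟩
  rw [Function.comp_apply, Function.comp_apply, h.2 x hx, hf.map_pow hx,
    h'.2 _ (mem_img_of_mem f hx)]

theorem inv (h : F.TorusMatch hT P f w) (hf : F.Mor P f) {g v : G → G}
    (hg : ∀ x ∈ P, g (f x) = x) (hv : F.Mor T v) (hvw : ∀ t ∈ T, v (w t) = t) :
    F.TorusMatch hT (img f P) g v := by
  refine ⟨hv, fun y hy => ?_⟩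
  obtain ⟨x, hx, rfl⟩ := hf.mem_img.mp hy
  rw [← hf.map_pow hx, hg _ (P.pow_mem hx _), ← h.2 x hx, hvw _ (hT.pow_mem (hf.le hx))]

theorem map_fixedTorus [Fact p.Prime] (h : F.TorusMatch hT P f w) (hf : F.Mor P f) {t : G}
    (ht : t ∈ F.fixedTorus hT P) : w t ∈ F.fixedTorus hT (img f P) := by
  rw [mem_fixedTorus hT hf.le] at ht
  rw [mem_fixedTorus hT hf.img_le]
  refine ⟨h.1.torus_mem hT ht.1, fun u hu hux => ?_⟩
  obtain ⟨v, hv, hvw, hwv⟩ := h.1.exists_inv_torus hT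
  have h1 := h.1.comp hu (fun x hx => h.1.torus_mem hT hx)
  have h2 := ht.2 (v ∘ u ∘ w) (h1.comp hv (fun x hx => h1.torus_mem hT hx)) (by
    intro x hx
    change v (u (w _)) = _
    rw [h.2 x hx, hf.map_pow hx, hux _ (mem_img_of_mem f hx), ← hf.map_pow hx, ← h.2 x hx,
      hvw _ (hT.pow_mem (hf.le hx))])
  have h3 := congrArg w h2
  rwa [Function.comp_apply, hwv _ (h1.torus_mem hT ht.1)] at h3

theorem exists_fixedTorus [Fact p.Prime] (h : F.TorusMatch hT P f w) (hf : F.Mor P f) {s : G}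
    (hs : s ∈ F.fixedTorus hT (img f P)) : ∃ t ∈ F.fixedTorus hT P, w t = s := by
  obtain ⟨v, hv, hvw, hwv⟩ := h.1.exists_inv_torus hT
  obtain ⟨g, hg, hgf, hgi⟩ := hf.exists_inv
  have h1 := (h.inv hf hgf hv hvw).map_fixedTorus hg hs
  have h2 : img g (img f P) = P := hg.img_eq (fun y hy => (hgi y hy).1)
    (fun x hx => ⟨f x, mem_img_of_mem f hx, hgf x hx⟩)
  rw [h2] at h1
  exact ⟨v s, h1, hwv s (fixedTorus_le hT _ hs)⟩

/-- Conjugating by y, applying w, undoing conjugation by f(y) and applying w⁻¹ is an F-automorphism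
of T fixing the p^m-th powers of elements of P; hence it fixes t. -/
theorem map_conj [Fact p.Prime] (h : F.TorusMatch hT P f w) (hf : F.Mor P f) {y t : G} (hy : y ∈ P)
    (ht : t ∈ F.fixedTorus hT P) : w (y * t * y⁻¹) = f y * w t * (f y)⁻¹ := by
  rw [mem_fixedTorus hT hf.le] at ht
  obtain ⟨v, hv, hvw, hwv⟩ := h.1.exists_inv_torus hT
  have h1 : F.Mor T (fun x => y * x * y⁻¹) := Mor.conj F hT.le (hf.le hy)
  have h2 : F.Mor T (fun x => (f y)⁻¹ * x * (f y)⁻¹⁻¹) :=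
    Mor.conj F hT.le (S.inv_mem (hf.mem hy))
  have h3 := h1.comp h.1 (fun x hx => h1.torus_mem hT hx)
  have h4 := h3.comp h2 (fun x hx => h3.torus_mem hT hx)
  have h5 := h4.comp hv (fun x hx => h4.torus_mem hT hx)
  have h6 := ht.2 _ h5 (by
    intro x hx
    simp only [Function.comp_apply]
    rw [← conj_pow, h.2 _ (P.mul_mem (P.mul_mem hy hx) (P.inv_mem hy)),
      conj_pow, hf.map_conj hy (P.pow_mem hx _)]
    rw [show (f y)⁻¹ * (f y * f (x ^ p ^ hT.exponent) * (f y)⁻¹) * (f y)⁻¹⁻¹ =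
      f (x ^ p ^ hT.exponent) by group, ← h.2 x hx, hvw _ (hT.pow_mem (hf.le hx))])
  have h7 := congrArg w h6
  simp only [Function.comp_apply] at h7
  have h8 := h4.torus_mem hT ht.1
  simp only [Function.comp_apply] at h8
  rw [hwv _ h8] at h7
  rw [← h7]
  group

/-- Two matching torus morphisms differ by an automorphism of T which fixes the p^m-th powers from
P. -/
theorem eqOn_fixedTorus [Fact p.Prime] (h : F.TorusMatch hT P f w) (hP : P ≤ S) {w' : G → G}
    (h' : F.TorusMatch hT P f w') : Set.EqOn w w' (F.fixedTorus hT P) := by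
  intro t ht
  obtain ⟨v, hv, hvw, hwv⟩ := h'.1.exists_inv_torus hT
  rw [SetLike.mem_coe, mem_fixedTorus hT hP] at ht
  have h1 := ht.2 _ (h.1.comp hv (fun x hx => h.1.torus_mem hT hx)) (by
    intro x hx
    rw [Function.comp_apply, h.2 x hx, ← h'.2 x hx, hvw _ (hT.pow_mem (hP hx))])
  have h2 := congrArg w' h1
  rwa [Function.comp_apply, hwv _ (h.1.torus_mem hT ht.1)] at h2

end TorusMatch

namespace Saturated

variable [Fact p.Prime] (hF : F.Saturated p) (hT : IsTorusIn p S T)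

/-- An exponent for which powers of fixed subgroups of the torus are divisible. -/
def divExponent : ℕ := (hF.exists_divisible_fixedIn hT).choose

/-- The divisible part of the group of fixed elements of the torus. -/
def bulletTorus (P : Subgroup G) : Subgroup G :=
  hT.powSubgroup (fixedTorus_le (F := F) hT P) (p ^ hF.divExponent hT)

/-- The closure `P•`. -/
def bullet (P : Subgroup G) : Subgroup G := P ⊔ hF.bulletTorus hT P

theorem isPDivisible_bulletTorus (P : Subgroup G) : IsPDivisible p (hF.bulletTorus hT P) :=
  (hF.exists_divisible_fixedIn hT).choose_spec _

theorem bulletTorus_le_fixedTorus (P : Subgroup G) : hF.bulletTorus hT P ≤ F.fixedTorus hT P :=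
  hT.powSubgroup_le _ _

theorem bulletTorus_le (P : Subgroup G) : hF.bulletTorus hT P ≤ T :=
  (hF.bulletTorus_le_fixedTorus hT P).trans (fixedTorus_le hT P)

theorem bulletTorus_mono_of_le {P Q : Subgroup G} (h : F.fixedTorus hT P ≤ F.fixedTorus hT Q) :
    hF.bulletTorus hT P ≤ hF.bulletTorus hT Q := by
  rintro _ ⟨a, ha, rfl⟩
  exact ⟨a, h ha, rfl⟩

theorem bulletTorus_mono {P Q : Subgroup G} (h : P ≤ Q) :
    hF.bulletTorus hT P ≤ hF.bulletTorus hT Q :=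
  hF.bulletTorus_mono_of_le hT (fixedTorus_mono hT h)

theorem le_bullet (P : Subgroup G) : P ≤ hF.bullet hT P := le_sup_left

theorem bulletTorus_le_bullet (P : Subgroup G) : hF.bulletTorus hT P ≤ hF.bullet hT P :=
  le_sup_right

theorem bullet_le {P : Subgroup G} (hP : P ≤ S) : hF.bullet hT P ≤ S :=
  sup_le hP ((hF.bulletTorus_le hT P).trans hT.le)

theorem bullet_mono {P Q : Subgroup G} (h : P ≤ Q) : hF.bullet hT P ≤ hF.bullet hT Q :=
  sup_le_sup h (hF.bulletTorus_mono hT h)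

variable {P : Subgroup G} {f w : G → G}

variable {hT} in
theorem map_bulletTorus (h : F.TorusMatch hT P f w) (hf : F.Mor P f) {t : G}
    (ht : t ∈ hF.bulletTorus hT P) : w t ∈ hF.bulletTorus hT (img f P) := by
  obtain ⟨a, ha, rfl⟩ := ht
  exact ⟨w a, h.map_fixedTorus hf ha, (h.1.map_pow (fixedTorus_le hT P ha) _).symm⟩

variable {hT} in
theorem exists_bulletTorus (h : F.TorusMatch hT P f w) (hf : F.Mor P f) {s : G}
    (hs : s ∈ hF.bulletTorus hT (img f P)) : ∃ t ∈ hF.bulletTorus hT P, w t = s := by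
  obtain ⟨a, ha, rfl⟩ := hs
  obtain ⟨t, ht, rfl⟩ := h.exists_fixedTorus hf ha
  exact ⟨_, ⟨t, ht, rfl⟩, h.1.map_pow (fixedTorus_le hT P ht) _⟩

theorem conj_mem_fixedTorus (hP : P ≤ S) {s t : G} (hs : s ∈ normalizerIn S P)
    (ht : t ∈ F.fixedTorus hT P) : s * t * s⁻¹ ∈ F.fixedTorus hT P := by
  have := (TorusMatch.conj F hT P hs.1).map_fixedTorus (Mor.conj F hP hs.1) ht
  rwa [img_conj_eq F hP hs] at this

theorem conj_mem_bulletTorus (hP : P ≤ S) {s t : G} (hs : s ∈ normalizerIn S P)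
    (ht : t ∈ hF.bulletTorus hT P) : s * t * s⁻¹ ∈ hF.bulletTorus hT P := by
  have := hF.map_bulletTorus (TorusMatch.conj F hT P hs.1) (Mor.conj F hP hs.1) ht
  rwa [img_conj_eq F hP hs] at this

theorem mem_bullet (hP : P ≤ S) {g : G} :
    g ∈ hF.bullet hT P ↔ ∃ x ∈ P, ∃ d ∈ hF.bulletTorus hT P, g = x * d := by
  have hle : P ≤ Subgroup.normalizer (hF.bulletTorus hT P : Set G) := by
    intro x hx
    refine mem_normalizer_of_isPGroup (hT.isPGroup le_rfl) (hP hx) fun d hd => ?_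
    exact hF.conj_mem_bulletTorus hT hP (le_normalizerIn hP hx) hd
  rw [bullet, ← SetLike.mem_coe, Subgroup.coe_mul_of_left_le_normalizer_right P _ hle]
  simp only [Set.mem_mul, SetLike.mem_coe]
  constructor
  · rintro ⟨x, hx, c, hc, rfl⟩
    exact ⟨x, hx, c, hc, rfl⟩
  · rintro ⟨x, hx, c, hc, rfl⟩
    exact ⟨x, hx, c, hc, rfl⟩

/-- A power (x d)^n is x^n times an element of the fixed torus of P, so an automorphism fixing the
powers from P also fixes those from P•. Hence the closure operation is idempotent. -/
theorem fixedTorus_bullet (hP : P ≤ S) :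
    F.fixedTorus hT (hF.bullet hT P) = F.fixedTorus hT P := by
  refine le_antisymm ?_ (fixedTorus_mono hT (hF.le_bullet hT P))
  intro t ht
  rw [mem_fixedTorus hT (hF.bullet_le hT hP)] at ht
  rw [mem_fixedTorus hT hP]
  refine ⟨ht.1, fun w hw hwx => ht.2 w hw fun g hg => ?_⟩
  obtain ⟨x, hx, d, hd, rfl⟩ := (hF.mem_bullet hT hP).mp hg
  have hpow : ∀ n, ∃ e ∈ F.fixedTorus hT P, (x * d) ^ n = x ^ n * e := by
    intro n
    induction n with
    | zero => exact ⟨1, Subgroup.one_mem _, by simp⟩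
    | succ n ih =>
      obtain ⟨e, he, hn⟩ := ih
      refine ⟨x⁻¹ * e * x * d, Subgroup.mul_mem _ ?_ (hF.bulletTorus_le_fixedTorus hT P hd), ?_⟩
      · have := conj_mem_fixedTorus hT hP (le_normalizerIn hP (P.inv_mem hx)) he
        simpa using this
      · rw [pow_succ, hn, pow_succ]
        group
  obtain ⟨e, he, hn⟩ := hpow (p ^ hT.exponent)
  rw [hn, hw.map_mul (hT.pow_mem (hP hx)) (fixedTorus_le hT P he), hwx x hx,
    ((mem_fixedTorus hT hP).mp he).2 w hw hwx]

theorem bulletTorus_eq {X : Subgroup G} (hP : P ≤ S) (hPX : P ≤ X) (hX : X ≤ hF.bullet hT P) :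
    F.fixedTorus hT X = F.fixedTorus hT P ∧ hF.bulletTorus hT X = hF.bulletTorus hT P := by
  have h : F.fixedTorus hT X = F.fixedTorus hT P :=
    le_antisymm ((fixedTorus_mono hT hX).trans (hF.fixedTorus_bullet hT hP).le)
      (fixedTorus_mono hT hPX)
  exact ⟨h, le_antisymm (hF.bulletTorus_mono_of_le hT h.le)
    (hF.bulletTorus_mono_of_le hT h.ge)⟩

theorem bullet_eq {X : Subgroup G} (hP : P ≤ S) (hPX : P ≤ X) (hX : X ≤ hF.bullet hT P) :
    hF.bullet hT X = hF.bullet hT P := by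
  refine le_antisymm (sup_le hX ?_) (hF.bullet_mono hT hPX)
  rw [(hF.bulletTorus_eq hT hP hPX hX).2]
  exact hF.bulletTorus_le_bullet hT P

theorem bullet_bullet (hP : P ≤ S) : hF.bullet hT (hF.bullet hT P) = hF.bullet hT P :=
  hF.bullet_eq hT hP (hF.le_bullet hT P) le_rfl

/-- Conjugation by an element centralizing P is an F-automorphism of T fixing the powers of elements
of P, hence fixes the torus added to P. -/
theorem centralizerIn_bullet (hP : P ≤ S) :
    centralizerIn S (hF.bullet hT P) = centralizerIn S P := by
  refine le_antisymm (centralizerIn_anti (hF.le_bullet hT P)) fun c hc => ?_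
  rw [mem_centralizerIn] at hc ⊢
  refine ⟨hc.1, fun g hg => ?_⟩
  obtain ⟨x, hx, d, hd, rfl⟩ := (hF.mem_bullet hT hP).mp hg
  have h1 := ((mem_fixedTorus hT hP).mp (hF.bulletTorus_le_fixedTorus hT P hd)).2 _
    (Mor.conj F hT.le hc.1) (fun x hx => by
      rw [← hc.2 _ (P.pow_mem hx _), mul_inv_cancel_right])
  have h2 : c * d = d * c := mul_inv_eq_iff_eq_mul.mp h1
  rw [mul_assoc, ← h2, ← mul_assoc, hc.2 x hx, mul_assoc]

variable {hT} in
-- The difficulty is that f(y) is not known to lie in T. Move f(P ⊓ T) by σ to a fully normalized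
-- subgroup. Then σ ∘ f on P ⊓ T extends to w' on T, and σ extends to τ on f(P ⊓ T) C_S(f(P ⊓ T)),
-- which contains the elements w(d). A torus morphism u matching τ makes u ∘ w and w' agree on the
-- fixed torus, so τ(w(y)) = τ(f(y)).
theorem eqOn_bulletTorus_aux (h : F.TorusMatch hT P f w) (hf : F.Mor P f) {y : G} (hy : y ∈ P)
    (hyD : y ∈ hF.bulletTorus hT P) : f y = w y := by
  have hD := hF.bulletTorus_le_fixedTorus hT P
  have hA : P ⊓ T ≤ P := inf_le_left
  have hfA := hf.mono hA
  obtain ⟨σ, hσ, hfn⟩ := hF.exists_fullyNormalized hT hfA.img_le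
  have hm : ∀ x ∈ P ⊓ T, f x ∈ img f (P ⊓ T) := fun x hx => mem_img_of_mem f hx
  obtain ⟨w', hw', hw'x⟩ := hF.exists_extension_centralizerIn (hfA.comp hσ hm)
    (by rw [hfA.img_comp hσ hm]; exact hF.fullyCentralized hfn)
  obtain ⟨τ, hτ, hτx⟩ := hF.exists_extension_centralizerIn hσ (hF.fullyCentralized hfn)
  have hw' : F.Mor T w' := hw'.mono fun t ht => Subgroup.mem_sup_right
    (mem_centralizerIn.mpr ⟨hT.le ht, fun x hx => hT.comm x hx.2 t ht⟩)
  have hwD : ∀ d ∈ hF.bulletTorus hT P, w d ∈ centralizerIn S (img f (P ⊓ T)) := by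
    intro d hd
    refine mem_centralizerIn.mpr ⟨h.1.mem (hF.bulletTorus_le hT P hd), fun z hz => ?_⟩
    obtain ⟨x, hx, rfl⟩ := hfA.mem_img.mp hz
    have h1 := h.map_conj hf hx.1 (hD hd)
    rw [hT.comm x hx.2 d (hF.bulletTorus_le hT P hd), mul_inv_cancel_right] at h1
    exact (mul_inv_eq_iff_eq_mul.mp h1.symm)
  have hwDS : ∀ d ∈ hF.bulletTorus hT P, w d ∈ img f (P ⊓ T) ⊔ centralizerIn S (img f (P ⊓ T)) :=
    fun d hd => Subgroup.mem_sup_right (hwD d hd)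
  obtain ⟨u, hu, hux⟩ := hF.exists_torus_match hT hτ
  have hτT : ∀ d ∈ hF.bulletTorus hT P, τ (w d) ∈ T := by
    intro d hd
    have hd1 := h.1.mono (hF.bulletTorus_le hT P)
    have hd2 := hd1.comp hτ hwDS
    exact hT.le_of_divisible (hd2.isPDivisible_img (hF.isPDivisible_bulletTorus hT P))
      hd2.img_le (mem_img_of_mem _ hd)
  have huw : ∀ d ∈ hF.bulletTorus hT P, u (w d) = τ (w d) := fun d hd =>
    hux _ (hwDS d hd) (h.1.torus_mem hT (hF.bulletTorus_le hT P hd)) (hτT d hd)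
  have hτf : ∀ x ∈ P ⊓ T, τ (f x) = w' x := fun x hx => by
    rw [hτx (hm x hx), hw'x hx]
    rfl
  have hmatch : F.TorusMatch hT P w' (u ∘ w) := by
    refine ⟨h.1.comp hu fun x hx => h.1.torus_mem hT hx, fun x hx => ?_⟩
    have hxA : x ^ p ^ hT.exponent ∈ P ⊓ T := ⟨P.pow_mem hx _, hT.pow_mem (hf.le hx)⟩
    rw [Function.comp_apply, h.2 x hx, ← hτf _ hxA]
    refine hux _ (Subgroup.mem_sup_left (hm _ hxA)) ?_ ?_
    · rw [← h.2 x hx]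
      exact h.1.torus_mem hT hxA.2
    · rw [hτf _ hxA]
      exact hw'.torus_mem hT hxA.2
  have hy' : y ∈ P ⊓ T := ⟨hy, hF.bulletTorus_le hT P hyD⟩
  have h1 := hmatch.eqOn_fixedTorus hf.le ⟨hw', fun _ _ => rfl⟩ (hD hyD)
  rw [Function.comp_apply, huw y hyD, ← hτf y hy'] at h1
  exact (hτ.eq_of_eq (hwDS y hyD) (Subgroup.mem_sup_left (hm y hy')) h1).symm

variable {hT} in
/-- A morphism agrees with a matching torus morphism on the torus part of the closure. -/
theorem eqOn_bulletTorus {X : Subgroup G} (h : F.TorusMatch hT P f w) (hPX : P ≤ X)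
    (hX : X ≤ hF.bullet hT P) (hf : F.Mor X f) {y : G} (hy : y ∈ X)
    (hyD : y ∈ hF.bulletTorus hT P) : f y = w y := by
  obtain ⟨w', hw'⟩ := hF.exists_torusMatch hT hf
  have hP := hPX.trans hf.le
  rw [hF.eqOn_bulletTorus_aux hw' hf hy ((hF.bulletTorus_eq hT hP hPX hX).2 ▸ hyD)]
  exact (hw'.mono hPX).eqOn_fixedTorus hP h (hF.bulletTorus_le_fixedTorus hT P hyD)

variable {hT} in
-- The commutator of d and x lies both in P and in the added torus, where f and w agree. So w(d)
-- induces on f(P) what d induces on P, which is the condition of axiom (II).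
theorem map_conj_of_normalizes (h : F.TorusMatch hT P f w) (hf : F.Mor P f) {d x : G}
    (hd : d ∈ hF.bulletTorus hT P) (hdP : ∀ x ∈ P, d * x * d⁻¹ ∈ P) (hx : x ∈ P) :
    f (d * x * d⁻¹) = w d * f x * (w d)⁻¹ := by
  have hxd : x * d⁻¹ * x⁻¹ ∈ hF.bulletTorus hT P :=
    hF.conj_mem_bulletTorus hT hf.le (le_normalizerIn hf.le hx) (Subgroup.inv_mem _ hd)
  have h1 : d * x * d⁻¹ * x⁻¹ = d * (x * d⁻¹ * x⁻¹) := by group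
  have h2 : d * x * d⁻¹ * x⁻¹ ∈ hF.bulletTorus hT P := by
    rw [h1]
    exact Subgroup.mul_mem _ hd hxd
  have h3 : d * x * d⁻¹ * x⁻¹ ∈ P := P.mul_mem (hdP x hx) (P.inv_mem hx)
  have h4 := hF.eqOn_bulletTorus h le_rfl (hF.le_bullet hT P) hf h3 h2
  have hle := hF.bulletTorus_le hT P
  rw [hf.map_mul (hdP x hx) (P.inv_mem hx), h1, h.1.map_mul (hle hd) (hle hxd),
    h.map_conj hf hx (hF.bulletTorus_le_fixedTorus hT P (Subgroup.inv_mem _ hd)),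
    h.1.map_inv (hle hd), hf.map_inv hx, mul_inv_eq_iff_eq_mul] at h4
  rw [h4]
  group

end Saturated

end FusionSystem

end

noncomputable section

namespace FusionSystem

namespace Saturated

variable {G : Type*} [Group G] {S T : Subgroup G} {F : FusionSystem S} {p : ℕ} [Fact p.Prime]
  (hF : F.Saturated p) (hT : IsTorusIn p S T) {P : Subgroup G} {f w : G → G}

/-! ### Extension of morphisms to closures -/

/-- An element x d of P• normalizing P is matched on the target by f(x) w(d), so N lies in the
extension domain of f. -/
theorem exists_extension_bullet_of_fullyCentralized (hf : F.Mor P f)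
    (hfc : F.FullyCentralized p (img f P)) {N : Subgroup G} (hPN : P ≤ N)
    (hNB : N ≤ hF.bullet hT P) (hN : ∀ g ∈ N, ∀ x ∈ P, g * x * g⁻¹ ∈ P) :
    ∃ f', F.Mor N f' ∧ Set.EqOn f' f P := by
  obtain ⟨w, hw⟩ := hF.exists_torusMatch hT hf
  refine hF.exists_extension hf hfc hPN (hNB.trans (hF.bullet_le hT hf.le)) hN fun n hn => ?_
  obtain ⟨x, hx, d, hd, rfl⟩ := (hF.mem_bullet hT hf.le).mp (hNB hn)
  have hdN : d ∈ N := by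
    have := N.mul_mem (N.inv_mem (hPN hx)) hn
    rwa [inv_mul_cancel_left] at this
  refine ⟨f x * w d, S.mul_mem (hf.mem hx) (hw.1.mem (hF.bulletTorus_le hT P hd)), fun y hy => ?_⟩
  have h1 := hF.map_conj_of_normalizes hw hf hd (hN d hdN) hy
  have h2 : x * d * y * (x * d)⁻¹ = x * (d * y * d⁻¹) * x⁻¹ := by group
  rw [h2, hf.map_conj hx (hN d hdN y hy), h1]
  group

variable {hT} in
-- The condition on the target is removed by a detour: for ρ onto a fully normalized conjugate, ρ ∘
-- f extends to g on N and ρ extends to τ on the normalizer of f(P) in its closure. The image of g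
-- lies in that of τ, so τ⁻¹ ∘ g is defined.
theorem exists_extension_normalizer_bullet (h : F.TorusMatch hT P f w) (hf : F.Mor P f)
    {N : Subgroup G} (hPN : P ≤ N) (hNB : N ≤ hF.bullet hT P)
    (hN : ∀ g ∈ N, ∀ x ∈ P, g * x * g⁻¹ ∈ P) :
    ∃ f', F.Mor N f' ∧ Set.EqOn f' f P := by
  obtain ⟨ρ, hρ, hfn⟩ := hF.exists_fullyNormalized hT hf.img_le
  obtain ⟨v, hv⟩ := hF.exists_torusMatch hT hρ
  have hm : ∀ x ∈ P, f x ∈ img f P := fun x hx => mem_img_of_mem f hx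
  obtain ⟨g, hg, hgx⟩ := hF.exists_extension_bullet_of_fullyCentralized hT (hf.comp hρ hm)
    (by rw [hf.img_comp hρ hm]; exact hF.fullyCentralized hfn) hPN hNB hN
  have hNR : img f P ≤ hF.bullet hT (img f P) ⊓ normalizerIn S (img f P) :=
    le_inf (hF.le_bullet hT _) (le_normalizerIn hf.img_le)
  obtain ⟨τ, hτ, hτx⟩ := hF.exists_extension_bullet_of_fullyCentralized hT hρ
    (hF.fullyCentralized hfn) hNR inf_le_left
    (fun s hs x hx => conj_mem_of_mem_normalizerIn hs.2 hx)
  obtain ⟨k, hk, hkτ, -⟩ := hτ.exists_inv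
  have hcomp := (h.comp hf hv).congr hgx
  have key : ∀ n ∈ N, ∃ z ∈ hF.bullet hT (img f P) ⊓ normalizerIn S (img f P), τ z = g n := by
    intro n hn
    obtain ⟨x, hx, d, hd, rfl⟩ := (hF.mem_bullet hT hf.le).mp (hNB hn)
    have hdN : d ∈ N := by
      have := N.mul_mem (N.inv_mem (hPN hx)) hn
      rwa [inv_mul_cancel_left] at this
    have hwd := hF.map_bulletTorus h hf hd
    have hwdN : w d ∈ hF.bullet hT (img f P) ⊓ normalizerIn S (img f P) := by
      refine ⟨hF.bulletTorus_le_bullet hT _ hwd, mem_normalizerIn_of_forall hT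
        (h.1.mem (hF.bulletTorus_le hT P hd)) fun y hy => ?_⟩
      obtain ⟨y, hyP, rfl⟩ := hf.mem_img.mp hy
      rw [← hF.map_conj_of_normalizes h hf hd (hN d hdN) hyP]
      exact hm _ (hN d hdN y hyP)
    refine ⟨f x * w d, Subgroup.mul_mem _ (hNR (hm x hx)) hwdN, ?_⟩
    rw [hτ.map_mul (hNR (hm x hx)) hwdN, hg.map_mul (hPN hx) hdN, hτx (hm x hx), hgx hx,
      hF.eqOn_bulletTorus hcomp hPN hNB hg hdN hd,
      hF.eqOn_bulletTorus (hv.congr hτx) hNR inf_le_left hτ hwdN hwd]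
    rfl
  refine ⟨k ∘ g, hg.comp hk fun n hn => ?_, fun x hx => ?_⟩
  · obtain ⟨z, hz, hzn⟩ := key n hn
    exact hzn ▸ mem_img_of_mem τ hz
  · rw [Function.comp_apply, hgx hx, Function.comp_apply, ← hτx (hm x hx), hkτ _ (hNR (hm x hx))]

open Classical in
/-- Every morphism extends to the closure of its source. -/
theorem exists_extension_bullet (hf : F.Mor P f) :
    ∃ f', F.Mor (hF.bullet hT P) f' ∧ Set.EqOn f' f P := by
  obtain ⟨w, h⟩ := hF.exists_torusMatch hT hf
  let D := hF.bulletTorus hT P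
  have hDT : D ≤ T := hF.bulletTorus_le hT P
  -- The only candidate is x d ↦ f(x) w(d). It is well defined because f and w agree on the
  -- intersection of P with the added torus.
  let e : G → G := fun g => if hg : ∃ z : G × G, z.1 ∈ P ∧ z.2 ∈ D ∧ g = z.1 * z.2 then
    f hg.choose.1 * w hg.choose.2 else 1
  have he : ∀ x ∈ P, ∀ d ∈ D, e (x * d) = f x * w d := by
    intro x hx d hd
    have hex : ∃ z : G × G, z.1 ∈ P ∧ z.2 ∈ D ∧ x * d = z.1 * z.2 := ⟨(x, d), hx, hd, rfl⟩
    have h1 : e (x * d) = f hex.choose.1 * w hex.choose.2 := dif_pos hex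
    obtain ⟨hy, hc, hyc⟩ := hex.choose_spec
    rw [h1]
    generalize hex.choose.1 = y at *
    generalize hex.choose.2 = c at *
    have h2 : y⁻¹ * x = c * d⁻¹ := by
      rw [inv_mul_eq_iff_eq_mul, ← mul_assoc, ← hyc, mul_inv_cancel_right]
    have h3 := hF.eqOn_bulletTorus h le_rfl (hF.le_bullet hT P) hf
      (P.mul_mem (P.inv_mem hy) hx) (by rw [h2]; exact D.mul_mem hc (D.inv_mem hd))
    conv_rhs at h3 => rw [h2]
    rw [hf.map_mul (P.inv_mem hy) hx, hf.map_inv hy, h.1.map_mul (hDT hc) (hDT (D.inv_mem hd)),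
      h.1.map_inv (hDT hd), inv_mul_eq_iff_eq_mul] at h3
    rw [h3]
    group
  have heP : Set.EqOn e f P := by
    intro x hx
    have := he x hx 1 D.one_mem
    rwa [mul_one, h.1.map_one, mul_one] at this
  -- Extend along iterated normalizers of P in P•. Their union is P•, and axiom (III) passes to the
  -- limit.
  let X : ℕ → Subgroup G := fun n =>
    n.rec P (fun _ Y => hF.bullet hT P ⊓ normalizerIn S Y)
  have hX1 : ∀ n, X (n + 1) = hF.bullet hT P ⊓ normalizerIn S (X n) := fun n => rfl
  have hXB : ∀ n, X n ≤ hF.bullet hT P := by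
    intro n
    cases n with
    | zero => exact hF.le_bullet hT P
    | succ n => exact inf_le_left
  have hXS : ∀ n, X n ≤ S := fun n => (hXB n).trans (hF.bullet_le hT hf.le)
  have hmono : Monotone X := monotone_nat_of_le_succ fun n => by
    rw [hX1]
    exact le_inf (hXB n) (le_normalizerIn (hXS n))
  have hPX : ∀ n, P ≤ X n := fun n => hmono (Nat.zero_le n)
  have hmor : ∀ n, F.Mor (X n) e := by
    intro n
    induction n with
    | zero => exact hf.congr heP
    | succ n ih =>
      obtain ⟨w', hw'⟩ := hF.exists_torusMatch hT ih
      have hB := hF.bullet_eq hT hf.le (hPX n) (hXB n)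
      have hBt := (hF.bulletTorus_eq hT hf.le (hPX n) (hXB n)).2
      obtain ⟨f', hf', hfe⟩ := hF.exists_extension_normalizer_bullet hw' ih
        (N := X (n + 1)) (hmono n.le_succ) (hB ▸ hXB (n + 1))
        (fun g hg x hx => conj_mem_of_mem_normalizerIn (hX1 n ▸ hg).2 hx)
      -- Any extension of f is forced to equal w on the added torus, so it coincides with e. Thus
      -- one function serves at all stages.
      refine hf'.congr fun g hg => ?_
      obtain ⟨x, hx, d, hd, rfl⟩ := (hF.mem_bullet hT hf.le).mp (hXB (n + 1) hg)
      have hdX : d ∈ X (n + 1) := by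
        have := (X (n + 1)).mul_mem ((X (n + 1)).inv_mem (hPX (n + 1) hx)) hg
        rwa [inv_mul_cancel_left] at this
      have hm : F.TorusMatch hT P f' w :=
        h.congr fun y hy => by rw [hfe (hPX n hy), heP hy]
      rw [he x hx d hd, hf'.map_mul (hPX (n + 1) hx) hdX, hfe (hPX n hx), heP hx,
        hF.eqOn_bulletTorus hm (hPX (n + 1)) (hXB (n + 1)) hf' hdX hd]
  have hB := hT.le_iSup_of_normalizer hf.le hDT
    (fun x hx d hd => hF.conj_mem_bulletTorus hT hf.le (le_normalizerIn hf.le hx) hd)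
    (fun g => hF.mem_bullet hT hf.le) X rfl hmono hXB
    (fun n g hg hgn => ⟨hg, hF.bullet_le hT hf.le hg, hgn⟩)
  exact ⟨e, hB ▸ hF.mor_iSup hmono hmor, heP⟩

theorem eqOn_bullet (hf : F.Mor (hF.bullet hT P) f) {g : G → G}
    (hg : F.Mor (hF.bullet hT P) g) (h : Set.EqOn f g P) : Set.EqOn f g (hF.bullet hT P) := by
  have hP := (hF.le_bullet hT P).trans hf.le
  obtain ⟨w, hw⟩ := hF.exists_torusMatch hT (hf.mono (hF.le_bullet hT P))
  intro y hy
  obtain ⟨x, hx, d, hd, rfl⟩ := (hF.mem_bullet hT hP).mp hy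
  have hxB := hF.le_bullet hT P hx
  have hdB := hF.bulletTorus_le_bullet hT P hd
  rw [hf.map_mul hxB hdB, hg.map_mul hxB hdB, h hx,
    hF.eqOn_bulletTorus hw (hF.le_bullet hT P) le_rfl hf hdB hd,
    hF.eqOn_bulletTorus (hw.congr h.symm) (hF.le_bullet hT P) le_rfl hg hdB hd]

theorem img_bullet (hf : F.Mor (hF.bullet hT P) f) :
    img f (hF.bullet hT P) = hF.bullet hT (img f P) := by
  have hPf := hf.mono (hF.le_bullet hT P)
  obtain ⟨w, hw⟩ := hF.exists_torusMatch hT hPf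
  have hfw : ∀ d ∈ hF.bulletTorus hT P, f d = w d := fun d hd =>
    hF.eqOn_bulletTorus hw (hF.le_bullet hT P) le_rfl hf (hF.bulletTorus_le_bullet hT P hd) hd
  refine hf.img_eq (fun y hy => ?_) (fun z hz => ?_)
  · obtain ⟨x, hx, d, hd, rfl⟩ := (hF.mem_bullet hT hPf.le).mp hy
    rw [hf.map_mul (hF.le_bullet hT P hx) (hF.bulletTorus_le_bullet hT P hd), hfw d hd]
    exact (hF.mem_bullet hT hPf.img_le).mpr
      ⟨_, mem_img_of_mem f hx, _, hF.map_bulletTorus hw hPf hd, rfl⟩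
  · obtain ⟨y, hy, c, hc, rfl⟩ := (hF.mem_bullet hT hPf.img_le).mp hz
    obtain ⟨x, hx, rfl⟩ := hPf.mem_img.mp hy
    obtain ⟨d, hd, rfl⟩ := hF.exists_bulletTorus hw hPf hc
    refine ⟨x * d, (hF.mem_bullet hT hPf.le).mpr ⟨x, hx, d, hd, rfl⟩, ?_⟩
    rw [hf.map_mul (hF.le_bullet hT P hx) (hF.bulletTorus_le_bullet hT P hd), hfw d hd]

theorem fullyCentralized_bullet (hP : F.FullyCentralized p P) :
    F.FullyCentralized p (hF.bullet hT P) := by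
  rw [fullyCentralized_iff] at hP ⊢
  refine ⟨hF.bullet_le hT hP.1, fun f hf => ?_⟩
  have hPf := hf.mono (hF.le_bullet hT P)
  rw [hF.img_bullet hT hf, hF.centralizerIn_bullet hT hPf.img_le,
    hF.centralizerIn_bullet hT hP.1]
  exact hP.2 f hPf

/-! ### The height of a subgroup -/

/-- The bound does not depend on P: for a ∈ P• ⊓ T, the power a^{p^m} is in the fixed torus of P• by
definition, and a further uniform power lies in the divisible part. Hence closed subgroups have only
finitely many orders. -/
theorem toralOrder_bullet_snd_le (hP : P ≤ S) :
    (ofLex (toralOrder p (hF.bullet hT P))).2 ≤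
      {t | t ∈ T ∧ t ^ p ^ (hT.exponent + hF.divExponent hT) = 1}.ncard * T.relIndex S := by
  refine hT.toralOrder_snd_le (hF.bullet_le hT hP) (hF.bulletTorus_le_bullet hT P)
    (hF.isPDivisible_bulletTorus hT P) ?_
  rintro a ⟨ha, haT⟩
  rw [pow_add, pow_mul, ← (hF.bulletTorus_eq hT hP (hF.le_bullet hT P) le_rfl).2]
  refine ⟨_, ?_, rfl⟩
  rw [mem_fixedTorus hT (hF.bullet_le hT hP)]
  exact ⟨T.pow_mem haT _, fun w _ hwx => hwx a ha⟩

/-- The set of possible orders of closed subgroups larger than that of `P•`. -/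
def largerOrders (P : Subgroup G) : Set (ℕ ×ₗ ℕ) :=
  {o | toralOrder p (hF.bullet hT P) < o ∧ (ofLex o).1 ≤ (ofLex (toralOrder p S)).1 ∧
    (ofLex o).2 ≤ {t | t ∈ T ∧ t ^ p ^ (hT.exponent + hF.divExponent hT) = 1}.ncard *
      T.relIndex S}

/-- A natural number measuring how far `P•` is from `S`. -/
def height (P : Subgroup G) : ℕ := (hF.largerOrders hT P).ncard

theorem finite_largerOrders (P : Subgroup G) : (hF.largerOrders hT P).Finite := by
  refine Set.Finite.subset (((Set.finite_Iic (ofLex (toralOrder p S)).1).prod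
    (Set.finite_Iic ({t | t ∈ T ∧ t ^ p ^ (hT.exponent + hF.divExponent hT) = 1}.ncard *
      T.relIndex S))).image toLex) ?_
  intro o ho
  exact ⟨ofLex o, ⟨ho.2.1, ho.2.2⟩, rfl⟩

theorem height_anti {X : Subgroup G} (h : P ≤ X) (hX : X ≤ S) :
    hF.height hT X ≤ hF.height hT P := by
  refine Set.ncard_le_ncard ?_ (hF.finite_largerOrders hT P)
  intro o ho
  exact ⟨(hT.toralOrder_mono (hF.bullet_mono hT h) (hF.bullet_le hT hX)).trans_lt ho.1, ho.2⟩

/-- If the height does not drop, the nested closures of P and X have the same order and so coincide.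
This is how strict decrease of the height gets established. -/
theorem le_bullet_of_height_le {X : Subgroup G} (h : P ≤ X) (hX : X ≤ S)
    (hh : hF.height hT P ≤ hF.height hT X) : X ≤ hF.bullet hT P := by
  have hmono := hT.toralOrder_mono (hF.bullet_mono hT h) (hF.bullet_le hT hX)
  have hsub : hF.largerOrders hT X ⊆ hF.largerOrders hT P := fun o ho =>
    ⟨hmono.trans_lt ho.1, ho.2⟩
  have heq := Set.eq_of_subset_of_ncard_le hsub hh (hF.finite_largerOrders hT P)
  have hle : toralOrder p (hF.bullet hT X) ≤ toralOrder p (hF.bullet hT P) := by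
    by_contra hlt
    have : toralOrder p (hF.bullet hT X) ∈ hF.largerOrders hT P :=
      ⟨not_le.mp hlt, hT.toralOrder_fst_le (hF.bullet_le hT hX),
        hF.toralOrder_bullet_snd_le hT hX⟩
    rw [← heq] at this
    exact lt_irrefl _ this.1
  rw [hT.eq_of_toralOrder_le (hF.bullet_mono hT h) (hF.bullet_le hT hX) hle]
  exact hF.le_bullet hT X

theorem height_bullet (hP : P ≤ S) : hF.height hT (hF.bullet hT P) = hF.height hT P := by
  rw [height, height, largerOrders, largerOrders, hF.bullet_bullet hT hP]

theorem height_img (hf : F.Mor P f) : hF.height hT (img f P) = hF.height hT P := by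
  obtain ⟨f', hf', hfe⟩ := hF.exists_extension_bullet hT hf
  rw [height, height, largerOrders, largerOrders, ← img_congr hfe, ← hF.img_bullet hT hf',
    hf'.toralOrder_img]

/-- A closed subgroup properly contained in `X` has larger height. -/
theorem height_lt {X : Subgroup G} (hP : hF.bullet hT P = P) (h : P ≤ X) (hX : X ≤ S)
    (hne : ¬ X ≤ P) : hF.height hT X < hF.height hT P := by
  by_contra hlt
  exact hne (hP ▸ hF.le_bullet_of_height_le hT h hX (not_lt.mp hlt))

theorem bullet_img (hf : F.Mor P f) (hP : hF.bullet hT P = P) :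
    hF.bullet hT (img f P) = img f P := by
  have := hF.img_bullet hT (P := P) (f := f) (by rwa [hP])
  rw [← this, hP]

end Saturated

end FusionSystem

end

noncomputable section

namespace FusionSystem

variable {G : Type*} [Group G] {S T : Subgroup G} {F : FusionSystem S} {p : ℕ}

/-! ### Centric subgroups -/

/-- `P` is `F`-centric: `C_S(Q) ≤ Q` for all `F`-conjugates `Q` of `P`. -/
def Cen (F : FusionSystem S) (P : Subgroup G) : Prop :=
  P ≤ S ∧ ∀ f, F.Mor P f → centralizerIn S (img f P) ≤ img f P

theorem Cen.centralizerIn_le {P : Subgroup G} (h : F.Cen P) : centralizerIn S P ≤ P := by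
  have := h.2 _ (Mor.id F h.1)
  rwa [img_id] at this

theorem Cen.mono {P X : Subgroup G} (h : F.Cen P) (hPX : P ≤ X) (hX : X ≤ S) : F.Cen X :=
  ⟨hX, fun f hf => (centralizerIn_anti (img_mono f hPX)).trans
    ((h.2 f (hf.mono hPX)).trans (img_mono f hPX))⟩

theorem Cen.map {P : Subgroup G} (h : F.Cen P) {f : G → G} (hf : F.Mor P f) : F.Cen (img f P) := by
  have hm : ∀ x ∈ P, f x ∈ img f P := fun x hx => mem_img_of_mem f hx
  refine ⟨hf.img_le, fun g hg => ?_⟩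
  rw [← hf.img_comp hg hm]
  exact h.2 _ (hf.comp hg hm)

theorem Mor.img_centralizerIn_le {P X : Subgroup G} {f : G → G} (hf : F.Mor X f) (hPX : P ≤ X)
    (hCX : centralizerIn S P ≤ X) :
    img f (centralizerIn S P) ≤ centralizerIn S (img f P) := by
  refine (hf.mono hCX).img_le_iff.mpr fun c hc => mem_centralizerIn.mpr ⟨hf.mem (hCX hc), ?_⟩
  intro y hy
  obtain ⟨x, hx, rfl⟩ := (hf.mono hPX).mem_img.mp hy
  rw [← hf.map_mul (hPX hx) (hCX hc), ← hf.map_mul (hCX hc) (hPX hx),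
    (mem_centralizerIn.mp hc).2 x hx]

/-- For centric P, the centralizer of a conjugate f(P) is contained in f(P), hence in the image of
the centralizer of P. -/
theorem Cen.fullyCentralized [Fact p.Prime] (hT : IsTorusIn p S T) {P : Subgroup G} (h : F.Cen P) :
    F.FullyCentralized p P := by
  refine fullyCentralized_iff.mpr ⟨h.1, fun f hf => ?_⟩
  have hC := h.centralizerIn_le
  rw [← (hf.mono hC).toralOrder_img]
  refine hT.toralOrder_mono ?_ (hf.mono hC).img_le
  intro c hc
  obtain ⟨x, hx, rfl⟩ := hf.mem_img.mp (h.2 f hf hc)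
  refine mem_img_of_mem f (mem_centralizerIn.mpr ⟨h.1 hx, fun y hy => ?_⟩)
  refine hf.eq_of_eq (P.mul_mem hy hx) (P.mul_mem hx hy) ?_
  rw [hf.map_mul hy hx, hf.map_mul hx hy]
  exact (mem_centralizerIn.mp hc).2 _ (mem_img_of_mem f hy)

/-- The image of C_S(R) is contained in C_S(g(R)), whose order cannot exceed that of C_S(R). -/
theorem FullyCentralized.img_centralizerIn [Fact p.Prime] (hT : IsTorusIn p S T) {R X : Subgroup G}
    (h : F.FullyCentralized p R) {g : G → G} (hg : F.Mor X g) (hRX : R ≤ X)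
    (hCX : centralizerIn S R ≤ X) : img g (centralizerIn S R) = centralizerIn S (img g R) := by
  refine hT.eq_of_toralOrder_le (hg.img_centralizerIn_le hRX hCX) centralizerIn_le ?_
  rw [(hg.mono hCX).toralOrder_img]
  exact (fullyCentralized_iff.mp h).2 g (hg.mono hRX)

/-- The centralizer of g(R C_S(R)) is contained in C_S(g(R)) = g(C_S(R)). These are the centric
subgroups to which residuals of R are lifted. -/
theorem FullyCentralized.cen_sup [Fact p.Prime] (hT : IsTorusIn p S T) {R : Subgroup G}
    (h : F.FullyCentralized p R) : F.Cen (R ⊔ centralizerIn S R) := by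
  refine ⟨sup_centralizerIn_le h.1, fun g hg => ?_⟩
  refine (centralizerIn_anti (img_mono g le_sup_left)).trans ?_
  rw [← h.img_centralizerIn hT hg le_sup_left le_sup_right]
  exact img_mono g le_sup_right

theorem Mor.img_sup_centralizerIn [Fact p.Prime] (hT : IsTorusIn p S T) {R : Subgroup G}
    (h : F.FullyCentralized p R) {g : G → G} (hg : F.Mor (R ⊔ centralizerIn S R) g) :
    img g (R ⊔ centralizerIn S R) =
      img g R ⊔ centralizerIn S (img g R) := by
  rw [← h.img_centralizerIn hT hg le_sup_left le_sup_right]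
  refine le_antisymm (hg.img_le_iff.mpr fun x hx => ?_)
    (sup_le (img_mono g le_sup_left) (img_mono g le_sup_right))
  obtain ⟨y, hy, c, hc, rfl⟩ := mem_sup_centralizerIn.mp hx
  rw [hg.map_mul (Subgroup.mem_sup_left hy) (Subgroup.mem_sup_right hc)]
  exact Subgroup.mul_mem _ (Subgroup.mem_sup_left (mem_img_of_mem g hy))
    (Subgroup.mem_sup_right (mem_img_of_mem g hc))

theorem Mor.img_self [Fact p.Prime] (hT : IsTorusIn p S T) {a : G → G} (h : F.Mor S a) :
    img a S = S :=
  hT.eq_of_toralOrder_le h.img_le le_rfl h.toralOrder_img.ge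

theorem Mor.exists_inv_self [Fact p.Prime] (hT : IsTorusIn p S T) {a : G → G} (h : F.Mor S a) :
    ∃ b, F.Mor S b ∧ (∀ x ∈ S, b (a x) = x) ∧ ∀ x ∈ S, a (b x) = x := by
  obtain ⟨b, hb, h1, h2⟩ := h.exists_inv
  rw [h.img_self hT] at hb h2
  exact ⟨b, hb, h1, fun x hx => (h2 x hx).2⟩

theorem Mor.img_img_self {a b : G → G} (hb : F.Mor S b) (ha : F.Mor S a)
    (hba : ∀ x ∈ S, b (a x) = x) {P : Subgroup G} (hP : P ≤ S) :
    img b (img a P) = P := by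
  rw [← (ha.mono hP).img_comp hb (fun x hx => ha.mem (hP hx)),
    img_congr (f := b ∘ a) (g := fun x => x) (fun x hx => hba x (hP hx)), img_id]

theorem cen_self [Fact p.Prime] (hT : IsTorusIn p S T) : F.Cen S :=
  ⟨le_rfl, fun f hf => by rw [hf.img_self hT]; exact FusionSystem.centralizerIn_le⟩

theorem Mor.img_normalizerIn [Fact p.Prime] (hT : IsTorusIn p S T) {a : G → G} (ha : F.Mor S a)
    {P : Subgroup G} (hP : P ≤ S) :
    img a (normalizerIn S P) = normalizerIn S (img a P) := by
  have key : ∀ a, F.Mor S a → ∀ P ≤ S,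
      img a (normalizerIn S P) ≤ normalizerIn S (img a P) := by
    intro a ha P hP
    refine (ha.mono normalizerIn_le).img_le_iff.mpr fun g hg => ?_
    refine mem_normalizerIn_of_forall hT (ha.mem hg.1) fun y hy => ?_
    obtain ⟨x, hx, rfl⟩ := (ha.mono hP).mem_img.mp hy
    rw [← ha.map_conj hg.1 (hP hx)]
    exact mem_img_of_mem a (conj_mem_of_mem_normalizerIn hg hx)
  refine le_antisymm (key a ha P hP) fun g hg => ?_
  obtain ⟨b, hb, hba, hab⟩ := ha.exists_inv_self hT
  have h1 := key b hb _ (ha.mono hP).img_le (mem_img_of_mem b hg)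
  rw [hb.img_img_self ha hba hP] at h1
  rw [← hab g hg.1]
  exact mem_img_of_mem a h1

theorem FullyNormalized.img_self [Fact p.Prime] (hT : IsTorusIn p S T) {P : Subgroup G}
    (h : F.FullyNormalized p P) {a : G → G} (ha : F.Mor S a) : F.FullyNormalized p (img a P) := by
  rw [fullyNormalized_iff] at h ⊢
  have hm : ∀ x ∈ P, a x ∈ img a P := fun x hx => mem_img_of_mem a hx
  refine ⟨(ha.mono h.1).img_le, fun f hf => ?_⟩
  rw [← ha.img_normalizerIn hT h.1, (ha.mono normalizerIn_le).toralOrder_img,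
    ← (ha.mono h.1).img_comp hf hm]
  exact h.2 _ ((ha.mono h.1).comp hf hm)

/-! ### Morphisms generated by the residuals of centric subgroups -/

/-- Composites of restrictions of elements of `O^{p'}(Aut_F(Q))`, for `Q` centric. -/
inductive Estar (p : ℕ) (F : FusionSystem S) (P : Subgroup G) : (G → G) → Prop
  | id {f : G → G} : P ≤ S → (∀ x ∈ P, f x = x) → Estar p F P f
  | step {f g κ : G → G} {Q : Subgroup G} : Estar p F P f → F.Cen Q → (∀ x ∈ P, f x ∈ Q) →
      F.Res p Q κ → (∀ x ∈ P, g x = κ (f x)) → Estar p F P g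

namespace Estar

variable {P Q : Subgroup G} {f g κ : G → G}

theorem mor (h : F.Estar p P f) : F.Mor P f := by
  induction h with
  | id hP h => exact (Mor.id F hP).congr h
  | step _ _ hm hκ hg ih => exact (ih.comp hκ.mor hm).congr hg

theorem congr (h : F.Estar p P f) (hg : Set.EqOn g f P) : F.Estar p P g := by
  cases h with
  | id hP h => exact .id hP fun x hx => (hg hx).trans (h x hx)
  | step h hQ hm hκ hf => exact .step h hQ hm hκ fun x hx => (hg hx).trans (hf x hx)

theorem mono (h : F.Estar p P f) (hQ : Q ≤ P) : F.Estar p Q f := by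
  induction h with
  | id hP h => exact .id (hQ.trans hP) fun x hx => h x (hQ hx)
  | step _ hC hm hκ hf ih =>
    exact .step ih hC (fun x hx => hm x (hQ hx)) hκ (fun x hx => hf x (hQ hx))

theorem comp (h : F.Estar p P f) (h' : F.Estar p Q g) (hm : ∀ x ∈ P, f x ∈ Q) :
    F.Estar p P (g ∘ f) := by
  induction h' with
  | id hQ h' => exact h.congr fun x hx => h' _ (hm x hx)
  | step _ hC hm' hκ hf ih =>
    exact .step ih hC (fun x hx => hm' _ (hm x hx)) hκ (fun x hx => hf _ (hm x hx))

theorem of_res (hQ : F.Cen Q) (hκ : F.Res p Q κ) (hP : P ≤ Q) : F.Estar p P κ :=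
  .step (.id (hP.trans hQ.1) fun _ _ => rfl) hQ (fun _ hx => hP hx) hκ fun _ _ => rfl

theorem of_id (hP : P ≤ S) : F.Estar p P (fun x => x) := .id hP fun _ _ => rfl

theorem conj [Fact p.Prime] (F : FusionSystem S) (hT : IsTorusIn p S T) (hP : P ≤ S) {s : G}
    (hs : s ∈ S) : F.Estar p P (fun x => s * x * s⁻¹) :=
  of_res (cen_self hT) (Res.conj F hT le_rfl (le_normalizerIn le_rfl hs)) hP

theorem exists_inv (h : F.Estar p P f) : ∃ g, F.Estar p (img f P) g ∧ ∀ x ∈ P, g (f x) = x := by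
  induction h with
  | @id f hP h =>
    refine ⟨fun x => x, of_id ?_, h⟩
    rwa [img_congr (g := fun x => x) h, img_id]
  | @step f g' κ Q hf hC hm hκ hg ih =>
    obtain ⟨g, hE, hgf⟩ := ih
    obtain ⟨κ', hκ', h1, h2⟩ := hκ.exists_inv
    have hmor : F.Mor P g' := (hf.mor.comp hκ.mor hm).congr hg
    have hle : img g' P ≤ Q := hmor.img_le_iff.mpr fun x hx => by
      rw [hg x hx]
      exact hκ.mem (hm x hx)
    refine ⟨g ∘ κ', (of_res hC hκ' hle).comp hE ?_, fun x hx => ?_⟩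
    · intro y hy
      obtain ⟨x, hx, rfl⟩ := hmor.mem_img.mp hy
      rw [hg x hx, h1 _ (hm x hx)]
      exact mem_img_of_mem f hx
    · rw [Function.comp_apply, hg x hx, h1 _ (hm x hx), hgf x hx]

/-- An automorphism of S permutes the centric subgroups and carries their residuals to residuals; so
Aut_F(S) normalizes `Estar`. -/
theorem transport (h : F.Estar p P f) {a : G → G} (ha : F.Mor S a) :
    ∃ g, F.Estar p (img a P) g ∧ ∀ x ∈ P, g (a x) = a (f x) := by
  induction h with
  | @id f hP h =>
    exact ⟨fun x => x, of_id (ha.mono hP).img_le, fun x hx => by rw [h x hx]⟩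
  | @step f g' κ Q hf hC hm hκ hg ih =>
    obtain ⟨g, hE, hgf⟩ := ih
    obtain ⟨κ', hκ', h1⟩ := hκ.transport (ha.mono hC.1)
    refine ⟨κ' ∘ g, .step hE (hC.map (ha.mono hC.1)) ?_ hκ' fun _ _ => rfl, fun x hx => ?_⟩
    · intro y hy
      obtain ⟨x, hx, rfl⟩ := (ha.mono hf.mor.le).mem_img.mp hy
      rw [hgf x hx]
      exact mem_img_of_mem a (hm x hx)
    · rw [Function.comp_apply, hgf x hx, h1 _ (hm x hx), hg x hx]

end Estar

/-- `f = a ∘ φ` on `P`, with `a ∈ Aut_F(S)` and `φ` generated by residuals. -/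
def Frattini (p : ℕ) (F : FusionSystem S) (P : Subgroup G) (f : G → G) : Prop :=
  ∃ a φ, F.Mor S a ∧ F.Estar p P φ ∧ ∀ x ∈ P, f x = a (φ x)

namespace Frattini

variable {P Q : Subgroup G} {f g : G → G}

theorem mono (h : F.Frattini p P f) (hQ : Q ≤ P) : F.Frattini p Q f := by
  obtain ⟨a, φ, ha, hφ, hf⟩ := h
  exact ⟨a, φ, ha, hφ.mono hQ, fun x hx => hf x (hQ hx)⟩

theorem congr (h : F.Frattini p P f) (hg : Set.EqOn g f P) : F.Frattini p P g := by
  obtain ⟨a, φ, ha, hφ, hf⟩ := h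
  exact ⟨a, φ, ha, hφ, fun x hx => (hg hx).trans (hf x hx)⟩

theorem of_estar (h : F.Estar p P f) : F.Frattini p P f :=
  ⟨fun x => x, f, Mor.id F le_rfl, h, fun _ _ => rfl⟩

theorem mor (h : F.Frattini p P f) : F.Mor P f := by
  obtain ⟨a, φ, ha, hφ, hf⟩ := h
  exact (hφ.mor.comp ha fun x hx => hφ.mor.mem hx).congr hf

/-- Commute the middle factors: b ψ a φ = (b a) (a⁻¹ ψ a) φ. -/
theorem comp [Fact p.Prime] (hT : IsTorusIn p S T) (h : F.Frattini p P f) (h' : F.Frattini p Q g)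
    (hm : ∀ x ∈ P, f x ∈ Q) : F.Frattini p P (g ∘ f) := by
  obtain ⟨a, φ, ha, hφ, hf⟩ := h
  obtain ⟨b, ψ, hb, hψ, hg⟩ := h'
  obtain ⟨a', ha', h1, h2⟩ := ha.exists_inv_self hT
  obtain ⟨ψ', hψ', h3⟩ := hψ.transport ha'
  have hmem : ∀ x ∈ P, φ x = a' (f x) := fun x hx => by rw [hf x hx, h1 _ (hφ.mor.mem hx)]
  refine ⟨b ∘ a, ψ' ∘ φ, ha.comp hb fun x hx => ha.mem hx, hφ.comp hψ' fun x hx => ?_,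
    fun x hx => ?_⟩
  · rw [hmem x hx]
    exact mem_img_of_mem a' (hm x hx)
  · change g (f x) = b (a (ψ' (φ x)))
    rw [hmem x hx, h3 _ (hm x hx), h2 _ (hψ.mor.mem (hm x hx)), hg _ (hm x hx)]

theorem exists_inv [Fact p.Prime] (hT : IsTorusIn p S T) (h : F.Frattini p P f) :
    ∃ g, F.Frattini p (img f P) g ∧ ∀ x ∈ P, g (f x) = x := by
  have hfm := h.mor
  obtain ⟨a, φ, ha, hφ, hf⟩ := h
  obtain ⟨a', ha', h1, h2⟩ := ha.exists_inv_self hT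
  obtain ⟨ψ, hψ, h3⟩ := hφ.exists_inv
  obtain ⟨ψ', hψ', h4⟩ := hψ.transport ha
  have h5 : img a (img φ P) = img f P := by
    rw [← hφ.mor.img_comp ha fun x hx => hφ.mor.mem hx]
    exact img_congr fun x hx => (hf x hx).symm
  rw [h5] at hψ'
  refine ⟨a' ∘ ψ', ⟨a', ψ', ha', hψ', fun _ _ => rfl⟩, fun x hx => ?_⟩
  rw [Function.comp_apply, hf x hx, h4 _ (mem_img_of_mem φ hx), h3 x hx, h1 x (hfm.le hx)]

end Frattini

namespace Saturated

variable [Fact p.Prime] (hF : F.Saturated p) (hT : IsTorusIn p S T) {P : Subgroup G} {f : G → G}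

/-- An Alperin-type induction on height. For closed P ≠ S, both P and f(P) are moved to one fully
normalized R by morphisms defined on their normalizers, which have smaller height. There remains an
automorphism of R. If R is not centric, it extends to the larger subgroup R C_S(R); if R is centric,
it extends to N_S(R) after correction by a residual, which is in `Estar`. Closedness is what makes
the height strictly decrease. -/
theorem frattini_aux (n : ℕ) : ∀ P f, hF.height hT P ≤ n → F.Mor P f → F.Frattini p P f := by
  induction n using Nat.strong_induction_on with
  | _ n ih =>
  suffices hcl : ∀ P f, hF.height hT P ≤ n → hF.bullet hT P = P → F.Mor P f →
      F.Frattini p P f by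
    intro P f hn hf
    obtain ⟨f', hf', hfe⟩ := hF.exists_extension_bullet hT hf
    exact ((hcl _ f' (by rwa [hF.height_bullet hT hf.le]) (hF.bullet_bullet hT hf.le) hf').mono
      (hF.le_bullet hT P)).congr hfe.symm
  intro P f hn hPc hf
  have hP := hf.le
  have hlt : ∀ X g, P ≤ X → ¬ X ≤ P → F.Mor X g → F.Frattini p X g := fun X g hX hne hg =>
    ih _ (lt_of_lt_of_le (hF.height_lt hT hPc hX hg.le hne) hn) X g le_rfl hg
  by_cases hSP : S ≤ P
  · obtain rfl : P = S := le_antisymm hP hSP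
    exact ⟨f, fun x => x, hf, .of_id le_rfl, fun _ _ => rfl⟩
  have hnorm : ∀ Q, Q ≤ S → ¬ S ≤ Q → ¬ normalizerIn S Q ≤ Q := by
    intro Q hQ hSQ hle
    obtain ⟨g, hg, hgQ, hgn⟩ := hT.exists_mem_normalizer hQ hSQ le_rfl
    exact hgQ (hle ⟨hg, hgn⟩)
  -- conjugates of `P`
  have hconj : ∀ g, F.Mor P g → hF.bullet hT (img g P) = img g P ∧ ¬ S ≤ img g P ∧
      ∀ X k, img g P ≤ X → ¬ X ≤ img g P → F.Mor X k → F.Frattini p X k := by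
    intro g hg
    have hc := hF.bullet_img hT hg hPc
    refine ⟨hc, fun hle => hSP ?_, fun X k hX hne hk => ?_⟩
    · have h1 : img g P = S := le_antisymm hg.img_le hle
      have h2 := hg.toralOrder_img (p := p)
      rw [h1] at h2
      exact (hT.eq_of_toralOrder_le hP le_rfl h2.le).ge
    · refine ih _ (lt_of_lt_of_le (hF.height_lt hT hc hX hk.le hne) ?_) X k le_rfl hk
      rwa [hF.height_img hT hg]
  obtain ⟨ψ, hψ, hfn⟩ := hF.exists_fullyNormalized hT hP
  obtain ⟨g₁, hg₁, hgR₁⟩ := hF.exists_extension_normalizerIn hT hψ hfn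
  obtain ⟨k, hk, hkf, hfk⟩ := hf.exists_inv
  have hkP : ∀ y ∈ img f P, k y ∈ P := fun y hy => (hfk y hy).1
  have hkimg : img k (img f P) = P := hk.img_eq hkP
    fun x hx => ⟨f x, mem_img_of_mem f hx, hkf x hx⟩
  have hψk := hk.comp hψ hkP
  have hψkimg : img (ψ ∘ k) (img f P) = img ψ P := by rw [hk.img_comp hψ hkP, hkimg]
  obtain ⟨g₂, hg₂, hgR₂⟩ := hF.exists_extension_normalizerIn hT hψk (by rw [hψkimg]; exact hfn)
  rw [hψkimg] at hgR₂
  have hF₁ : F.Frattini p P g₁ :=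
    (hlt _ g₁ (le_normalizerIn hP) (hnorm P hP hSP) hg₁).mono (le_normalizerIn hP)
  have hF₂ : F.Frattini p (img f P) g₂ := by
    obtain ⟨-, h2, h3⟩ := hconj f hf
    exact (h3 _ g₂ (le_normalizerIn hf.img_le) (hnorm _ hf.img_le h2) hg₂).mono
      (le_normalizerIn hf.img_le)
  obtain ⟨k₁, hk₁, hk₁x⟩ := hF₁.exists_inv hT
  obtain ⟨k₂, hk₂, hk₂x⟩ := hF₂.exists_inv hT
  rw [hgR₁] at hk₁
  rw [hgR₂] at hk₂
  set R := img ψ P with hR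
  have hk₁P : ∀ y ∈ R, k₁ y ∈ P := by
    intro y hy
    rw [← hgR₁] at hy
    obtain ⟨x, hx, rfl⟩ := hF₁.mor.mem_img.mp hy
    rwa [hk₁x x hx]
  have hα : F.Mor R (g₂ ∘ f ∘ k₁) :=
    (hk₁.mor.comp hf hk₁P).comp hF₂.mor fun y hy => mem_img_of_mem f (hk₁P y hy)
  have hαF : F.Frattini p R (g₂ ∘ f ∘ k₁) := by
    obtain ⟨hRc, hSR, hind⟩ := hconj ψ hψ
    have hαR : img (g₂ ∘ f ∘ k₁) R = R := by
      refine hα.img_eq (fun y hy => ?_) fun y hy => ?_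
      · rw [← hgR₂]
        exact mem_img_of_mem g₂ (mem_img_of_mem f (hk₁P y hy))
      · have hy' := hy
        rw [← hgR₂] at hy'
        obtain ⟨z, hz, rfl⟩ := hF₂.mor.mem_img.mp hy'
        obtain ⟨x, hx, rfl⟩ := hf.mem_img.mp hz
        refine ⟨g₁ x, hgR₁ ▸ mem_img_of_mem g₁ hx, ?_⟩
        simp only [Function.comp_apply]
        rw [hk₁x x hx]
    -- As R is fully centralized, C_S(R) ≤ R makes it centric, so κ⁻¹ belongs to `Estar` and α = κ⁻¹
    -- ∘ ν on R.
    by_cases hRC : centralizerIn S R ≤ R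
    · have hcen : F.Cen R := by
        have := (hF.fullyCentralized hfn).cen_sup hT
        rwa [sup_eq_left.mpr hRC] at this
      obtain ⟨κ, hκ, ν, hν, hνx⟩ := hF.exists_res_extension hT hα (by rw [hαR]; exact hfn)
      rw [hαR] at hκ
      obtain ⟨κ', hκ', h1, h2⟩ := hκ.exists_inv
      have hνF := (hind _ ν (le_normalizerIn hψ.img_le) (hnorm R hψ.img_le hSR) hν).mono
        (le_normalizerIn hψ.img_le)
      have hαm : ∀ y ∈ R, (g₂ ∘ f ∘ k₁) y ∈ R := hα.img_le_iff.mp hαR.le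
      refine (hνF.comp hT (.of_estar (.of_res hcen hκ' le_rfl)) fun y hy => ?_).congr
        fun y hy => ?_
      · rw [hνx hy]
        exact hκ.mem (hαm y hy)
      · rw [Function.comp_apply (f := κ'), hνx hy, Function.comp_apply (f := κ),
          h1 _ (hαm y hy)]
    · obtain ⟨β, hβ, hβx⟩ := hF.exists_extension_centralizerIn hα
        (by rw [hαR]; exact hF.fullyCentralized hfn)
      exact ((hind _ β le_sup_left (fun h => hRC (le_sup_right.trans h)) hβ).mono
        le_sup_left).congr hβx.symm
  have hg₁m : ∀ x ∈ P, g₁ x ∈ R := fun x hx => hgR₁ ▸ mem_img_of_mem g₁ hx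
  refine ((hF₁.comp hT hαF hg₁m).comp hT hk₂ fun x hx => ?_).congr fun x hx => ?_
  · simp only [Function.comp_apply]
    rw [hk₁x x hx]
    exact hgR₂ ▸ mem_img_of_mem g₂ (mem_img_of_mem f hx)
  · simp only [Function.comp_apply]
    rw [hk₁x x hx, hk₂x _ (mem_img_of_mem f hx)]

/-- The Frattini factorization of morphisms. -/
theorem frattini (hF : F.Saturated p) (hT : IsTorusIn p S T) (hf : F.Mor P f) : F.Frattini p P f :=
  hF.frattini_aux hT _ P f le_rfl hf

/-- In the Frattini factorization of a morphism onto a fully normalized subgroup, the factor from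
Aut_F(S) can be dropped, since it preserves full normalization. -/
theorem exists_estar_fullyNormalized (hF : F.Saturated p) (hT : IsTorusIn p S T) (hP : P ≤ S) :
    ∃ ρ, F.Estar p (normalizerIn S P) ρ ∧ F.FullyNormalized p (img ρ P) := by
  obtain ⟨ψ, hψ, hfn⟩ := hF.exists_fullyNormalized hT hP
  obtain ⟨g, hg, hgR⟩ := hF.exists_extension_normalizerIn hT hψ hfn
  obtain ⟨a, φ, ha, hφ, hgx⟩ := hF.frattini hT hg
  obtain ⟨b, hb, h1, h2⟩ := ha.exists_inv_self hT
  refine ⟨φ, hφ, ?_⟩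
  have h3 : img φ P = img b (img g P) := by
    rw [← (hg.mono (le_normalizerIn hP)).img_comp hb fun x hx => hg.mem (le_normalizerIn hP hx)]
    refine img_congr fun x hx => ?_
    rw [Function.comp_apply, hgx x (le_normalizerIn hP hx),
      h1 _ (hφ.mor.mem (le_normalizerIn hP hx))]
  rw [h3, hgR]
  exact hfn.img_self hT hb

/-- Residual automorphisms lift along surjective restriction maps. -/
theorem exists_res_lift (hF : F.Saturated p) (hT : IsTorusIn p S T)
    {R Y : Subgroup G} (hRY : R ≤ Y) (hY : Y ≤ S)
    (h : ∀ α, F.Mor R α → img α R = R → ∃ β, F.Mor Y β ∧ img β Y = Y ∧ Set.EqOn β α R)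
    {κ : G → G} (hκ : F.Res p R κ) : ∃ κ', F.Res p Y κ' ∧ Set.EqOn κ' κ R := by
  obtain ⟨hR, α, hα, hακ⟩ := hκ
  let M := F.aut Y hY ⊓ stabilizerAut Y R
  let φ : M →* MulAut R := (restrictAut Y R hRY).comp (Subgroup.inclusion inf_le_right)
  obtain ⟨β, hβ, hβα⟩ := ((hF.isPByFinite_aut hT hY).subgroup (M := M) inf_le_left)
    |>.exists_mem_residualIn φ (N := F.aut R hR)
    (fun β => by
      have h1 : F.Mor R (extendFun (β : MulAut Y).toMonoidHom) :=
        ((mem_aut_iff hY).mp β.2.1).mono hRY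
      refine h1.mem_aut fun x => ?_
      rw [extendFun_apply _ (hRY x.2)]
      rfl)
    (fun γ hγ => by
      have hγm := (mem_aut_iff hR).mp hγ
      have hγi : img (extendFun γ.toMonoidHom) R = R := by
        refine hγm.img_eq (fun x hx => ?_) fun y hy => ⟨γ.symm ⟨y, hy⟩, (γ.symm _).2, ?_⟩
        · rw [extendFun_apply _ hx]
          exact (γ _).2
        · rw [extendFun_coe]
          exact congrArg Subtype.val (γ.apply_symm_apply ⟨y, hy⟩)
      obtain ⟨β, hβ, hβY, hβx⟩ := h _ hγm hγi
      obtain ⟨b, hb, hbx⟩ := hβ.exists_aut hβY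
      refine ⟨⟨b, hb, fun x => ?_⟩, ?_⟩
      · rw [hbx]
        have h2 : img β R = R := by rw [img_congr hβx, hγi]
        have h3 := hβ.mem_img_iff x.2 hRY
        rw [h2] at h3
        exact h3.symm
      · ext x
        change (b ⟨x, hRY x.2⟩ : G) = γ x
        rw [hbx]
        change β x = _
        rw [hβx x.2, extendFun_coe]
        rfl) hα
  refine ⟨extendFun (β : MulAut Y).toMonoidHom, ⟨hY, β, residualIn_mono inf_le_left hβ,
    fun x => (extendFun_coe (β : MulAut Y).toMonoidHom x).symm⟩, fun x hx => ?_⟩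
  have h4 := hακ ⟨x, hx⟩
  simp only at h4
  rw [extendFun_apply _ (hRY hx), ← h4, ← hβα]
  rfl

theorem exists_res_sup (hF : F.Saturated p) (hT : IsTorusIn p S T)
    {R : Subgroup G} (hR : F.FullyCentralized p R) {κ : G → G}
    (hκ : F.Res p R κ) :
    ∃ κ', F.Res p (R ⊔ centralizerIn S R) κ' ∧ Set.EqOn κ' κ R := by
  refine hF.exists_res_lift hT le_sup_left (sup_centralizerIn_le hR.1) (fun α hα hαR => ?_) hκ
  obtain ⟨β, hβ, hβx⟩ := hF.exists_extension_centralizerIn hα (by rwa [hαR])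
  refine ⟨β, hβ, ?_, hβx⟩
  rw [hβ.img_sup_centralizerIn hT hR, img_congr hβx, hαR]

theorem exists_estar_sup (hF : F.Saturated p) (hT : IsTorusIn p S T)
    {R : Subgroup G} (hR : F.FullyCentralized p R) {κ : G → G}
    (hκ : F.Res p R κ) :
    ∃ κ', F.Estar p (R ⊔ centralizerIn S R) κ' ∧ Set.EqOn κ' κ R := by
  obtain ⟨κ', hκ', h⟩ := hF.exists_res_sup hT hR hκ
  exact ⟨κ', .of_res (hR.cen_sup hT) hκ' le_rfl, h⟩

/-- `Estar` is generated at centric subgroups only, yet it contains all residuals: move P by `Estar`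
to a fully normalized R, lift the residual to the centric subgroup R C_S(R), and move back. -/
theorem estar_of_res (hF : F.Saturated p) (hT : IsTorusIn p S T)
    {κ : G → G} (hκ : F.Res p P κ) : F.Estar p P κ := by
  have hP := hκ.mor.le
  obtain ⟨ρ, hρ, hfn⟩ := hF.exists_estar_fullyNormalized hT hP
  have hρP := hρ.mono (le_normalizerIn hP)
  obtain ⟨ρ', hρ', h1⟩ := hρP.exists_inv
  obtain ⟨κ', hκ', h2⟩ := hκ.transport hρP.mor
  obtain ⟨κ'', hκ'', h3⟩ := hF.exists_estar_sup hT (hF.fullyCentralized hfn) hκ'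
  have h4 : ∀ x ∈ P, κ'' (ρ x) = ρ (κ x) := fun x hx => by
    rw [h3 (mem_img_of_mem ρ hx), h2 x hx]
  refine ((hρP.comp (hκ''.mono le_sup_left) fun x hx => mem_img_of_mem ρ hx).comp hρ'
    fun x hx => ?_).congr fun x hx => ?_
  · rw [Function.comp_apply, h4 x hx]
    exact mem_img_of_mem ρ (hκ.mem hx)
  · simp only [Function.comp_apply]
    rw [h4 x hx, h1 _ (hκ.mem hx)]

/-- Each residual step at Q lifts to a residual at the closure of Q, because automorphisms of Q
extend to it. -/
theorem exists_estar_bullet (h : F.Estar p P f) :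
    ∃ f', F.Estar p (hF.bullet hT P) f' ∧ Set.EqOn f' f P := by
  induction h with
  | id hP h => exact ⟨fun x => x, .of_id (hF.bullet_le hT hP), fun x hx => (h x hx).symm⟩
  | @step f g κ Q hf hC hm hκ hg ih =>
    obtain ⟨f', hf', hfe⟩ := ih
    obtain ⟨κ', hκ', hκe⟩ := hF.exists_res_lift hT (hF.le_bullet hT Q) (hF.bullet_le hT hC.1)
      (fun α hα hαR => by
        obtain ⟨β, hβ, hβx⟩ := hF.exists_extension_bullet hT hα
        refine ⟨β, hβ, ?_, hβx⟩
        rw [hF.img_bullet hT hβ, img_congr hβx, hαR]) hκ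
    refine ⟨κ' ∘ f', .step hf' (hC.mono (hF.le_bullet hT Q) (hF.bullet_le hT hC.1)) ?_ hκ'
      fun _ _ => rfl, fun x hx => ?_⟩
    · intro x hx
      have h1 : f' x ∈ img f' (hF.bullet hT P) := mem_img_of_mem f' hx
      rw [hF.img_bullet hT hf'.mor, img_congr hfe] at h1
      exact hF.bullet_mono hT (hf.mor.img_le_iff.mpr hm) h1
    · rw [Function.comp_apply, hfe hx, hκe (hm x hx), hg x hx]

end Saturated

end FusionSystem

end

noncomputable section

/-! ### Normalizer induction and extensions of the identity -/

namespace FusionSystem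

variable {G : Type*} [Group G] {S T : Subgroup G} {F : FusionSystem S} {p : ℕ}

namespace Saturated

variable [Fact p.Prime] (hF : F.Saturated p) (hT : IsTorusIn p S T) {P : Subgroup G} {f : G → G}

/-- A property of subgroups between `P` and `X` which passes to normalizers in `X` and to
increasing unions holds for `X` if it holds for `P`. -/
theorem normalizer_induction (hF : F.Saturated p) (hT : IsTorusIn p S T)
    {X : Subgroup G} (C : Subgroup G → Prop) (hPX : P ≤ X) (hX : X ≤ S)
    (h0 : C P) (hstep : ∀ Y, P ≤ Y → Y ≤ X → C Y → C (X ⊓ normalizerIn S Y))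
    (hunion : ∀ Y : ℕ → Subgroup G, Monotone Y → (∀ n, C (Y n)) → C (⨆ n, Y n)) : C X := by
  -- Choose Y of least height. Every larger subgroup with the property then stays inside Y• ⊓ X,
  -- which the iterated normalizers of Y in X exhaust.
  obtain ⟨Y, ⟨hPY, hYX, hY⟩, hmin⟩ : ∃ Y, (P ≤ Y ∧ Y ≤ X ∧ C Y) ∧
      ∀ Z, P ≤ Z → Z ≤ X → C Z → hF.height hT Y ≤ hF.height hT Z := by
    obtain ⟨Y, hY, hmin⟩ := WellFounded.has_min (measure (hF.height hT)).wf
      {Y | P ≤ Y ∧ Y ≤ X ∧ C Y} ⟨P, le_rfl, hPX, h0⟩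
    exact ⟨Y, hY, fun Z h1 h2 h3 => not_lt.mp (hmin Z ⟨h1, h2, h3⟩)⟩
  have hYS := hYX.trans hX
  have hbul : ∀ Z, Y ≤ Z → Z ≤ X → C Z → Z ≤ hF.bullet hT Y ⊓ X := fun Z h1 h2 h3 =>
    le_inf (hF.le_bullet_of_height_le hT h1 (h2.trans hX) (hmin Z (hPY.trans h1) h2 h3)) h2
  let Z : ℕ → Subgroup G := fun n => n.rec Y (fun _ W => X ⊓ normalizerIn S W)
  have hZ1 : ∀ n, Z (n + 1) = X ⊓ normalizerIn S (Z n) := fun n => rfl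
  have hZX : ∀ n, Z n ≤ X := by
    intro n
    cases n with
    | zero => exact hYX
    | succ n => exact inf_le_left
  have hmono : Monotone Z := monotone_nat_of_le_succ fun n => by
    rw [hZ1]
    exact le_inf (hZX n) (le_normalizerIn ((hZX n).trans hX))
  have hYZ : ∀ n, Y ≤ Z n := fun n => hmono (Nat.zero_le n)
  have hZC : ∀ n, C (Z n) := by
    intro n
    induction n with
    | zero => exact hY
    | succ n ih => exact hstep _ (hPY.trans (hYZ n)) (hZX n) ih
  have hB := hT.le_iSup_of_normalizer hYS (D := hF.bulletTorus hT Y ⊓ X)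
    (B := hF.bullet hT Y ⊓ X) (inf_le_left.trans (hF.bulletTorus_le hT Y))
    (fun x hx d hd => ⟨hF.conj_mem_bulletTorus hT hYS (le_normalizerIn hYS hx) hd.1,
      X.mul_mem (X.mul_mem (hYX hx) hd.2) (X.inv_mem (hYX hx))⟩)
    (fun g => by
      constructor
      · rintro ⟨hg, hgX⟩
        obtain ⟨x, hx, d, hd, rfl⟩ := (hF.mem_bullet hT hYS).mp hg
        refine ⟨x, hx, d, ⟨hd, ?_⟩, rfl⟩
        have := X.mul_mem (X.inv_mem (hYX hx)) hgX
        rwa [inv_mul_cancel_left] at this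
      · rintro ⟨x, hx, d, hd, rfl⟩
        exact ⟨(hF.mem_bullet hT hYS).mpr ⟨x, hx, d, hd.1, rfl⟩, X.mul_mem (hYX hx) hd.2⟩)
    Z rfl hmono (fun n => hbul _ (hYZ n) (hZX n) (hZC n))
    (fun n g hg hgn => ⟨hg.2, hX hg.2, hgn⟩)
  have hU : C (hF.bullet hT Y ⊓ X) := hB ▸ hunion Z hmono hZC
  have hYB : Y ≤ hF.bullet hT Y ⊓ X := le_inf (hF.le_bullet hT Y) hYX
  -- If Y• ⊓ X were proper in X, its normalizer in X would be larger and still have the property,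
  -- against the choice of Y.
  have hle : X ≤ hF.bullet hT Y ⊓ X := by
    by_contra hne
    obtain ⟨g, hg, hgB, hgn⟩ := hT.exists_mem_normalizer inf_le_right hne hX
    have h1 := hstep _ (hPY.trans hYB) inf_le_right hU
    have h2 : hF.bullet hT Y ⊓ X ≤ X ⊓ normalizerIn S (hF.bullet hT Y ⊓ X) :=
      le_inf inf_le_right (le_normalizerIn (inf_le_right.trans hX))
    exact hgB (hbul _ (hYB.trans h2) inf_le_left h1 ⟨hg, hX hg, hgn⟩)
  rwa [le_antisymm inf_le_right hle] at hU

/-- An extension of the identity of a centric subgroup to a subgroup of its normalizer lies in the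
residual. -/
theorem res_of_eqOn_id (hF : F.Saturated p) (hT : IsTorusIn p S T)
    {X : Subgroup G} (hP : F.Cen P) (hPX : P ≤ X) (hX : X ≤ normalizerIn S P)
    (hf : F.Mor X f) (hfP : ∀ x ∈ P, f x = x) : F.Res p X f := by
  have hz : ∀ x ∈ X, x⁻¹ * f x ∈ centralizerIn S P := by
    intro x hx
    refine mem_centralizerIn.mpr ⟨S.mul_mem (S.inv_mem (hf.le hx)) (hf.mem hx), fun y hy => ?_⟩
    have hxy := conj_mem_of_mem_normalizerIn (hX hx) hy
    have h1 := hf.map_conj hx (hPX hy)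
    rw [hfP _ hxy, hfP y hy] at h1
    calc y * (x⁻¹ * f x) = x⁻¹ * (x * y * x⁻¹) * f x := by group
      _ = x⁻¹ * f x * y := by rw [h1]; group
  have hzP : ∀ x ∈ X, x⁻¹ * f x ∈ P := fun x hx => hP.centralizerIn_le (hz x hx)
  have hfX : ∀ x ∈ X, f x ∈ X := fun x hx => by
    have := X.mul_mem hx (hPX (hzP x hx))
    rwa [mul_inv_cancel_left] at this
  have hmul : ∀ x ∈ X, ∀ z ∈ P, f (x * z) = f x * z := fun x hx z hz => by
    rw [hf.map_mul hx (hPX hz), hfP z hz]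
  have himg : img f X = X := by
    refine hf.img_eq hfX fun y hy => ⟨y * (y⁻¹ * f y)⁻¹, X.mul_mem hy
      (X.inv_mem (hPX (hzP y hy))), ?_⟩
    rw [hmul y hy _ (P.inv_mem (hzP y hy))]
    group
  obtain ⟨α, hα, hαf⟩ := hf.exists_aut himg
  -- With z = x⁻¹ f(x) ∈ C_S(P) ≤ P, which f fixes, the n-th iterate sends x to x z^n.
  have hpow : ∀ n : ℕ, ∀ x : X, (((α ^ n) x : X) : G) = x * ((x : G)⁻¹ * f x) ^ n := by
    intro n x
    induction n with
    | zero => simp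
    | succ n ih =>
      rw [pow_succ', MulAut.mul_apply, hαf, ih, hmul x x.2 _ (P.pow_mem (hzP x x.2) n), pow_succ',
        ← mul_assoc, mul_inv_cancel_left]
  obtain ⟨I, hI, hIp, hIf⟩ := hF.isPByFinite_aut hT hf.le
  have h1 := Subgroup.pow_index_mem (H := I) ⟨α, hα⟩
  obtain ⟨k, hk⟩ := hIp ⟨_, h1⟩
  have h2 : α ^ (I.index * p ^ k) = 1 := by
    have := congrArg (fun z : I => ((z : F.aut X hf.le) : MulAut X)) hk
    simpa [← pow_mul] using this
  obtain ⟨a, b, hb, hab⟩ := Nat.exists_eq_pow_mul_and_not_dvd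
    (Nat.mul_ne_zero hIf.index_ne_zero (pow_ne_zero k (Fact.out : p.Prime).ne_zero)) p
    (Fact.out : p.Prime).ne_one
  -- Since Aut_F(X) is p-by-finite, α has finite order dividing p^a b with b prime to p. Each z has
  -- p-power order, so p^a alone kills all of them: α is a p-element, hence residual.
  have h3 : α ^ p ^ a = 1 := by
    ext x
    rw [hpow, MulAut.one_apply, mul_eq_left]
    have h4 : ((x : G)⁻¹ * f x) ^ (p ^ a * b) = 1 := by
      have := hpow (p ^ a * b) x
      rw [← hab, h2, MulAut.one_apply] at this
      exact mul_eq_left.mp (hab ▸ this.symm)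
    obtain ⟨m, hm⟩ := hT.exists_pow_eq_one (hP.1 (hzP x x.2))
    have h5 : (((x : G)⁻¹ * f x) ^ p ^ a) ^ p ^ m = 1 := by
      rw [← pow_mul, mul_comm, pow_mul, hm, one_pow]
    rw [pow_mul] at h4
    have hcop : Nat.gcd (p ^ m) b = 1 :=
      (((Fact.out : p.Prime).coprime_iff_not_dvd.mpr hb).pow_left m).gcd_eq_one
    have h6 := Nat.dvd_gcd (orderOf_dvd_of_pow_eq_one h5) (orderOf_dvd_of_pow_eq_one h4)
    rw [hcop, Nat.dvd_one, orderOf_eq_one_iff] at h6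
    exact h6
  have hpg : IsPGroup p (Subgroup.zpowers α) := by
    rintro ⟨_, n, rfl⟩
    refine ⟨a, Subtype.ext ?_⟩
    change (α ^ n) ^ p ^ a = 1
    rw [← zpow_natCast, zpow_comm, zpow_natCast, h3, one_zpow]
  exact ⟨hf.le, α, hpg.le_residualIn (Subgroup.zpowers_le.mpr hα) (Subgroup.mem_zpowers α), hαf⟩

end Saturated

/-! ### Subsystems of index prime to `p` -/

theorem mor_of_le {E : FusionSystem S} (h : E ≤ F) {P : Subgroup G} {f : G → G} (hf : E.Mor P f) :
    F.Mor P f := by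
  obtain ⟨φ, hφ, hx⟩ := hf
  exact ⟨φ, h _ _ hφ, hx⟩

theorem Cen.of_le {E : FusionSystem S} (h : E ≤ F) {P : Subgroup G} (hP : F.Cen P) : E.Cen P :=
  ⟨hP.1, fun f hf => hP.2 f (mor_of_le h hf)⟩

namespace HasIndexPrimeTo

variable {E : FusionSystem S}

theorem mor_of_res (h : E.HasIndexPrimeTo p F) {P : Subgroup G} {κ : G → G} (hκ : F.Res p P κ) :
    E.Mor P κ := by
  obtain ⟨hP, α, hα, hx⟩ := hκ
  exact mor_of_mem_aut (h.residual_le P hP hα) hx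

theorem mor_of_estar (h : E.HasIndexPrimeTo p F) {P : Subgroup G} {f : G → G}
    (hf : F.Estar p P f) : E.Mor P f := by
  induction hf with
  | id hP h => exact (Mor.id E hP).congr h
  | step _ _ hm hκ hg ih => exact (ih.comp (h.mor_of_res hκ) hm).congr hg

/-- Normalizer induction: E extends α from Y to some β on N_S(Y). Then α⁻¹ ∘ β is the identity on
the centric subgroup Y, hence residual, hence in E, and so α is in E on N_S(Y). -/
theorem mor_self [Fact p.Prime] (h : E.HasIndexPrimeTo p F) (hF : F.Saturated p)
    (hT : IsTorusIn p S T) {α : G → G} (hα : F.Mor S α) {P : Subgroup G} (hP : F.Cen P)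
    (hPα : E.Mor P α) : E.Mor S α := by
  refine hF.normalizer_induction hT (fun X => E.Mor X α) hP.1 le_rfl hPα ?_
    (fun Y hY hC => h.saturated.mor_iSup hY hC)
  intro Y hPY hY hYα
  rw [inf_eq_right.mpr normalizerIn_le]
  have hYC := hP.mono hPY hY
  obtain ⟨β, hβ, hβx⟩ := h.saturated.exists_extension hYα
    (((hYC.map (mor_of_le h.le hYα)).of_le h.le).fullyCentralized hT) (le_normalizerIn hY)
    normalizerIn_le (fun g hg x hx => conj_mem_of_mem_normalizerIn hg hx)
    (fun g hg => ⟨α g, hα.mem hg.1, fun x hx => hα.map_conj hg.1 (hY hx)⟩)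
  obtain ⟨α', hα', h1, h2⟩ := hα.exists_inv_self hT
  have hβF := mor_of_le h.le hβ
  have hδ : F.Res p (normalizerIn S Y) (α' ∘ β) :=
    hF.res_of_eqOn_id hT hYC (le_normalizerIn hY) le_rfl
      (hβF.comp hα' fun x hx => hβF.mem hx)
      (fun x hx => by rw [Function.comp_apply, hβx hx, h1 x (hY hx)])
  obtain ⟨δ, hδ', h3, h4⟩ := hδ.exists_inv
  refine (((h.mor_of_res hδ').comp hβ fun x hx => hδ'.mem hx).congr fun x hx => ?_)
  have h5 := congrArg α (h4 x hx)
  rw [Function.comp_apply, h2 _ (hβF.mem (hδ'.mem hx))] at h5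
  rw [Function.comp_apply, h5]

end HasIndexPrimeTo

/-- The subgroup of `Aut_F(S)` generated by the automorphisms whose restriction to some centric
subgroup is generated by residuals. -/
inductive AutMin (p : ℕ) (F : FusionSystem S) : (G → G) → Prop
  | id {a : G → G} : (∀ x ∈ S, a x = x) → AutMin p F a
  | step {a b c : G → G} {P : Subgroup G} : AutMin p F a → F.Mor S b → F.Cen P → F.Estar p P b →
      (∀ x ∈ S, c x = b (a x)) → AutMin p F c

namespace AutMin

variable {a b c : G → G}

theorem mor (h : F.AutMin p a) : F.Mor S a := by
  induction h with
  | id h => exact (Mor.id F le_rfl).congr h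
  | step _ hb _ _ hc ih => exact (ih.comp hb fun x hx => ih.mem hx).congr hc

theorem comp (h : F.AutMin p a) (h' : F.AutMin p b) : F.AutMin p (b ∘ a) := by
  induction h' with
  | id h' =>
    cases h with
    | id h => exact .id fun x hx => (h' _ (by rw [h x hx]; exact hx)).trans (h x hx)
    | step h₀ hb hP hE hc =>
      exact .step h₀ hb hP hE fun x hx =>
        (h' _ ((AutMin.step h₀ hb hP hE hc).mor.mem hx)).trans (hc x hx)
  | step _ hb hP hE hc ih => exact .step ih hb hP hE fun x hx => hc _ (h.mor.mem hx)

theorem of_estar (hb : F.Mor S b) {P : Subgroup G} (hP : F.Cen P) (hE : F.Estar p P b) :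
    F.AutMin p b :=
  .step (.id fun _ _ => rfl) hb hP hE fun _ _ => rfl

theorem exists_inv [Fact p.Prime] (hT : IsTorusIn p S T) (h : F.AutMin p a) :
    ∃ b, F.AutMin p b ∧ (∀ x ∈ S, b (a x) = x) ∧ ∀ x ∈ S, a (b x) = x := by
  induction h with
  | id h => exact ⟨fun x => x, .id fun _ _ => rfl, h, h⟩
  | @step a b c P h₀ hb hP hE hc ih =>
    obtain ⟨a', ha', h1, h2⟩ := ih
    obtain ⟨b', hb', h3, h4⟩ := hb.exists_inv_self hT
    obtain ⟨e, he, h5⟩ := hE.exists_inv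
    have he' : F.Estar p (img b P) b' := he.congr fun y hy => by
      obtain ⟨x, hx, rfl⟩ := (hb.mono hP.1).mem_img.mp hy
      rw [h3 x (hP.1 hx), h5 x hx]
    refine ⟨a' ∘ b', (of_estar hb' (hP.map (hb.mono hP.1)) he').comp ha', fun x hx => ?_,
      fun x hx => ?_⟩
    · rw [Function.comp_apply, hc x hx, h3 _ (h₀.mor.mem hx), h1 x hx]
    · rw [Function.comp_apply, hc _ (ha'.mor.mem (hb'.mem hx)), h2 _ (hb'.mem hx), h4 x hx]

theorem transport [Fact p.Prime] (hT : IsTorusIn p S T) (h : F.AutMin p a) (hc : F.Mor S c) :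
    ∃ b, F.AutMin p b ∧ ∀ x ∈ S, b (c x) = c (a x) := by
  obtain ⟨c', hc', h1, h2⟩ := hc.exists_inv_self hT
  induction h with
  | id h => exact ⟨fun x => x, .id fun _ _ => rfl, fun x hx => by rw [h x hx]⟩
  | @step a b d P h₀ hb hP hE hd ih =>
    obtain ⟨a', ha', h3⟩ := ih
    obtain ⟨e, he, h4⟩ := hE.transport hc
    have hb' : F.Mor S (c ∘ b ∘ c') :=
      (hc'.comp hb fun x hx => hc'.mem hx).comp hc fun x hx => hb.mem (hc'.mem hx)
    refine ⟨_, ha'.comp (of_estar hb' (hP.map (hc.mono hP.1)) (he.congr fun y hy => ?_)),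
      fun x hx => ?_⟩
    · obtain ⟨x, hx, rfl⟩ := (hc.mono hP.1).mem_img.mp hy
      simp only [Function.comp_apply]
      rw [h4 x hx, h1 x (hP.1 hx)]
    · simp only [Function.comp_apply]
      rw [h3 x hx, h1 _ (h₀.mor.mem hx), hd x hx]

end AutMin

/-- The morphisms of the minimal subsystem: `f = a ∘ φ` on `P`, with `a ∈ AutMin` and `φ` generated
by residuals. -/
def MorMin (p : ℕ) (F : FusionSystem S) (P : Subgroup G) (f : G → G) : Prop :=
  ∃ a φ, F.AutMin p a ∧ F.Estar p P φ ∧ ∀ x ∈ P, f x = a (φ x)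

namespace MorMin

variable {P Q : Subgroup G} {f g : G → G}

theorem mono (h : F.MorMin p P f) (hQ : Q ≤ P) : F.MorMin p Q f := by
  obtain ⟨a, φ, ha, hφ, hf⟩ := h
  exact ⟨a, φ, ha, hφ.mono hQ, fun x hx => hf x (hQ hx)⟩

theorem congr (h : F.MorMin p P f) (hg : Set.EqOn g f P) : F.MorMin p P g := by
  obtain ⟨a, φ, ha, hφ, hf⟩ := h
  exact ⟨a, φ, ha, hφ, fun x hx => (hg hx).trans (hf x hx)⟩

theorem of_estar (h : F.Estar p P f) : F.MorMin p P f :=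
  ⟨fun x => x, f, .id fun _ _ => rfl, h, fun _ _ => rfl⟩

theorem of_autMin (h : F.AutMin p f) (hP : P ≤ S) : F.MorMin p P f :=
  ⟨f, fun x => x, h, .of_id hP, fun _ _ => rfl⟩

theorem mor (h : F.MorMin p P f) : F.Mor P f := by
  obtain ⟨a, φ, ha, hφ, hf⟩ := h
  exact (hφ.mor.comp ha.mor fun x hx => hφ.mor.mem hx).congr hf

theorem comp [Fact p.Prime] (hT : IsTorusIn p S T) (h : F.MorMin p P f) (h' : F.MorMin p Q g)
    (hm : ∀ x ∈ P, f x ∈ Q) : F.MorMin p P (g ∘ f) := by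
  obtain ⟨a, φ, ha, hφ, hf⟩ := h
  obtain ⟨b, ψ, hb, hψ, hg⟩ := h'
  obtain ⟨a', ha', h1, h2⟩ := ha.exists_inv hT
  obtain ⟨ψ', hψ', h3⟩ := hψ.transport ha'.mor
  have hmem : ∀ x ∈ P, φ x = a' (f x) := fun x hx => by rw [hf x hx, h1 _ (hφ.mor.mem hx)]
  refine ⟨b ∘ a, ψ' ∘ φ, ha.comp hb, hφ.comp hψ' fun x hx => ?_, fun x hx => ?_⟩
  · rw [hmem x hx]
    exact mem_img_of_mem a' (hm x hx)
  · change g (f x) = b (a (ψ' (φ x)))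
    rw [hmem x hx, h3 _ (hm x hx), h2 _ (hψ.mor.mem (hm x hx)), hg _ (hm x hx)]

theorem exists_inv [Fact p.Prime] (hT : IsTorusIn p S T) (h : F.MorMin p P f) :
    ∃ g, F.MorMin p (img f P) g ∧ ∀ x ∈ P, g (f x) = x := by
  have hfm := h.mor
  obtain ⟨a, φ, ha, hφ, hf⟩ := h
  obtain ⟨a', ha', h1, h2⟩ := ha.exists_inv hT
  obtain ⟨ψ, hψ, h3⟩ := hφ.exists_inv
  obtain ⟨ψ', hψ', h4⟩ := hψ.transport ha.mor
  have h5 : img a (img φ P) = img f P := by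
    rw [← hφ.mor.img_comp ha.mor fun x hx => hφ.mor.mem hx]
    exact img_congr fun x hx => (hf x hx).symm
  rw [h5] at hψ'
  refine ⟨a' ∘ ψ', ⟨a', ψ', ha', hψ', fun _ _ => rfl⟩, fun x hx => ?_⟩
  rw [Function.comp_apply, hf x hx, h4 _ (mem_img_of_mem φ hx), h3 x hx, h1 x (hfm.le hx)]

theorem transport [Fact p.Prime] (hT : IsTorusIn p S T) (h : F.MorMin p P f) {c : G → G}
    (hc : F.Mor S c) : ∃ g, F.MorMin p (img c P) g ∧ ∀ x ∈ P, g (c x) = c (f x) := by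
  obtain ⟨a, φ, ha, hφ, hf⟩ := h
  obtain ⟨b, hb, h1⟩ := ha.transport hT hc
  obtain ⟨ψ, hψ, h2⟩ := hφ.transport hc
  refine ⟨b ∘ ψ, ⟨b, ψ, hb, hψ, fun _ _ => rfl⟩, fun x hx => ?_⟩
  rw [Function.comp_apply, h2 x hx, h1 _ (hφ.mor.mem hx), hf x hx]

/-- Membership of an automorphism of S in `AutMin` is detected on a single centric subgroup. -/
theorem autMin [Fact p.Prime] (hT : IsTorusIn p S T) {α : G → G} (hα : F.Mor S α) (hP : F.Cen P)
    (h : F.MorMin p P α) : F.AutMin p α := by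
  obtain ⟨a, φ, ha, hφ, hf⟩ := h
  obtain ⟨a', ha', h1, h2⟩ := ha.exists_inv hT
  have hE : F.AutMin p (a' ∘ α) :=
    .of_estar (hα.comp ha'.mor fun x hx => hα.mem hx) hP (hφ.congr fun x hx => by
      rw [Function.comp_apply, hf x hx, h1 _ (hφ.mor.mem hx)])
  have := hE.comp ha
  cases this with
  | id h => exact .id fun x hx => by rw [← h2 _ (hα.mem hx)]; exact h x hx
  | step h hb hP hE hc =>
    exact .step h hb hP hE fun x hx => by rw [← h2 _ (hα.mem hx)]; exact hc x hx

end MorMin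

namespace Saturated

variable [Fact p.Prime] (hF : F.Saturated p) (hT : IsTorusIn p S T) {P : Subgroup G} {f : G → G}

/-- Extensions of morphisms from centric subgroups stay in the minimal subsystem. -/
theorem morMin_of_cen (hF : F.Saturated p) (hT : IsTorusIn p S T)
    (hP : F.Cen P) (h : F.MorMin p P f) {X : Subgroup G} (hPX : P ≤ X)
    (hf : F.Mor X f) : F.MorMin p X f := by
  obtain ⟨a, φ, ha, hφ, hfx⟩ := hF.frattini hT hf
  have hφP := hφ.mono hPX
  obtain ⟨ψ, hψ, h1⟩ := hφP.exists_inv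
  -- On the centric subgroup φ(P), a equals f ∘ φ⁻¹, which is in the minimal system; this puts a in
  -- `AutMin`.
  have h2 : F.MorMin p (img φ P) a := by
    refine ((MorMin.of_estar hψ).comp hT h fun y hy => ?_).congr fun y hy => ?_
    · obtain ⟨x, hx, rfl⟩ := hφP.mor.mem_img.mp hy
      rwa [h1 x hx]
    · obtain ⟨x, hx, rfl⟩ := hφP.mor.mem_img.mp hy
      rw [Function.comp_apply, h1 x hx, hfx x (hPX hx)]
  exact ⟨a, φ, h2.autMin hT ha (hP.map hφP.mor), hφ, hfx⟩

theorem exists_morMin_bullet (h : F.MorMin p P f) :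
    ∃ f', F.MorMin p (hF.bullet hT P) f' ∧ Set.EqOn f' f P := by
  obtain ⟨a, φ, ha, hφ, hf⟩ := h
  obtain ⟨φ', hφ', h1⟩ := hF.exists_estar_bullet hT hφ
  exact ⟨a ∘ φ', ⟨a, φ', ha, hφ', fun _ _ => rfl⟩, fun x hx => by
    rw [Function.comp_apply, h1 hx, hf x hx]⟩

/-- Heights are natural numbers, so some X n has least height and its closure contains the whole
union. The extension of f to that closure within the minimal system agrees with f by uniqueness of
extensions to closures. -/
theorem morMin_iSup (hF : F.Saturated p) (hT : IsTorusIn p S T)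
    {X : ℕ → Subgroup G} (hX : Monotone X) (h : ∀ n, F.MorMin p (X n) f) :
    F.MorMin p (⨆ n, X n) f := by
  have hf := hF.mor_iSup hX fun n => (h n).mor
  obtain ⟨n, hn⟩ : ∃ n, ∀ m, hF.height hT (X n) ≤ hF.height hT (X m) := by
    obtain ⟨n, -, hn⟩ := WellFounded.has_min (measure fun n => hF.height hT (X n)).wf
      Set.univ ⟨0, trivial⟩
    exact ⟨n, fun m => not_lt.mp (hn m trivial)⟩
  have hle : ⨆ m, X m ≤ hF.bullet hT (X n) := by
    refine iSup_le fun m => (hX (le_max_right n m)).trans ?_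
    exact hF.le_bullet_of_height_le hT (hX (le_max_left n m)) (h _).mor.le (hn _)
  have hXn := hF.bullet_eq hT (h n).mor.le (le_iSup X n) hle
  obtain ⟨f₁, hf₁, h1⟩ := hF.exists_morMin_bullet hT (h n)
  obtain ⟨f₂, hf₂, h2⟩ := hF.exists_extension_bullet hT hf
  rw [hXn] at hf₂
  have h3 := hF.eqOn_bullet hT hf₁.mor hf₂ fun x hx => by
    rw [h1 hx, h2 (le_iSup X n hx)]
  exact (hf₁.mono hle).congr fun x hx => by rw [h3 (hle hx), h2 hx]

end Saturated

/-- Minimality: residuals are in E by definition, and the generators of `AutMin` by `mor_self`. -/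
theorem HasIndexPrimeTo.mor_of_morMin [Fact p.Prime] {E : FusionSystem S}
    (h : E.HasIndexPrimeTo p F) (hF : F.Saturated p) (hT : IsTorusIn p S T) {P : Subgroup G}
    {f : G → G} (hf : F.MorMin p P f) : E.Mor P f := by
  have key : ∀ a, F.AutMin p a → E.Mor S a := by
    intro a ha
    induction ha with
    | id h => exact (Mor.id E le_rfl).congr h
    | step _ hb hP hE hc ih =>
      exact (ih.comp (h.mor_self hF hT hb hP (h.mor_of_estar hE)) fun x hx => ih.mem hx).congr hc
  obtain ⟨a, φ, ha, hφ, hx⟩ := hf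
  exact ((h.mor_of_estar hφ).comp (key a ha) fun x hx => hφ.mor.mem hx).congr hx

end FusionSystem

end

noncomputable section

namespace FusionSystem

variable {G : Type*} [Group G] {S T : Subgroup G} {F : FusionSystem S} {p : ℕ}

/-! ### Pairs of subgroups with a large common normalizer -/

/-- Every isomorphism of pairs onto `(X, R)` can be modified by a residual automorphism so that it
carries `Aut_S` of the source pair into `Aut_S(X)`. -/
def RelGood (p : ℕ) (F : FusionSystem S) (R X : Subgroup G) : Prop :=
  ∀ (Z R' : Subgroup G) (g : G → G), F.Mor Z g → img g Z = X → R' ≤ Z → img g R' = R →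
    ∃ κ, F.Res p X κ ∧ F.Res p R κ ∧ ∀ n ∈ normalizerIn S Z, n ∈ normalizerIn S R' →
      ∃ s ∈ S, ∀ z ∈ Z, κ (g (n * z * n⁻¹)) = s * κ (g z) * s⁻¹

theorem img_extendFun_aut {R : Subgroup G} (γ : MulAut R) {hR : R ≤ S} (hγ : γ ∈ F.aut R hR) :
    img (extendFun γ.toMonoidHom) R = R := by
  refine ((mem_aut_iff hR).mp hγ).img_eq (fun x hx => ?_)
    fun y hy => ⟨γ.symm ⟨y, hy⟩, (γ.symm _).2, ?_⟩
  · rw [extendFun_apply _ hx]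
    exact (γ _).2
  · rw [extendFun_coe]
    exact congrArg Subtype.val (γ.apply_symm_apply ⟨y, hy⟩)

namespace Saturated

variable [Fact p.Prime] (hF : F.Saturated p) (hT : IsTorusIn p S T)

/-- Sylow's theorem relative to a pair: work in the group M of automorphisms of g(Z) stabilizing
g(R'). The conjugator lies in O^{p'}(M), so it is residual on g(Z) and restricts to a residual of
g(R'). -/
theorem exists_res_conj_pair (hF : F.Saturated p) (hT : IsTorusIn p S T)
    {Z R' : Subgroup G} {g : G → G} (hg : F.Mor Z g) (hR' : R' ≤ Z)
    {V : Subgroup (MulAut (img g Z))} (hV : IsPGroup p V)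
    (hVM : V ≤ F.aut (img g Z) hg.img_le ⊓ stabilizerAut (img g Z) (img g R'))
    (hmax : ∀ W : Subgroup (MulAut (img g Z)), IsPGroup p W →
      W ≤ F.aut (img g Z) hg.img_le ⊓ stabilizerAut (img g Z) (img g R') → V ≤ W → W ≤ V) :
    ∃ κ, F.Res p (img g Z) κ ∧ F.Res p (img g R') κ ∧
      ∀ n ∈ normalizerIn S Z, n ∈ normalizerIn S R' → ∃ v ∈ V, ∀ z ∈ Z,
        κ (g (n * z * n⁻¹)) = extendFun v.toMonoidHom (κ (g z)) := by
  set M := F.aut (img g Z) hg.img_le ⊓ stabilizerAut (img g Z) (img g R') with hM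
  obtain ⟨e, he, hx⟩ := hg.exists_mulEquiv
  let U₀ : Subgroup (MulAut Z) :=
    ((normalizerIn S R').subgroupOf (Subgroup.normalizer (Z : Set G))).map Z.normalizerMonoidHom
  have hU₀ : U₀ ≤ autIn S Z := Subgroup.map_mono fun n hn => hn.1
  obtain ⟨α, hα, hconj⟩ := ((hF.isPByFinite_aut hT hg.img_le).subgroup (M := M)
    inf_le_left).exists_residualIn_conj
    (U := U₀.map (MulAut.congr e).toMonoidHom) (((isPGroup_autIn hT Z).to_le hU₀).map _)
    (by
      rintro _ ⟨u, hu, rfl⟩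
      refine ⟨hg.congr_mem_aut hx (autIn_le_aut F hg.le (hU₀ hu)), ?_⟩
      obtain ⟨n, hn, rfl⟩ := hu
      intro y
      obtain ⟨z, rfl⟩ := e.surjective y
      change _ ↔ (e (Z.normalizerMonoidHom n (e.symm (e z))) : G) ∈ _
      rw [MulEquiv.symm_apply_apply, hx, hx, hg.mem_img_iff z.2 hR',
        hg.mem_img_iff (Subtype.prop _) hR']
      exact Subgroup.mem_normalizer_iff.mp hn.2 z)
    hV hVM hmax
  have hres : F.Res p (img g Z) (extendFun α.toMonoidHom) :=
    ⟨hg.img_le, α, residualIn_mono inf_le_left hα, fun x => (extendFun_coe α.toMonoidHom x).symm⟩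
  have hRZ : img g R' ≤ img g Z := img_mono g hR'
  refine ⟨extendFun α.toMonoidHom, hres, ⟨hRZ.trans hg.img_le, _, map_mem_residualIn
      (N := F.aut (img g R') (hRZ.trans hg.img_le))
      ((restrictAut (img g Z) (img g R') hRZ).comp
        (Subgroup.inclusion (inf_le_right : M ≤ stabilizerAut (img g Z) (img g R')))) ?_ hα, ?_⟩, ?_⟩
  · intro β
    have h1 : F.Mor (img g R') (extendFun (β : MulAut (img g Z)).toMonoidHom) :=
      ((mem_aut_iff hg.img_le).mp β.2.1).mono hRZ
    refine h1.mem_aut fun x => ?_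
    rw [extendFun_apply _ (hRZ x.2)]
    rfl
  · intro x
    rw [extendFun_apply _ (hRZ x.2)]
    rfl
  · intro n hn hnR
    have h1 : Z.normalizerMonoidHom ⟨n, hn.2⟩ ∈ U₀ := ⟨⟨n, hn.2⟩, hnR, rfl⟩
    refine ⟨_, hconj _ ⟨_, h1, rfl⟩, fun z hz => ?_⟩
    have hfx : ∀ y (hy : y ∈ Z), extendFun α.toMonoidHom (g y) = α (e ⟨y, hy⟩) := by
      intro y hy
      have h2 := hx ⟨y, hy⟩
      simp only at h2
      rw [← h2, extendFun_coe]
      rfl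
    rw [hfx _ hz, hfx _ (conj_mem_of_mem_normalizerIn hn hz), extendFun_coe]
    change _ = ((α (e (Z.normalizerMonoidHom ⟨n, hn.2⟩ (e.symm (α⁻¹ (α (e ⟨z, hz⟩)))))) :
      img g Z) : G)
    rw [MulAut.inv_apply_self, MulEquiv.symm_apply_apply]
    rfl

/-- If μ carries a maximal p-subgroup of the stabilizer of R into Aut_S, the target pair is good:
pull the given isomorphism back along μ, correct it at (X, R), and transport the residuals. -/
theorem relGood_of_maximal (hF : F.Saturated p) (hT : IsTorusIn p S T)
    {X R : Subgroup G} (hX : X ≤ S) (hRX : R ≤ X)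
    {V : Subgroup (MulAut X)} (hV : IsPGroup p V) (hVM : V ≤ F.aut X hX ⊓ stabilizerAut X R)
    (hmax : ∀ W : Subgroup (MulAut X), IsPGroup p W →
      W ≤ F.aut X hX ⊓ stabilizerAut X R → V ≤ W → W ≤ V)
    {μ : G → G} (hμ : F.Mor X μ)
    (hVS : ∀ v ∈ V, ∃ s ∈ S, ∀ x : X, μ (v x) = s * μ x * s⁻¹) :
    F.RelGood p (img μ R) (img μ X) := by
  intro Z R' g hg hgZ hR' hgR
  obtain ⟨k, hk, hkμ, hμk⟩ := hμ.exists_inv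
  have hm : ∀ z ∈ Z, g z ∈ img μ X := fun z hz => hgZ ▸ mem_img_of_mem g hz
  have h0 := hg.comp hk hm
  have hμ0 : ∀ z ∈ Z, μ ((k ∘ g) z) = g z := fun z hz => (hμk _ (hm z hz)).2
  have h0X : img (k ∘ g) Z = X := by
    refine h0.img_eq (fun z hz => (hμk _ (hm z hz)).1) fun x hx => ?_
    have : μ x ∈ img g Z := hgZ ▸ mem_img_of_mem μ hx
    obtain ⟨z, hz, hzx⟩ := hg.mem_img.mp this
    exact ⟨z, hz, by rw [Function.comp_apply, hzx, hkμ x hx]⟩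
  have h0R : img (k ∘ g) R' = R := by
    refine (h0.mono hR').img_eq (fun z hz => ?_) fun x hx => ?_
    · have h1 : g z ∈ img μ R := hgR ▸ mem_img_of_mem g hz
      obtain ⟨r, hr, hrz⟩ := (hμ.mono hRX).mem_img.mp h1
      rw [Function.comp_apply, ← hrz, hkμ r (hRX hr)]
      exact hr
    · have : μ x ∈ img g R' := hgR ▸ mem_img_of_mem μ hx
      obtain ⟨z, hz, hzx⟩ := (hg.mono hR').mem_img.mp this
      exact ⟨z, hz, by rw [Function.comp_apply, hzx, hkμ x (hRX hx)]⟩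
  have hm0 : ∀ z ∈ Z, (k ∘ g) z ∈ X := fun z hz => (hμk _ (hm z hz)).1
  generalize k ∘ g = g₀ at *
  subst h0X
  subst h0R
  obtain ⟨κ, hκX, hκR, hκ⟩ := hF.exists_res_conj_pair hT h0 hR' hV hVM hmax
  obtain ⟨κ', hκ', h1⟩ := hκX.transport hμ
  obtain ⟨κ'', hκ'', h2⟩ := hκR.transport (hμ.mono hRX)
  refine ⟨κ', hκ', hκ''.congr fun y hy => ?_, fun n hn hnR => ?_⟩
  · obtain ⟨x, hx, rfl⟩ := (hμ.mono hRX).mem_img.mp hy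
    rw [h1 x (hRX hx), h2 x hx]
  · obtain ⟨v, hv, hvz⟩ := hκ n hn hnR
    obtain ⟨s, hs, hsx⟩ := hVS v hv
    refine ⟨s, hs, fun z hz => ?_⟩
    have hnz := conj_mem_of_mem_normalizerIn hn hz
    have hκz := hκX.mem (hm0 z hz)
    rw [← hμ0 z hz, ← hμ0 _ hnz, h1 _ (hm0 _ hnz), h1 _ (hm0 z hz), hvz z hz,
      extendFun_apply _ hκz]
    exact hsx ⟨_, hκz⟩

end Saturated

theorem RelGood.img_self [Fact p.Prime] (hT : IsTorusIn p S T) {R X : Subgroup G}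
    (h : F.RelGood p R X) (hX : X ≤ S) (hRX : R ≤ X) {a : G → G} (ha : F.Mor S a) :
    F.RelGood p (img a R) (img a X) := by
  intro Z R' g hg hgZ hR' hgR
  obtain ⟨b, hb, hba, hab⟩ := ha.exists_inv_self hT
  have hm : ∀ z ∈ Z, g z ∈ S := fun z hz => hg.mem hz
  obtain ⟨κ, hκX, hκR, hκ⟩ := h Z R' (b ∘ g) (hg.comp hb hm)
    (by rw [hg.img_comp hb hm, hgZ, hb.img_img_self ha hba hX]) hR'
    (by rw [(hg.mono hR').img_comp hb fun x hx => hm x (hR' hx), hgR,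
      hb.img_img_self ha hba (hRX.trans hX)])
  obtain ⟨κ', hκ', h1⟩ := hκX.transport (ha.mono hX)
  obtain ⟨κ'', hκ'', h2⟩ := hκR.transport (ha.mono (hRX.trans hX))
  have hbX : ∀ z ∈ Z, b (g z) ∈ X := by
    intro z hz
    have h3 : g z ∈ img a X := hgZ ▸ mem_img_of_mem g hz
    obtain ⟨x, hx, hxz⟩ := (ha.mono hX).mem_img.mp h3
    rw [← hxz, hba x (hX hx)]
    exact hx
  refine ⟨κ', hκ', hκ''.congr fun y hy => ?_, fun n hn hnR => ?_⟩
  · obtain ⟨x, hx, rfl⟩ := (ha.mono (hRX.trans hX)).mem_img.mp hy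
    rw [h1 x (hRX hx), h2 x hx]
  · obtain ⟨s, hs, hsz⟩ := hκ n hn hnR
    refine ⟨a s, ha.mem hs, fun z hz => ?_⟩
    have hnz := conj_mem_of_mem_normalizerIn hn hz
    have h4 := hsz z hz
    simp only [Function.comp_apply] at h4
    rw [← hab _ (hm _ hnz), ← hab _ (hm z hz), h1 _ (hbX _ hnz), h1 _ (hbX z hz), h4,
      ha.map_conj hs (hX (hκX.mem (hbX z hz)))]

theorem Mor.img_centralizerIn_self [Fact p.Prime] (hT : IsTorusIn p S T) {a : G → G}
    (ha : F.Mor S a) {P : Subgroup G} (hP : P ≤ S) :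
    img a (centralizerIn S P) = centralizerIn S (img a P) := by
  refine le_antisymm (ha.img_centralizerIn_le hP centralizerIn_le) fun g hg => ?_
  obtain ⟨b, hb, hba, hab⟩ := ha.exists_inv_self hT
  have h1 := hb.img_centralizerIn_le (ha.mono hP).img_le centralizerIn_le (mem_img_of_mem b hg)
  rw [hb.img_img_self ha hba hP] at h1
  rw [← hab g (centralizerIn_le hg)]
  exact mem_img_of_mem a h1

theorem FullyCentralized.img_self [Fact p.Prime] (hT : IsTorusIn p S T) {P : Subgroup G}
    (h : F.FullyCentralized p P) {a : G → G} (ha : F.Mor S a) :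
    F.FullyCentralized p (img a P) := by
  rw [fullyCentralized_iff] at h ⊢
  have hm : ∀ x ∈ P, a x ∈ img a P := fun x hx => mem_img_of_mem a hx
  refine ⟨(ha.mono h.1).img_le, fun f hf => ?_⟩
  rw [← ha.img_centralizerIn_self hT h.1, (ha.mono centralizerIn_le).toralOrder_img,
    ← (ha.mono h.1).img_comp hf hm]
  exact h.2 _ ((ha.mono h.1).comp hf hm)

/-- The image of a fully centralized subgroup under a morphism defined on its centralizer. -/
theorem FullyCentralized.map [Fact p.Prime] (hT : IsTorusIn p S T) {Q X : Subgroup G}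
    (h : F.FullyCentralized p Q) {η : G → G} (hη : F.Mor X η) (hQX : Q ≤ X)
    (hCX : centralizerIn S Q ≤ X) : F.FullyCentralized p (img η Q) := by
  have hQ := hη.mono hQX
  refine fullyCentralized_iff.mpr ⟨hQ.img_le, fun f hf => ?_⟩
  have hm : ∀ x ∈ Q, η x ∈ img η Q := fun x hx => mem_img_of_mem η hx
  rw [← h.img_centralizerIn hT hη hQX hCX, (hη.mono hCX).toralOrder_img, ← hQ.img_comp hf hm]
  exact (fullyCentralized_iff.mp h).2 _ (hQ.comp hf hm)

namespace Saturated

variable [Fact p.Prime] (hF : F.Saturated p) (hT : IsTorusIn p S T)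

/-- A `p`-subgroup of `Aut_F(X)` can be moved into `Aut_S` by a morphism onto a fully normalized
subgroup. -/
theorem exists_mor_conj (hF : F.Saturated p) (hT : IsTorusIn p S T)
    {X : Subgroup G} (hX : X ≤ S) {V : Subgroup (MulAut X)}
    (hV : IsPGroup p V) (hVF : V ≤ F.aut X hX) :
    ∃ ψ, F.Mor X ψ ∧ F.FullyNormalized p (img ψ X) ∧
      ∀ v ∈ V, ∃ s ∈ S, ∀ x : X, ψ (v x) = s * ψ x * s⁻¹ := by
  obtain ⟨ψ₁, hψ₁, hfn⟩ := hF.exists_fullyNormalized hT hX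
  obtain ⟨e, he, hex⟩ := hψ₁.exists_mulEquiv
  obtain ⟨α, hα, hconj⟩ := (hF.isPByFinite_aut hT hψ₁.img_le).exists_residualIn_conj
    (U := V.map (MulAut.congr e).toMonoidHom) (hV.map _)
    (by
      rintro _ ⟨a, ha, rfl⟩
      exact hψ₁.congr_mem_aut hex (hVF ha))
    (isPGroup_autIn hT (img ψ₁ X)) (autIn_le_aut F hψ₁.img_le)
    (fun W hW hWF h => hF.le_autIn_of_isPGroup hfn hW hWF h)
  have hαm := (mem_aut_iff hψ₁.img_le).mp (residualIn_le _ hα)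
  have hm₁ : ∀ x ∈ X, ψ₁ x ∈ img ψ₁ X := fun x hx => mem_img_of_mem ψ₁ hx
  have hψx : ∀ y : X, (extendFun α.toMonoidHom ∘ ψ₁) y = α (e y) := by
    intro y
    rw [Function.comp_apply, ← hex y, extendFun_coe]
    rfl
  refine ⟨extendFun α.toMonoidHom ∘ ψ₁, hψ₁.comp hαm hm₁, ?_, fun v hv => ?_⟩
  · rw [hψ₁.img_comp hαm hm₁, img_extendFun_aut α (residualIn_le _ hα)]
    exact hfn
  · obtain ⟨s, hs, -, hsx⟩ := mem_autIn_iff.mp (hconj _ ⟨v, hv, rfl⟩)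
    refine ⟨s, hs, fun x => ?_⟩
    rw [hψx, hψx, ← hsx]
    change _ = ((α (e (v (e.symm (α⁻¹ (α (e x)))))) : img ψ₁ X) : G)
    rw [MulAut.inv_apply_self, MulEquiv.symm_apply_apply]

/-- A subgroup `X` of the normalizer of a fully normalized subgroup `R` can be moved to a good
position by a morphism generated by residuals and defined on `N_{N_S(R)}(X)`. -/
theorem exists_relGood (hF : F.Saturated p) (hT : IsTorusIn p S T)
    {R X : Subgroup G} (hR : F.FullyNormalized p R) (hRX : R ≤ X)
    (hXR : X ≤ normalizerIn S R) :
    ∃ ρ, F.Estar p (normalizerIn S R ⊓ normalizerIn S X) ρ ∧ F.FullyNormalized p (img ρ R) ∧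
      F.FullyCentralized p (img ρ X) ∧ F.RelGood p (img ρ R) (img ρ X) := by
  have hX : X ≤ S := hXR.trans normalizerIn_le
  -- V plays the role of a Sylow subgroup of the stabilizer of R in Aut_F(X); ψ realizes it by
  -- conjugations in S.
  obtain ⟨V, hV, hVM, hmax⟩ := IsPGroup.exists_maximal_le (p := p)
    (M := F.aut X hX ⊓ stabilizerAut X R)
  obtain ⟨ψ, hψ, hfn, hVs⟩ := hF.exists_mor_conj hT hX hV (hVM.trans inf_le_left)
  -- move `ψ(R)` back to `R`
  have hψR := hψ.mono hRX
  obtain ⟨k, hk, hkψ, hψk⟩ := hψR.exists_inv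
  have hkR : img k (img ψ R) = R := hk.img_eq (fun y hy => (hψk y hy).1)
    fun x hx => ⟨ψ x, mem_img_of_mem ψ hx, hkψ x hx⟩
  -- Since R is fully normalized, η is defined on all of N_S(ψ(R)), in particular on ψ(X) and on the
  -- elements of S realizing V.
  obtain ⟨η, hη, hηR⟩ := hF.exists_extension_normalizerIn hT hk (by rwa [hkR])
  rw [hkR] at hηR
  have hψN : ∀ x ∈ X, ψ x ∈ normalizerIn S (img ψ R) := by
    intro x hx
    refine mem_normalizerIn_of_forall hT (hψ.mem hx) fun y hy => ?_
    obtain ⟨r, hr, rfl⟩ := hψR.mem_img.mp hy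
    rw [← hψ.map_conj hx (hRX hr)]
    exact mem_img_of_mem ψ (conj_mem_of_mem_normalizerIn (hXR hx) hr)
  have hμ : F.Mor X (η ∘ ψ) := hψ.comp hη hψN
  have hμR : img (η ∘ ψ) R = R := by
    rw [hψR.img_comp hη fun x hx => hψN x (hRX hx), hηR]
  have hμX : img (η ∘ ψ) X = img η (img ψ X) := hψ.img_comp hη hψN
  have hgood : F.RelGood p R (img (η ∘ ψ) X) := by
    have := hF.relGood_of_maximal hT hX hRX hV hVM hmax hμ (by
      intro v hv
      obtain ⟨s, hs, hsx⟩ := hVs v hv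
      have hsN : s ∈ normalizerIn S (img ψ R) := by
        refine mem_normalizerIn_of_forall hT hs fun y hy => ?_
        obtain ⟨r, hr, rfl⟩ := hψR.mem_img.mp hy
        have h1 := hsx ⟨r, hRX hr⟩
        rw [← h1]
        exact mem_img_of_mem ψ (((hVM hv).2 ⟨r, hRX hr⟩).mp hr)
      refine ⟨η s, hη.mem hsN, fun x => ?_⟩
      rw [Function.comp_apply, hsx, hη.map_conj hsN (hψN x x.2)]
      rfl)
    rwa [hμR] at this
  have hfcX : F.FullyCentralized p (img (η ∘ ψ) X) := by
    rw [hμX]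
    refine FullyCentralized.map hT ?_ hη (hψ.img_le_iff.mpr hψN) ?_
    · exact hF.fullyCentralized hfn
    · exact (centralizerIn_anti (img_mono ψ hRX)).trans centralizerIn_le_normalizerIn
  obtain ⟨κ, hκX, hκR, hκ⟩ := hgood X R (η ∘ ψ) hμ rfl hRX hμR
  have hmμ : ∀ x ∈ X, (η ∘ ψ) x ∈ img (η ∘ ψ) X := fun x hx => mem_img_of_mem _ hx
  have hκμ := hμ.comp hκX.mor hmμ
  have hκμX : img (κ ∘ η ∘ ψ) X = img (η ∘ ψ) X := by
    rw [hμ.img_comp hκX.mor hmμ, hκX.img_eq]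
  have hκμR : img (κ ∘ η ∘ ψ) R = R := by
    rw [(hμ.mono hRX).img_comp hκX.mor fun x hx => hmμ x (hRX hx), hμR, hκR.img_eq]
  have hXN : X ≤ normalizerIn S R ⊓ normalizerIn S X := le_inf hXR (le_normalizerIn hX)
  obtain ⟨ν, hν, hνx⟩ := hF.exists_extension hκμ (by rw [hκμX]; exact hfcX) hXN
    (inf_le_left.trans normalizerIn_le)
    (fun g hg x hx => conj_mem_of_mem_normalizerIn hg.2 hx)
    (fun g hg => hκ g hg.2 hg.1)
  -- The extension is only in F. Discarding its factor from Aut_F(S) leaves ρ in `Estar`, and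
  -- automorphisms of S preserve all three properties of the target.
  obtain ⟨a, ρ, ha, hρ, hνρ⟩ := hF.frattini hT hν
  obtain ⟨b, hb, hba, hab⟩ := ha.exists_inv_self hT
  have hρν : ∀ P, P ≤ X → img ρ P = img b (img ν P) := by
    intro P hP
    have hPN := hP.trans hXN
    rw [← (hν.mono hPN).img_comp hb fun x hx => hν.mem (hPN hx)]
    refine img_congr fun x hx => ?_
    rw [Function.comp_apply, hνρ x (hPN hx), hba _ (hρ.mor.mem (hPN hx))]
  have hνX : img ν X = img (η ∘ ψ) X := by rw [img_congr hνx, hκμX]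
  have hνR : img ν R = R := by rw [img_congr fun x hx => hνx (hRX hx), hκμR]
  refine ⟨ρ, hρ, ?_, ?_, ?_⟩
  · rw [hρν R hRX, hνR]
    exact hR.img_self hT hb
  · rw [hρν X le_rfl, hνX]
    exact hfcX.img_self hT hb
  · rw [hρν X le_rfl, hρν R hRX, hνX, hνR]
    exact hgood.img_self hT hμ.img_le (hμR ▸ img_mono _ hRX) hb

end Saturated

end FusionSystem

end

noncomputable section

namespace FusionSystem

variable {G : Type*} [Group G] {S T : Subgroup G} {F : FusionSystem S} {p : ℕ}

/-! ### Extension to `P C_S(P)` -/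

/-- On `R`, the function `f` extends to a morphism of the minimal subsystem on `R C_S(R)`. -/
def ExtendsToCentralizer (p : ℕ) (F : FusionSystem S) (R : Subgroup G) (f : G → G) : Prop :=
  ∃ ε, F.MorMin p (R ⊔ centralizerIn S R) ε ∧ Set.EqOn ε f R

namespace ExtendsToCentralizer

variable {R : Subgroup G} {f g : G → G}

theorem congr (h : F.ExtendsToCentralizer p R f) (hg : Set.EqOn g f R) :
    F.ExtendsToCentralizer p R g := by
  obtain ⟨ε, hε, hx⟩ := h
  exact ⟨ε, hε, fun x hxR => (hx hxR).trans (hg hxR).symm⟩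

theorem of_morMin {X : Subgroup G} (hf : F.MorMin p X f) (hR : R ≤ X)
    (hC : centralizerIn S R ≤ X) : F.ExtendsToCentralizer p R f :=
  ⟨f, hf.mono (sup_le hR hC), fun _ _ => rfl⟩

theorem comp [Fact p.Prime] (hT : IsTorusIn p S T) (h : F.ExtendsToCentralizer p R f)
    (h' : F.ExtendsToCentralizer p (img f R) g) : F.ExtendsToCentralizer p R (g ∘ f) := by
  obtain ⟨ε, hε, hx⟩ := h
  obtain ⟨δ, hδ, hy⟩ := h'
  refine ⟨δ ∘ ε, hε.comp hT hδ fun z hz => ?_, fun x hxR => ?_⟩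
  · obtain ⟨x, hxR, c, hc, rfl⟩ := mem_sup_centralizerIn.mp hz
    rw [hε.mor.map_mul (Subgroup.mem_sup_left hxR) (Subgroup.mem_sup_right hc), hx hxR]
    refine Subgroup.mul_mem _ (Subgroup.mem_sup_left (mem_img_of_mem f hxR))
      (Subgroup.mem_sup_right ?_)
    have := hε.mor.img_centralizerIn_le le_sup_left le_sup_right (mem_img_of_mem ε hc)
    rwa [img_congr hx] at this
  · rw [Function.comp_apply, hx hxR, hy (mem_img_of_mem f hxR)]
    rfl

/-- Full centralization of R makes ε carry R C_S(R) onto f(R) C_S(f(R)), so its inverse has the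
required source. -/
theorem inv [Fact p.Prime] (hT : IsTorusIn p S T) (h : F.ExtendsToCentralizer p R f)
    (hR : F.FullyCentralized p R) (hg : ∀ x ∈ R, g (f x) = x) :
    F.ExtendsToCentralizer p (img f R) g := by
  obtain ⟨ε, hε, hx⟩ := h
  obtain ⟨δ, hδ, hδε⟩ := hε.exists_inv hT
  rw [hε.mor.img_sup_centralizerIn hT hR, img_congr hx] at hδ
  refine ⟨δ, hδ, fun y hy => ?_⟩
  rw [← img_congr hx] at hy
  obtain ⟨x, hxR, rfl⟩ := (hε.mor.mono le_sup_left).mem_img.mp hy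
  rw [hδε x (Subgroup.mem_sup_left hxR), hx hxR, hg x hxR]

theorem of_res [Fact p.Prime] (hF : F.Saturated p) (hT : IsTorusIn p S T)
    (hR : F.FullyCentralized p R) (hκ : F.Res p R f) : F.ExtendsToCentralizer p R f := by
  obtain ⟨κ', hκ', h⟩ := hF.exists_estar_sup hT hR hκ
  exact ⟨κ', .of_estar hκ', h⟩

end ExtendsToCentralizer

/-- The extension axiom for the minimal subsystem and a morphism defined on `P`. -/
def ExtendsToNormalizers (p : ℕ) (F : FusionSystem S) (P : Subgroup G) : Prop :=
  ∀ (f : G → G) (N : Subgroup G), F.MorMin p P f → F.FullyCentralized p (img f P) → P ≤ N →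
    N ≤ S → (∀ g ∈ N, ∀ x ∈ P, g * x * g⁻¹ ∈ P) →
    (∀ g ∈ N, ∃ s ∈ S, ∀ x ∈ P, f (g * x * g⁻¹) = s * f x * s⁻¹) →
    ∃ f', F.MorMin p N f' ∧ Set.EqOn f' f P

theorem Mor.map_mem_normalizerIn [Fact p.Prime] (hT : IsTorusIn p S T) {X R : Subgroup G}
    {f : G → G} (hf : F.Mor X f) (hRX : R ≤ X) {x : G} (hx : x ∈ X) (hxR : x ∈ normalizerIn S R) :
    f x ∈ normalizerIn S (img f R) := by
  refine mem_normalizerIn_of_forall hT (hf.mem hx) fun y hy => ?_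
  obtain ⟨r, hr, rfl⟩ := (hf.mono hRX).mem_img.mp hy
  rw [← hf.map_conj hx (hRX hr)]
  exact mem_img_of_mem f (conj_mem_of_mem_normalizerIn hxR hr)

theorem Mor.mem_normalizerIn_of_map [Fact p.Prime] (hT : IsTorusIn p S T) {X R : Subgroup G}
    {f : G → G} (hf : F.Mor X f) (hRX : R ≤ X) {x : G} (hx : x ∈ X)
    (hxR : f x ∈ normalizerIn S (img f R)) : x ∈ normalizerIn S R := by
  refine mem_normalizerIn_of_forall hT (hf.le hx) fun r hr => ?_
  have h1 := conj_mem_of_mem_normalizerIn hxR (mem_img_of_mem f hr)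
  rw [← hf.map_conj hx (hRX hr)] at h1
  exact (hf.mem_img_iff (X.mul_mem (X.mul_mem hx (hRX hr)) (X.inv_mem hx)) hRX).mp h1

namespace Saturated

variable [Fact p.Prime] (hF : F.Saturated p) (hT : IsTorusIn p S T)

/-- Induction on the height of X. Extend χ to ω on X• and put Y = X• ⊓ N_S(R). If Y contains C_S(R),
nothing remains. Otherwise a map ρ in `Estar` puts the pair (ω(R), ω(Y)) in good position. After a
residual correction κ, axiom (II) at Y, whose height is below k, extends κ ρ ω to N_S(R) ⊓ N_S(Y),
where induction applies. Induction also applies to ρ, and on R one has ω = ρ⁻¹ κ⁻¹ (κ ρ ω). -/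
theorem extendsToCentralizer_aux (k : ℕ)
    (hII : ∀ P, hF.height hT P < k → F.ExtendsToNormalizers p P) (n : ℕ) :
    ∀ R X χ, hF.height hT X ≤ n → F.FullyNormalized p R → F.FullyNormalized p (img χ R) →
      hF.bullet hT R = R → hF.height hT R ≤ k → R ≤ X → ¬ X ≤ R → X ≤ normalizerIn S R →
      F.MorMin p X χ → F.ExtendsToCentralizer p R χ := by
  induction n using Nat.strong_induction_on with
  | _ n ih =>
  intro R X χ hn hR hχR hRc hRk hRX hXR hXN hχ
  have hXS := hχ.mor.le
  obtain ⟨ω, hω, hωχ⟩ := hF.exists_morMin_bullet hT hχ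
  have hωR : img ω R = img χ R := img_congr fun x hx => hωχ (hRX hx)
  rw [← hωR] at hχR
  refine ExtendsToCentralizer.congr (f := ω) ?_ fun x hx => (hωχ (hRX hx)).symm
  set Y := hF.bullet hT X ⊓ normalizerIn S R with hY
  have hXY : X ≤ Y := le_inf (hF.le_bullet hT X) hXN
  have hYB : Y ≤ hF.bullet hT X := inf_le_left
  have hYS : Y ≤ S := hYB.trans hω.mor.le
  have hRY : R ≤ Y := hRX.trans hXY
  have hωY := hω.mono hYB
  by_cases hCY : centralizerIn S R ≤ Y
  · exact .of_morMin hωY hRY hCY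
  have hYN : Y ≤ normalizerIn S R := inf_le_right
  have hYY : Y ≤ normalizerIn S R ⊓ normalizerIn S Y := le_inf hYN (le_normalizerIn hYS)
  have hYne : ¬ normalizerIn S R ⊓ normalizerIn S Y ≤ Y := by
    intro hle
    obtain ⟨g, hg, hgY, hgn⟩ := hT.exists_mem_normalizer hYN
      (fun h => hCY (centralizerIn_le_normalizerIn.trans h)) normalizerIn_le
    exact hgY (hle ⟨hg, hg.1, hgn⟩)
  have hX₁S : normalizerIn S R ⊓ normalizerIn S Y ≤ S := inf_le_left.trans normalizerIn_le
  -- Without a drop in height this normalizer would lie in X•, hence in Y, contradicting growth of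
  -- normalizers in N_S(R).
  have hlt : hF.height hT (normalizerIn S R ⊓ normalizerIn S Y) < hF.height hT X := by
    by_contra hge
    have := hF.le_bullet_of_height_le hT (hXY.trans hYY) hX₁S (not_lt.mp hge)
    exact hYne (le_inf this inf_le_left)
  have hYk : hF.height hT Y < k :=
    ((hF.height_anti hT hXY hYS).trans_lt (hF.height_lt hT hRc hRX hXS hXR)).trans_le hRk
  have hωYN : img ω Y ≤ normalizerIn S (img ω R) := hωY.mor.img_le_iff.mpr fun y hy =>
    hωY.mor.map_mem_normalizerIn hT hRY hy (hYN hy)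
  have hωRY : img ω R ≤ img ω Y := img_mono ω hRY
  obtain ⟨ρ, hρ, hρR, hρY, hgood⟩ := hF.exists_relGood hT hχR hωRY hωYN
  have hYX' : img ω Y ≤ normalizerIn S (img ω R) ⊓ normalizerIn S (img ω Y) :=
    le_inf hωYN (le_normalizerIn hωY.mor.img_le)
  have hm : ∀ y ∈ Y, ω y ∈ normalizerIn S (img ω R) ⊓ normalizerIn S (img ω Y) :=
    fun y hy => hYX' (mem_img_of_mem ω hy)
  have hρω := hωY.comp hT (.of_estar hρ) hm
  have hρωY : img (ρ ∘ ω) Y = img ρ (img ω Y) := hωY.mor.img_comp hρ.mor hm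
  have hρωR : img (ρ ∘ ω) R = img ρ (img ω R) :=
    (hωY.mor.mono hRY).img_comp hρ.mor fun x hx => hm x (hRY hx)
  obtain ⟨κ, hκY, hκR, hκ⟩ := hgood Y R (ρ ∘ ω) hρω.mor hρωY hRY hρωR
  have hm' : ∀ y ∈ Y, (ρ ∘ ω) y ∈ img ρ (img ω Y) := fun y hy => hρωY ▸ mem_img_of_mem _ hy
  have hκω := hρω.comp hT (.of_estar (hF.estar_of_res hT hκY)) hm'
  obtain ⟨χ₁, hχ₁, hχ₁x⟩ := hII Y hYk (κ ∘ ρ ∘ ω) (normalizerIn S R ⊓ normalizerIn S Y) hκω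
    (by rw [hρω.mor.img_comp hκY.mor hm', hρωY, hκY.img_eq]; exact hρY) hYY hX₁S
    (fun g hg x hx => conj_mem_of_mem_normalizerIn hg.2 hx) (fun g hg => hκ g hg.2 hg.1)
  have hmR : ∀ x ∈ R, (ρ ∘ ω) x ∈ img ρ (img ω R) := fun x hx => hρωR ▸ mem_img_of_mem _ hx
  have hχ₁R : img χ₁ R = img ρ (img ω R) := by
    rw [img_congr fun x hx => hχ₁x (hRY hx), (hρω.mor.mono hRY).img_comp hκR.mor hmR, hρωR,
      hκR.img_eq]
  have hext₁ := ih _ (lt_of_lt_of_le hlt hn) R _ χ₁ le_rfl hR (by rw [hχ₁R]; exact hρR) hRc hRk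
    (hRY.trans hYY) (fun h => hXR ((hXY.trans hYY).trans h)) inf_le_left hχ₁
  obtain ⟨κ', hκ', hκ₁, hκ₂⟩ := hκR.exists_inv
  have hext₂ := hext₁.comp hT (g := κ')
    (by rw [hχ₁R]; exact .of_res hF hT (hF.fullyCentralized hρR) hκ')
  have hext₂x : Set.EqOn (ρ ∘ ω) (κ' ∘ χ₁) R := fun x hx => by
    rw [Function.comp_apply (f := κ'), hχ₁x (hRY hx), Function.comp_apply (f := κ),
      hκ₁ _ (hmR x hx)]
  replace hext₂ := hext₂.congr hext₂x
  have hωRm := hωY.mor.mono hRY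
  have hext₃ : F.ExtendsToCentralizer p (img ω R) ρ := by
    by_cases hC : centralizerIn S (img ω R) ≤
        normalizerIn S (img ω R) ⊓ normalizerIn S (img ω Y)
    · exact .of_morMin (.of_estar hρ) (hωRY.trans hYX') hC
    refine ih _ (lt_of_lt_of_le ?_ hn) (img ω R) _ ρ le_rfl hχR hρR
      (hF.bullet_img hT hωRm hRc) (by rwa [hF.height_img hT hωRm]) (hωRY.trans hYX') ?_
      inf_le_left (.of_estar hρ)
    -- Were the height not smaller, the normalizer would lie in the closure of ω(Y), which is ω(X•);
    -- pulling back by ω puts it in ω(Y), again against growth of normalizers.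
    · by_contra hge
      have hb := hF.bullet_eq hT hXS hXY hYB
      have h1 : hF.height hT (img ω Y) ≤
          hF.height hT (normalizerIn S (img ω R) ⊓ normalizerIn S (img ω Y)) := by
        rw [hF.height_img hT hωY.mor]
        exact (hF.height_anti hT hXY hYS).trans (not_lt.mp hge)
      have h2 := hF.le_bullet_of_height_le hT hYX' (inf_le_left.trans normalizerIn_le) h1
      have h3 := hF.img_bullet hT (P := Y) (f := ω) (by rw [hb]; exact hω.mor)
      rw [← h3, hb] at h2
      have h4 : normalizerIn S (img ω R) ⊓ normalizerIn S (img ω Y) ≤ img ω Y := by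
        intro y hy
        obtain ⟨x, hx, rfl⟩ := hω.mor.mem_img.mp (h2 hy)
        exact mem_img_of_mem ω
          ⟨hx, hω.mor.mem_normalizerIn_of_map hT (hRY.trans hYB) hx hy.1⟩
      obtain ⟨g, hg, hgY, hgn⟩ := hT.exists_mem_normalizer hωYN
        (fun h => hC (centralizerIn_le_normalizerIn.trans (h.trans hYX'))) normalizerIn_le
      exact hgY (h4 ⟨hg, hg.1, hgn⟩)
    · intro hle
      refine hXR fun x hx => ?_
      exact (hωY.mor.mem_img_iff (hXY hx) hRY).mp (hle (hYX' (mem_img_of_mem ω (hXY hx))))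
  obtain ⟨ρ', hρ', hρ'x, -⟩ := (hρ.mor.mono (hωRY.trans hYX')).exists_inv
  have hext₄ := hext₃.inv hT (hF.fullyCentralized hχR) hρ'x
  have hext₅ := hext₂.comp hT (g := ρ') (by rw [hρωR]; exact hext₄)
  refine hext₅.congr fun x hx => ?_
  simp only [Function.comp_apply]
  rw [hρ'x _ (mem_img_of_mem ω hx)]

theorem extendsToCentralizer_of_pair {k : ℕ}
    (hII : ∀ P, hF.height hT P < k → F.ExtendsToNormalizers p P) {P X : Subgroup G}
    (hP : hF.bullet hT P = P) (hPk : hF.height hT P ≤ k) (hPX : P ≤ X)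
    (hXP : ¬ X ≤ P) (hX : X ≤ normalizerIn S P) {σ χ τ : G → G} (hσ : F.MorMin p X σ)
    (hσP : F.FullyNormalized p (img σ P)) (hχ : F.MorMin p X χ)
    (hχP : F.FullyNormalized p (img χ P)) (hτ : ∀ x ∈ P, τ (σ x) = χ x) :
    F.ExtendsToCentralizer p (img σ P) τ := by
  obtain ⟨σ', hσ', h1⟩ := hσ.exists_inv hT
  have hm : ∀ y ∈ img σ X, σ' y ∈ X := fun y hy => by
    obtain ⟨x, hx, rfl⟩ := hσ.mor.mem_img.mp hy
    rwa [h1 x hx]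
  have hPσ := hσ.mor.mono hPX
  have h2 : Set.EqOn τ (χ ∘ σ') (img σ P) := fun y hy => by
    obtain ⟨x, hx, rfl⟩ := hPσ.mem_img.mp hy
    rw [hτ x hx, Function.comp_apply, h1 x (hPX hx)]
  refine (hF.extendsToCentralizer_aux hT k hII _ (img σ P) (img σ X) (χ ∘ σ') le_rfl hσP ?_
    (hF.bullet_img hT hPσ hP) (by rwa [hF.height_img hT hPσ]) (img_mono σ hPX) ?_ ?_
    (hσ'.comp hT hχ hm)).congr h2
  · have h3 : img (χ ∘ σ') (img σ P) = img χ P := by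
      rw [(hσ'.mor.mono (img_mono σ hPX)).img_comp hχ.mor fun y hy => hm y (img_mono σ hPX hy)]
      congr 1
      refine (hσ'.mor.mono (img_mono σ hPX)).img_eq (fun y hy => ?_)
        fun x hx => ⟨σ x, mem_img_of_mem σ hx, h1 x (hPX hx)⟩
      obtain ⟨x, hx, rfl⟩ := hPσ.mem_img.mp hy
      rwa [h1 x (hPX hx)]
    rw [h3]
    exact hχP
  · intro hle
    exact hXP fun x hx => (hσ.mor.mem_img_iff hx hPX).mp (hle (mem_img_of_mem σ hx))
  · exact hσ.mor.img_le_iff.mpr fun x hx => hσ.mor.map_mem_normalizerIn hT hPX hx (hX hx)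

/-- Induct on the chain of residual steps making up φ, moving each intermediate image of P to a
fully normalized subgroup. A step κ at Q is defined on Q ⊓ N_S(f(P)), strictly larger than f(P), so
`extendsToCentralizer_of_pair` applies to it. -/
theorem extendsToCentralizer_estar {k : ℕ}
    (hII : ∀ P, hF.height hT P < k → F.ExtendsToNormalizers p P) {P : Subgroup G}
    (hP : hF.bullet hT P = P) (hPk : hF.height hT P ≤ k) (hPC : ¬ F.Cen P) {φ : G → G}
    (hφ : F.Estar p P φ) : ∀ σ σ' τ, F.MorMin p (normalizerIn S P) σ →
      F.FullyNormalized p (img σ P) → F.MorMin p (normalizerIn S (img φ P)) σ' →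
      F.FullyNormalized p (img σ' (img φ P)) → (∀ x ∈ P, τ (σ x) = σ' (φ x)) →
      F.ExtendsToCentralizer p (img σ P) τ := by
  induction hφ with
  | @id φ hPS hφ =>
    intro σ σ' τ hσ hσP hσ' hσ'P hτ
    have h1 : img φ P = P := by rw [img_congr (g := fun x => x) hφ, img_id]
    rw [h1] at hσ' hσ'P
    refine hF.extendsToCentralizer_of_pair hT hII hP hPk (le_normalizerIn hPS) (fun hle => ?_)
      le_rfl hσ hσP hσ' hσ'P (fun x hx => by rw [hτ x hx, hφ x hx])
    by_cases hSP : S ≤ P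
    · exact hPC ((cen_self hT).mono hSP hPS)
    · obtain ⟨g, hg, hgP, hgn⟩ := hT.exists_mem_normalizer hPS hSP le_rfl
      exact hgP (hle ⟨hg, hgn⟩)
  | @step f g κ Q hf hC hm hκ hg ih =>
    intro σ σ' τ hσ hσP hσ' hσ'P hτ
    have hPS := hf.mor.le
    have hP₀S := hf.mor.img_le
    have hP₀Q : img f P ≤ Q := hf.mor.img_le_iff.mpr hm
    obtain ⟨σ₀, hσ₀, hσ₀P⟩ := hF.exists_estar_fullyNormalized hT hP₀S
    have hσP' := hσ.mor.mono (le_normalizerIn hPS)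
    obtain ⟨k₁, hk₁, hk₁σ, -⟩ := hσP'.exists_inv
    have h1 := ih σ σ₀ (σ₀ ∘ f ∘ k₁) hσ hσP (.of_estar hσ₀) hσ₀P fun x hx => by
      simp only [Function.comp_apply]
      rw [hk₁σ x hx]
    have hκf : img κ (img f P) = img g P := by
      rw [← hf.mor.img_comp hκ.mor hm]
      exact img_congr fun x hx => (hg x hx).symm
    have hXκ : ∀ x ∈ Q ⊓ normalizerIn S (img f P), κ x ∈ normalizerIn S (img g P) := by
      intro x hx
      rw [← hκf]
      exact hκ.mor.map_mem_normalizerIn hT hP₀Q hx.1 hx.2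
    have hχ : F.MorMin p (Q ⊓ normalizerIn S (img f P)) (σ' ∘ κ) :=
      (MorMin.of_estar (.of_res hC hκ inf_le_left)).comp hT hσ' hXκ
    have hP₀X : img f P ≤ Q ⊓ normalizerIn S (img f P) := le_inf hP₀Q (le_normalizerIn hP₀S)
    obtain ⟨k₂, hk₂, hk₂σ, -⟩ := (hσ₀.mor.mono (le_normalizerIn hP₀S)).exists_inv
    have h2 := hF.extendsToCentralizer_of_pair hT hII (hF.bullet_img hT hf.mor hP)
      (by rwa [hF.height_img hT hf.mor]) hP₀X
      (by
        intro hle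
        -- Q is centric whereas the conjugates of P are not, so f(P) ≠ Q.
        have hne : ¬ Q ≤ img f P := by
          intro hQ
          apply hPC
          have hcen : F.Cen (img f P) := le_antisymm hP₀Q hQ ▸ hC
          obtain ⟨k, hk, hkf, hfk⟩ := hf.mor.exists_inv
          have h3 : img k (img f P) = P := hk.img_eq (fun y hy => (hfk y hy).1)
            fun x hx => ⟨f x, mem_img_of_mem f hx, hkf x hx⟩
          exact h3 ▸ hcen.map hk
        obtain ⟨y, hy, hyP, hyn⟩ := hT.exists_mem_normalizer hP₀Q hne hC.1
        exact hyP (hle ⟨hy, hC.1 hy, hyn⟩))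
      inf_le_right ((MorMin.of_estar hσ₀).mono inf_le_right) hσ₀P hχ
      (by
        rw [(hκ.mor.mono hP₀Q).img_comp hσ'.mor fun x hx => hXκ x (hP₀X hx), hκf]
        exact hσ'P)
      (τ := (σ' ∘ κ) ∘ k₂)
      (fun x hx => by rw [Function.comp_apply, hk₂σ x hx])
    have h3 : img (σ₀ ∘ f ∘ k₁) (img σ P) = img σ₀ (img f P) := by
      obtain ⟨ε, hε, hεx⟩ := h1
      have hmor := (hε.mor.mono le_sup_left).congr hεx.symm
      refine hmor.img_eq (fun y hy => ?_) fun z hz => ?_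
      · obtain ⟨x, hx, rfl⟩ := hσP'.mem_img.mp hy
        simp only [Function.comp_apply]
        rw [hk₁σ x hx]
        exact mem_img_of_mem σ₀ (mem_img_of_mem f hx)
      · obtain ⟨y, hy, rfl⟩ := (hσ₀.mor.mono (le_normalizerIn hP₀S)).mem_img.mp hz
        obtain ⟨x, hx, rfl⟩ := hf.mor.mem_img.mp hy
        refine ⟨σ x, mem_img_of_mem σ hx, ?_⟩
        simp only [Function.comp_apply]
        rw [hk₁σ x hx]
    refine (h1.comp hT (g := (σ' ∘ κ) ∘ k₂) (by rw [h3]; exact h2)).congr fun y hy => ?_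
    obtain ⟨x, hx, rfl⟩ := hσP'.mem_img.mp hy
    simp only [Function.comp_apply]
    rw [hτ x hx, hk₁σ x hx, hk₂σ _ (mem_img_of_mem f hx), hg x hx]

/-- Pass to closures, which have the same centralizers, and drop the factor in `AutMin`, which is
defined on all of S. For non-centric P, the map φ is compared with its counterpart between fully
normalized conjugates. The maps σ, σ' to these are defined on normalizers, hence on centralizers,
and σ' is inverted using that φ(P) is fully centralized. -/
theorem extendsToCentralizer {k : ℕ}
    (hII : ∀ P, hF.height hT P < k → F.ExtendsToNormalizers p P) {P : Subgroup G} {f : G → G}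
    (hPk : hF.height hT P ≤ k) (hf : F.MorMin p P f) (hfc : F.FullyCentralized p (img f P)) :
    F.ExtendsToCentralizer p P f := by
  suffices h : ∀ P f, hF.bullet hT P = P → hF.height hT P ≤ k → F.MorMin p P f →
      F.FullyCentralized p (img f P) → F.ExtendsToCentralizer p P f by
    have hP := hf.mor.le
    obtain ⟨f', hf', hfx⟩ := hF.exists_morMin_bullet hT hf
    obtain ⟨ε, hε, hεx⟩ := h _ f' (hF.bullet_bullet hT hP) (by rwa [hF.height_bullet hT hP]) hf'
      (by
        rw [hF.img_bullet hT hf'.mor, img_congr hfx]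
        exact hF.fullyCentralized_bullet hT hfc)
    rw [hF.centralizerIn_bullet hT hP] at hε
    exact ⟨ε, hε.mono (sup_le_sup_right (hF.le_bullet hT P) _), fun x hx => by
      rw [hεx (hF.le_bullet hT P hx), hfx hx]⟩
  intro P f hPc hPk hf hfc
  by_cases hPC : F.Cen P
  · exact .of_morMin hf le_rfl hPC.centralizerIn_le
  have hP := hf.mor.le
  obtain ⟨a, φ, ha, hφ, hfx⟩ := hf
  obtain ⟨b, hb, hba, hab⟩ := ha.exists_inv hT
  have hφfc : F.FullyCentralized p (img φ P) := by
    have h1 : img f P = img a (img φ P) := by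
      rw [← hφ.mor.img_comp ha.mor fun x hx => hφ.mor.mem hx]
      exact img_congr hfx
    have := hfc.img_self hT hb.mor
    rwa [h1, hb.mor.img_img_self ha.mor hba hφ.mor.img_le] at this
  obtain ⟨σ, hσ, hσP⟩ := hF.exists_estar_fullyNormalized hT hP
  obtain ⟨σ', hσ', hσ'P⟩ := hF.exists_estar_fullyNormalized hT hφ.mor.img_le
  have hσm := hσ.mor.mono (le_normalizerIn hP)
  have hσ'm := hσ'.mor.mono (le_normalizerIn hφ.mor.img_le)
  obtain ⟨k₁, hk₁, hk₁σ, -⟩ := hσm.exists_inv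
  obtain ⟨k₂, hk₂, hk₂σ, -⟩ := hσ'm.exists_inv
  have h1 := hF.extendsToCentralizer_estar hT hII hPc hPk hPC hφ σ σ' (σ' ∘ φ ∘ k₁)
    (.of_estar hσ) hσP (.of_estar hσ') hσ'P fun x hx => by
      simp only [Function.comp_apply]
      rw [hk₁σ x hx]
  have h2 : F.ExtendsToCentralizer p P σ :=
    .of_morMin (.of_estar hσ) (le_normalizerIn hP) centralizerIn_le_normalizerIn
  have h3 : F.ExtendsToCentralizer p P (σ' ∘ φ) := (h2.comp hT h1).congr fun x hx => by
    simp only [Function.comp_apply]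
    rw [hk₁σ x hx]
  have h4 : F.ExtendsToCentralizer p (img φ P) σ' :=
    .of_morMin (.of_estar hσ') (le_normalizerIn hφ.mor.img_le) centralizerIn_le_normalizerIn
  have h5 : F.ExtendsToCentralizer p P φ :=
    (h3.comp hT (g := k₂) (by
      rw [hφ.mor.img_comp hσ'm fun x hx => mem_img_of_mem φ hx]
      exact h4.inv hT hφfc hk₂σ)).congr fun x hx => by
        simp only [Function.comp_apply]
        rw [hk₂σ _ (mem_img_of_mem φ hx)]
  exact (h5.comp hT (g := a) (.of_morMin (.of_autMin ha le_rfl) hφ.mor.img_le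
    centralizerIn_le)).congr hfx

end Saturated

end FusionSystem

end

noncomputable section

/-! ### The extension axiom for the minimal subsystem -/

namespace FusionSystem

variable {G : Type*} [Group G] {S T : Subgroup G} {F : FusionSystem S} {p : ℕ}

theorem normalizerIn_le_sup_centralizerIn [Fact p.Prime] (hT : IsTorusIn p S T) {R : Subgroup G} :
    normalizerIn S R ≤ normalizerIn S (R ⊔ centralizerIn S R) := by
  intro g hg
  refine mem_normalizerIn_of_forall hT hg.1 fun y hy => ?_
  obtain ⟨r, hr, c, hc, rfl⟩ := mem_sup_centralizerIn.mp hy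
  refine mem_sup_centralizerIn.mpr ⟨_, conj_mem_of_mem_normalizerIn hg hr, g * c * g⁻¹, ?_,
    by group⟩
  rw [mem_centralizerIn] at hc ⊢
  refine ⟨S.mul_mem (S.mul_mem hg.1 hc.1) (S.inv_mem hg.1), fun x hx => ?_⟩
  have h1 := hc.2 _ (conj_mem_of_mem_normalizerIn ((normalizerIn S R).inv_mem hg) hx)
  calc x * (g * c * g⁻¹) = g * (g⁻¹ * x * g⁻¹⁻¹ * c) * g⁻¹ := by group
    _ = g * c * g⁻¹ * x := by rw [h1]; group

namespace Saturated

variable [Fact p.Prime] (hF : F.Saturated p) (hT : IsTorusIn p S T)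

/-- A `p`-automorphism of `R C_S(R)` which is the identity on the fully centralized subgroup `R`
is conjugation by an element of `C_S(R)`. -/
theorem exists_centralizerIn_conj (hF : F.Saturated p) (hT : IsTorusIn p S T)
    {R : Subgroup G} (hR : F.FullyCentralized p R)
    {u : MulAut (R ⊔ centralizerIn S R : Subgroup G)}
    (hu : u ∈ F.aut (R ⊔ centralizerIn S R) (sup_centralizerIn_le hR.1))
    (hup : IsPGroup p (Subgroup.zpowers u))
    (huR : ∀ y : (R ⊔ centralizerIn S R : Subgroup G), (y : G) ∈ R → u y = y) :
    ∃ c ∈ centralizerIn S R, ∀ y : (R ⊔ centralizerIn S R : Subgroup G),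
      (u y : G) = c * y * c⁻¹ := by
  obtain ⟨ψ, hψ, -, hs⟩ := hF.exists_mor_conj hT (sup_centralizerIn_le hR.1) hup
    (Subgroup.zpowers_le.mpr hu)
  obtain ⟨s, hsS, hsx⟩ := hs u (Subgroup.mem_zpowers u)
  have h1 : s ∈ centralizerIn S (img ψ R) := by
    refine mem_centralizerIn.mpr ⟨hsS, fun y hy => ?_⟩
    obtain ⟨r, hr, rfl⟩ := (hψ.mono le_sup_left).mem_img.mp hy
    have h2 := hsx ⟨r, Subgroup.mem_sup_left hr⟩
    rw [huR ⟨r, Subgroup.mem_sup_left hr⟩ hr] at h2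
    exact eq_mul_inv_iff_mul_eq.mp h2
  -- The element s realizing u after transport by ψ centralizes ψ(R), and C_S(ψ(R)) = ψ(C_S(R)) by
  -- full centralization; so s = ψ(c).
  rw [← hR.img_centralizerIn hT hψ le_sup_left le_sup_right] at h1
  obtain ⟨c, hc, rfl⟩ := (hψ.mono le_sup_right).mem_img.mp h1
  have hcY : c ∈ R ⊔ centralizerIn S R := Subgroup.mem_sup_right hc
  refine ⟨c, hc, fun y => ?_⟩
  refine hψ.eq_of_eq (u y).2 (mul_mem (mul_mem hcY y.2) (inv_mem hcY)) ?_
  rw [hsx, hψ.map_conj hcY y.2]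

/-- The core of the extension axiom: an automorphism `α` of `S` whose restriction to `R` extends
to `R C_S(R)` in the minimal subsystem also has such an extension to any subgroup of `N_S(R)`. -/
theorem exists_morMin_of_extendsToCentralizer (hF : F.Saturated p) (hT : IsTorusIn p S T)
    {R X : Subgroup G} (hR : F.FullyCentralized p R)
    (hRX : R ≤ X) (hX : X ≤ normalizerIn S R) {α : G → G} (hα : F.Mor S α)
    (h : F.ExtendsToCentralizer p R α) : ∃ θ, F.MorMin p X θ ∧ Set.EqOn θ α R := by
  obtain ⟨ε, hε, hεα⟩ := h
  obtain ⟨α', hα', h1, h2⟩ := hα.exists_inv_self hT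
  have hYS : R ⊔ centralizerIn S R ≤ S := sup_centralizerIn_le hR.1
  have hYC : F.Cen (R ⊔ centralizerIn S R) := hR.cen_sup hT
  have hRY : R ≤ R ⊔ centralizerIn S R := le_sup_left
  have hδm : F.Mor (R ⊔ centralizerIn S R) (α' ∘ ε) := hε.mor.comp hα' fun x hx => hε.mor.mem hx
  have hδR : ∀ x ∈ R, (α' ∘ ε) x = x := fun x hx => by
    rw [Function.comp_apply, hεα hx, h1 x (hR.1 hx)]
  have hδY : img (α' ∘ ε) (R ⊔ centralizerIn S R) = R ⊔ centralizerIn S R := by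
    rw [hδm.img_sup_centralizerIn hT hR, img_congr (f := α' ∘ ε) (g := fun x => x) hδR, img_id]
  have hαδ : ∀ y ∈ R ⊔ centralizerIn S R, α ((α' ∘ ε) y) = ε y := fun y hy =>
    h2 _ (hε.mor.mem hy)
  generalize α' ∘ ε = δ₀ at *
  have hXconj : ∀ x ∈ X, ∀ r ∈ R, x * r * x⁻¹ ∈ R := fun x hx r hr =>
    conj_mem_of_mem_normalizerIn (hX hx) hr
  have hXconj' : ∀ x ∈ X, ∀ r ∈ R, x⁻¹ * r * x ∈ R := fun x hx r hr => by
    simpa using hXconj x⁻¹ (X.inv_mem hx) r hr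
  -- The elements of S acting on R as elements of X do; it contains X and C_S(R), hence also Y = R
  -- C_S(R).
  let X₂ : Subgroup G :=
    { carrier := {g | g ∈ S ∧ ∃ x ∈ X, ∀ r ∈ R, g * r * g⁻¹ = x * r * x⁻¹}
      one_mem' := ⟨S.one_mem, 1, X.one_mem, fun _ _ => rfl⟩
      mul_mem' := by
        rintro g g' ⟨hg, x, hx, h⟩ ⟨hg', x', hx', h'⟩
        refine ⟨S.mul_mem hg hg', x * x', X.mul_mem hx hx', fun r hr => ?_⟩
        calc g * g' * r * (g * g')⁻¹ = g * (g' * r * g'⁻¹) * g⁻¹ := by group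
          _ = x * (x' * r * x'⁻¹) * x⁻¹ := by rw [h' r hr, h _ (hXconj x' hx' r hr)]
          _ = x * x' * r * (x * x')⁻¹ := by group
      inv_mem' := by
        rintro g ⟨hg, x, hx, h⟩
        refine ⟨S.inv_mem hg, x⁻¹, X.inv_mem hx, fun r hr => ?_⟩
        have h3 := h _ (hXconj' x hx r hr)
        calc g⁻¹ * r * g⁻¹⁻¹ = g⁻¹ * (x * (x⁻¹ * r * x) * x⁻¹) * g := by group
          _ = x⁻¹ * r * x⁻¹⁻¹ := by rw [← h3]; group }
  have hX₂S : X₂ ≤ S := fun g hg => hg.1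
  have hXX₂ : X ≤ X₂ := fun x hx => ⟨(hX hx).1, x, hx, fun _ _ => rfl⟩
  have hX₂N : X₂ ≤ normalizerIn S (R ⊔ centralizerIn S R) := by
    rintro g ⟨hg, x, hx, h⟩
    refine normalizerIn_le_sup_centralizerIn hT (mem_normalizerIn_of_forall hT hg fun r hr => ?_)
    rw [h r hr]
    exact hXconj x hx r hr
  have hCX₂ : centralizerIn S R ≤ X₂ := fun c hc =>
    ⟨hc.1, 1, X.one_mem, fun r hr => by
      rw [← (mem_centralizerIn.mp hc).2 r hr]
      group⟩
  have hYX₂ : R ⊔ centralizerIn S R ≤ X₂ := sup_le (hRX.trans hXX₂) hCX₂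
  set Y := R ⊔ centralizerIn S R with hY
  -- M consists of the automorphisms of Y acting on R by conjugation with elements of X.
  let M : Subgroup (MulAut Y) :=
    { carrier := {β | β ∈ F.aut Y hYS ∧ ∃ x ∈ X, ∀ y : Y, (y : G) ∈ R → (β y : G) = x * y * x⁻¹}
      one_mem' := ⟨one_mem _, 1, X.one_mem, fun y _ => by simp⟩
      mul_mem' := by
        rintro β γ ⟨hβ, x, hx, h⟩ ⟨hγ, x', hx', h'⟩
        refine ⟨mul_mem hβ hγ, x * x', X.mul_mem hx hx', fun y hy => ?_⟩
        have h3 : (γ y : G) ∈ R := by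
          rw [h' y hy]
          exact hXconj x' hx' y hy
        rw [MulAut.mul_apply, h _ h3, h' y hy]
        group
      inv_mem' := by
        rintro β ⟨hβ, x, hx, h⟩
        refine ⟨inv_mem hβ, x⁻¹, X.inv_mem hx, fun y hy => ?_⟩
        have h3 := h ⟨x⁻¹ * y * x, hRY (hXconj' x hx y hy)⟩ (hXconj' x hx y hy)
        have h4 : β ⟨x⁻¹ * y * x, hRY (hXconj' x hx y hy)⟩ = y := by
          apply Subtype.ext
          rw [h3]
          group
        rw [← h4, MulAut.inv_apply_self, h4]
        group }
  have hMF : M ≤ F.aut Y hYS := fun β hβ => hβ.1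
  have hV : IsPGroup p (autIn X₂ Y) := (isPGroup_autIn hT Y).to_le
    (Subgroup.map_mono fun n hn => hX₂S hn)
  have hVmem : ∀ g (hg : g ∈ X₂), Y.normalizerMonoidHom ⟨g, (hX₂N hg).2⟩ ∈ autIn X₂ Y :=
    fun g hg => ⟨⟨g, (hX₂N hg).2⟩, hg, rfl⟩
  have hVM : autIn X₂ Y ≤ M := by
    intro v hv
    obtain ⟨g, ⟨hgS, x, hx, h⟩, -, hgv⟩ := mem_autIn_iff.mp hv
    exact ⟨(Mor.conj F hYS hgS).mem_aut hgv, x, hx, fun y hy => by rw [hgv, h y hy]⟩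
  -- Aut_{X₂}(Y) is a maximal p-subgroup of M: divide w by the conjugation it induces on R; what
  -- remains is a p-element trivial on R, hence conjugation by an element of C_S(R).
  have hmax : ∀ W : Subgroup (MulAut Y), IsPGroup p W → W ≤ M → autIn X₂ Y ≤ W →
      W ≤ autIn X₂ Y := by
    intro W hW hWM hVW w hw
    obtain ⟨hwF, x, hx, hwx⟩ := hWM hw
    have hv := hVmem x (hXX₂ hx)
    set v := Y.normalizerMonoidHom ⟨x, (hX₂N (hXX₂ hx)).2⟩ with hvdef
    have hvx : ∀ y : Y, (v y : G) = x * y * x⁻¹ := fun y => rfl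
    have hu : v⁻¹ * w ∈ W := mul_mem (inv_mem (hVW hv)) hw
    obtain ⟨c, hc, hcu⟩ := hF.exists_centralizerIn_conj hT hR (u := v⁻¹ * w) (hMF (hWM hu))
      (hW.to_le (Subgroup.zpowers_le.mpr hu)) (fun y hy => by
        have h3 : w y = v y := Subtype.ext ((hwx y hy).trans (hvx y).symm)
        rw [MulAut.mul_apply, h3, MulAut.inv_apply_self])
    have h4 : v⁻¹ * w ∈ autIn X₂ Y :=
      mem_autIn_iff.mpr ⟨c, hCX₂ hc, (hX₂N (hCX₂ hc)).2, hcu⟩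
    have := mul_mem hv h4
    rwa [mul_inv_cancel_left] at this
  obtain ⟨δ, hδ, hδx⟩ := hδm.exists_aut hδY
  have hδM : δ ∈ M := ⟨hδ, 1, X.one_mem, fun y hy => by rw [hδx, hδR y hy]; simp⟩
  obtain ⟨κ, hκ, hκV⟩ := ((hF.isPByFinite_aut hT hYS).subgroup hMF).exists_residualIn_conj
    (U := (autIn X₂ Y).map (MulAut.conj δ).toMonoidHom) (hV.map _)
    (by
      rintro _ ⟨v, hv, rfl⟩
      exact mul_mem (mul_mem hδM (hVM hv)) (inv_mem hδM)) hV hVM hmax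
  have hκM := residualIn_le _ hκ
  -- The automorphism δ = α⁻¹ ε is trivial on R but need not normalize Aut_{X₂}(Y); its residual
  -- multiple ν does.
  let ν := κ * δ
  have hνM : ν ∈ M := mul_mem hκM hδM
  have hνV : ∀ v ∈ autIn X₂ Y, ν * v * ν⁻¹ ∈ autIn X₂ Y := by
    intro v hv
    have h3 := hκV _ ⟨v, hv, rfl⟩
    have h4 : ν * v * ν⁻¹ = κ * (MulAut.conj δ).toMonoidHom v * κ⁻¹ := by
      change κ * δ * v * (κ * δ)⁻¹ = κ * (δ * v * δ⁻¹) * κ⁻¹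
      group
    rw [h4]
    exact h3
  let κ₁ := ν⁻¹ * κ⁻¹ * ν
  have hκ₁ : κ₁ ∈ residualIn p M := by
    have := residualIn_conj_mem (inv_mem hκ) (inv_mem hνM)
    rwa [inv_inv] at this
  have hδκ : δ = ν * κ₁ := by
    change δ = κ * δ * ((κ * δ)⁻¹ * κ⁻¹ * (κ * δ))
    group
  obtain ⟨-, x, hx, hκ₁x⟩ := residualIn_le _ hκ₁
  have hc := hVmem x (hXX₂ hx)
  set c := Y.normalizerMonoidHom ⟨x, (hX₂N (hXX₂ hx)).2⟩ with hcdef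
  have hcx : ∀ y : Y, (c y : G) = x * y * x⁻¹ := fun y => rfl
  -- The correction spoils triviality on R: κ₁ acts there as conjugation by some x ∈ X. Multiplying
  -- by c = c_x repairs this, as l = δ κ₁⁻¹ c is again trivial on R and c belongs to Aut_{X₂}(Y). So
  -- l extends to θ on X₂, the target Y being centric.
  let l := ν * c
  have hlM : l ∈ M := mul_mem hνM (hVM hc)
  have hlV : ∀ v ∈ autIn X₂ Y, l * v * l⁻¹ ∈ autIn X₂ Y := by
    intro v hv
    have h3 := hνV _ (mul_mem (mul_mem hc hv) (inv_mem hc))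
    have h4 : l * v * l⁻¹ = ν * (c * v * c⁻¹) * ν⁻¹ := by
      change ν * c * v * (ν * c)⁻¹ = _
      group
    rwa [h4]
  have hlδ : ∀ y : Y, l y = δ (κ₁⁻¹ (c y)) := by
    intro y
    have h3 : l = δ * κ₁⁻¹ * c := by
      rw [hδκ]
      change ν * c = _
      group
    rw [h3]
    rfl
  have hlm := (mem_aut_iff hYS).mp (hMF hlM)
  obtain ⟨θ, hθ, hθl⟩ := hF.exists_extension hlm ((hYC.map hlm).fullyCentralized hT) hYX₂ hX₂S
    (fun g hg y hy => conj_mem_of_mem_normalizerIn (hX₂N hg) hy) (by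
      intro g hg
      obtain ⟨s, hs, -, hsy⟩ := mem_autIn_iff.mp (hlV _ (hVmem g hg))
      refine ⟨s, hX₂S hs, fun y hy => ?_⟩
      rw [extendFun_apply _ hy, extendFun_apply _ (conj_mem_of_mem_normalizerIn (hX₂N hg) hy)]
      have h3 := hsy (l ⟨y, hy⟩)
      rw [MulAut.mul_apply, MulAut.mul_apply, MulAut.inv_apply_self] at h3
      exact h3)
  have hθY : ∀ y : Y, θ y = l y := fun y => by
    rw [hθl y.2, extendFun_coe]
    rfl
  have hθR : ∀ r ∈ R, θ r = r := by
    intro r hr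
    have h3 : c ⟨r, hRY hr⟩ = κ₁ ⟨r, hRY hr⟩ :=
      Subtype.ext ((hcx _).trans (hκ₁x ⟨r, hRY hr⟩ hr).symm)
    have h4 := hθY ⟨r, hRY hr⟩
    rw [hlδ, h3, MulAut.inv_apply_self, hδx] at h4
    exact h4.trans (hδR r hr)
  refine ⟨α ∘ θ, ?_, fun r hr => by rw [Function.comp_apply, hθR r hr]⟩
  -- On the centric subgroup Y, α ∘ θ is ε κ₁⁻¹ c_x, a composite of morphisms of the minimal system;
  -- this decides membership on X₂.
  refine MorMin.mono (hF.morMin_of_cen hT hYC ?_ hYX₂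
    (hθ.comp hα fun g hg => hθ.mem hg)) hXX₂
  have hκres : F.Res p Y (extendFun (κ₁⁻¹).toMonoidHom) :=
    ⟨hYS, κ₁⁻¹, inv_mem (residualIn_mono hMF hκ₁),
      fun y => (extendFun_coe (κ₁⁻¹).toMonoidHom y).symm⟩
  have hcE : F.Estar p Y (fun y => x * y * x⁻¹) := Estar.conj F hT hYS (hX hx).1
  have hcY : ∀ y ∈ Y, x * y * x⁻¹ ∈ Y := fun y hy =>
    conj_mem_of_mem_normalizerIn (hX₂N (hXX₂ hx)) hy
  have hE := hcE.comp (.of_res hYC hκres le_rfl) hcY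
  refine ((MorMin.of_estar hE).comp hT hε fun y hy => hκres.mem (hcY y hy)).congr fun y hy => ?_
  simp only [Function.comp_apply]
  have h3 := hθY ⟨y, hy⟩
  rw [hlδ, hδx] at h3
  rw [h3, hαδ _ (Subtype.prop _), extendFun_apply _ (hcY y hy)]
  rfl

/-- Strong induction on height, which supplies the hypothesis of `extendsToCentralizer`. An
extension in F factors as α ∘ φ with φ in `Estar` on N; it suffices to replace α on φ(N) by a
morphism of the minimal system agreeing with it on φ(P). -/
theorem extendsToNormalizers (hF : F.Saturated p) (hT : IsTorusIn p S T)
    (P : Subgroup G) : F.ExtendsToNormalizers p P := by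
  induction hk : hF.height hT P using Nat.strong_induction_on generalizing P with
  | _ k ih =>
  have hII : ∀ Q, hF.height hT Q < k → F.ExtendsToNormalizers p Q := fun Q hQ => ih _ hQ Q rfl
  intro f N hf hfc hPN hNS hN hc
  obtain ⟨ψ, hψ, hψf⟩ := hF.exists_extension hf.mor hfc hPN hNS hN hc
  obtain ⟨α, φ, hα, hφ, hψx⟩ := hF.frattini hT hψ
  obtain ⟨α', hα', h1, h2⟩ := hα.exists_inv_self hT
  have hφP := hφ.mono hPN
  have hαφ : ∀ x ∈ P, α (φ x) = f x := fun x hx => by rw [← hψx x (hPN hx), hψf hx]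
  have hαimg : img α (img φ P) = img f P := by
    rw [← hφP.mor.img_comp hα fun x hx => hφP.mor.mem hx]
    exact img_congr hαφ
  have hR : F.FullyCentralized p (img φ P) := by
    have := hfc.img_self hT hα'
    rwa [← hαimg, hα'.img_img_self hα h1 hφP.mor.img_le] at this
  have hαR : F.MorMin p (img φ P) α := by
    obtain ⟨φ', hφ', h3⟩ := hφP.exists_inv
    refine ((MorMin.of_estar hφ').comp hT hf fun y hy => ?_).congr fun y hy => ?_
    · obtain ⟨x, hx, rfl⟩ := hφP.mor.mem_img.mp hy
      rwa [h3 x hx]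
    · obtain ⟨x, hx, rfl⟩ := hφP.mor.mem_img.mp hy
      rw [Function.comp_apply, h3 x hx, hαφ x hx]
  have hext := hF.extendsToCentralizer hT hII (P := img φ P)
    (by rw [hF.height_img hT hφP.mor, hk]) hαR (by rw [hαimg]; exact hfc)
  obtain ⟨θ, hθ, hθα⟩ := hF.exists_morMin_of_extendsToCentralizer hT hR (img_mono φ hPN)
    (hφ.mor.img_le_iff.mpr fun g hg => hφ.mor.map_mem_normalizerIn hT hPN hg
      (mem_normalizerIn_of_forall hT (hNS hg) (hN g hg))) hα hext
  refine ⟨θ ∘ φ, (MorMin.of_estar hφ).comp hT hθ fun x hx => mem_img_of_mem φ hx,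
    fun x hx => ?_⟩
  rw [Function.comp_apply, hθα (mem_img_of_mem φ hx), hαφ x hx]

end Saturated

end FusionSystem

end

noncomputable section

namespace FusionSystem

variable {G : Type*} [Group G] {S T : Subgroup G} {F : FusionSystem S} {p : ℕ}

theorem FullyCentralized.of_le {E : FusionSystem S} (hE : E ≤ F) {P : Subgroup G}
    (h : F.FullyCentralized p P) : E.FullyCentralized p P := by
  rw [fullyCentralized_iff] at h ⊢
  exact ⟨h.1, fun f hf => h.2 f (mor_of_le hE hf)⟩

theorem aut_mono {E : FusionSystem S} (hE : E ≤ F) {P : Subgroup G} (hP : P ≤ S) :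
    E.aut P hP ≤ F.aut P hP := fun _ hα => hE _ _ hα

theorem _root_.IsSylowIn.of_le {X : Type*} [Group X] {A B C : Subgroup X} (h : IsSylowIn p A C)
    (hAB : A ≤ B) (hBC : B ≤ C) : IsSylowIn p A B := by
  obtain ⟨Q, rfl⟩ := h
  refine ⟨⟨((Q : Subgroup C).map C.subtype).subgroupOf B,
    (Q.isPGroup'.map _).comap_of_injective _ B.subtype_injective, fun {W} hW hle => ?_⟩, ?_⟩
  · have h1 : (W.map B.subtype).subgroupOf C = Q := by
      refine Q.is_maximal' ((hW.map _).comap_of_injective _ C.subtype_injective) fun x hx => ?_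
      exact ⟨⟨x, hAB ⟨x, hx, rfl⟩⟩, hle ⟨x, hx, rfl⟩, rfl⟩
    refine le_antisymm (fun w hw => ?_) hle
    have h2 : (⟨w, hBC w.2⟩ : C) ∈ (W.map B.subtype).subgroupOf C := ⟨w, hw, rfl⟩
    rw [h1] at h2
    exact ⟨_, h2, rfl⟩
  · exact Subgroup.map_subgroupOf_eq_of_le hAB

/-! ### The minimal subsystem -/

/-- The fusion system with morphisms `MorMin`. -/
def minSystem [Fact p.Prime] (F : FusionSystem S) (hT : IsTorusIn p S T) : FusionSystem S where
  Hom P Q := {φ | Q ≤ S ∧ F.MorMin p P (extendFun φ)}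
  le_of_mem h := ⟨h.2.mor.le, h.1⟩
  injective {P Q φ} h x y hxy := by
    refine Subtype.ext (h.2.mor.eq_of_eq x.2 y.2 ?_)
    rw [extendFun_coe, extendFun_coe, hxy]
  conj_mem {P Q} hP hQ g hg h := ⟨hQ, (MorMin.of_estar (Estar.conj F hT hP hg)).congr
    fun x hx => extendFun_apply _ hx⟩
  comp_mem {P Q R ψ φ} h h' := ⟨h.1, (h'.2.comp hT h.2 fun x hx => by
      rw [extendFun_apply _ hx]
      exact (φ _).2).congr fun x hx => by
      rw [extendFun_apply _ hx, Function.comp_apply, extendFun_apply _ hx, extendFun_coe]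
      rfl⟩
  factor {P Q φ} h := by
    obtain ⟨e, he, hx⟩ := h.2.mor.exists_mulEquiv
    have hle : img (extendFun φ) P ≤ Q := h.2.mor.img_le_iff.mpr fun x hx => by
      rw [extendFun_apply _ hx]
      exact (φ _).2
    refine ⟨_, hle, e, ⟨hle.trans h.1, h.2.congr fun x hxP => ?_⟩, ⟨h.2.mor.le, ?_⟩, ?_⟩
    · rw [extendFun_apply _ hxP]
      exact hx ⟨x, hxP⟩
    · obtain ⟨g, hg, h1⟩ := h.2.exists_inv hT
      refine hg.congr fun y hy => ?_
      obtain ⟨x, hxy⟩ := e.surjective ⟨y, hy⟩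
      have h2 : y = extendFun φ x := by rw [← hx, hxy]
      rw [extendFun_apply _ hy, ← hxy]
      change ((e.symm (e x) : P) : G) = _
      rw [e.symm_apply_apply, h2, h1 x x.2]
    · ext x
      rw [← extendFun_coe φ x, ← hx]
      rfl

variable [Fact p.Prime] {hT : IsTorusIn p S T}

theorem minSystem_mor {P : Subgroup G} {f : G → G} :
    (F.minSystem hT).Mor P f ↔ F.MorMin p P f := by
  constructor
  · rintro ⟨φ, hφ, hx⟩
    exact hφ.2.congr fun x hxP => by rw [extendFun_apply _ hxP, ← hx ⟨x, hxP⟩]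
  · intro h
    let φ : P →* S := MonoidHom.mk' (fun x => ⟨f x, h.mor.mem x.2⟩)
      fun x y => Subtype.ext (h.mor.map_mul x.2 y.2)
    exact ⟨φ, ⟨le_rfl, h.congr fun x hx => extendFun_apply φ hx⟩, fun x => rfl⟩

theorem minSystem_le : F.minSystem hT ≤ F := by
  intro P Q φ hφ
  exact hφ.2.mor.hom_mem hφ.1 φ fun x => (extendFun_coe φ x).symm

/-- By the Frattini factorization each F-conjugate of P is the image under Aut_F(S) of a conjugate
in the subsystem, and Aut_F(S) preserves orders of normalizers. -/
theorem fullyNormalized_of_minSystem (hF : F.Saturated p) {P : Subgroup G}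
    (h : (F.minSystem hT).FullyNormalized p P) : F.FullyNormalized p P := by
  rw [fullyNormalized_iff] at h ⊢
  refine ⟨h.1, fun f hf => ?_⟩
  obtain ⟨a, φ, ha, hφ, hfx⟩ := hF.frattini hT hf
  have h1 : img f P = img a (img φ P) := by
    rw [← hφ.mor.img_comp ha fun x hx => hφ.mor.mem hx]
    exact img_congr hfx
  rw [h1, ← ha.img_normalizerIn hT hφ.mor.img_le, (ha.mono normalizerIn_le).toralOrder_img]
  exact h.2 φ (minSystem_mor.mpr (.of_estar hφ))

theorem fullyCentralized_of_minSystem (hF : F.Saturated p) {P : Subgroup G}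
    (h : (F.minSystem hT).FullyCentralized p P) : F.FullyCentralized p P := by
  rw [fullyCentralized_iff] at h ⊢
  refine ⟨h.1, fun f hf => ?_⟩
  obtain ⟨a, φ, ha, hφ, hfx⟩ := hF.frattini hT hf
  have h1 : img f P = img a (img φ P) := by
    rw [← hφ.mor.img_comp ha fun x hx => hφ.mor.mem hx]
    exact img_congr hfx
  rw [h1, ← ha.img_centralizerIn_self hT hφ.mor.img_le,
    (ha.mono centralizerIn_le).toralOrder_img]
  exact h.2 φ (minSystem_mor.mpr (.of_estar hφ))

/-- For axiom (I), Aut_S(P) ≤ Aut_E(P) ≤ Aut_F(P) lets finiteness and the Sylow property of the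
outer images descend from F. -/
theorem Saturated.minSystem (hF : F.Saturated p) (hT : IsTorusIn p S T) :
    (F.minSystem hT).Saturated p where
  sylow P hP hfn := by
    have hfn' := fullyNormalized_of_minSystem hF hfn
    obtain ⟨hfc, hfin, hsyl⟩ := hF.sylow P hP hfn'
    have hle : outImage ((F.minSystem hT).aut P hP) ≤ outImage (F.aut P hP) :=
      Subgroup.map_mono (aut_mono minSystem_le hP)
    refine ⟨hfc.of_le minSystem_le, ?_, ?_⟩
    · exact Finite.of_injective _ (Subgroup.inclusion_injective hle)
    · exact hsyl.of_le (Subgroup.map_mono (autIn_le_aut _ hP)) hle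
  extend P φ hφ hfc := by
    have himg : imageOf φ P = img (extendFun φ) P := by
      ext y
      rw [hφ.2.mor.mem_img]
      constructor
      · rintro ⟨x, hx, rfl⟩
        exact ⟨x, x.2, extendFun_coe φ x⟩
      · rintro ⟨x, hx, rfl⟩
        exact ⟨⟨x, hx⟩, hx, (extendFun_apply φ hx).symm⟩
    rw [himg] at hfc
    set N := extensionDomain φ ((F.minSystem hT).injective hφ) with hN
    have hmem : ∀ {g}, g ∈ N ↔ _ := fun {g} =>
      mem_extensionDomain_iff ((F.minSystem hT).injective hφ)
    have hPN : P ≤ N := by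
      intro g hg
      refine hmem.mpr ⟨hφ.2.mor.le hg, Subgroup.le_normalizer hg, φ ⟨g, hg⟩, (φ _).2, fun x => ?_⟩
      have h1 : (⟨g * x * g⁻¹, P.mul_mem (P.mul_mem hg x.2) (P.inv_mem hg)⟩ : P) =
        ⟨g, hg⟩ * x * ⟨g, hg⟩⁻¹ := rfl
      rw [h1, map_mul, map_mul, map_inv]
      rfl
    obtain ⟨f', hf', hfx⟩ := hF.extendsToNormalizers hT P (extendFun φ) N hφ.2
      (fullyCentralized_of_minSystem hF hfc) hPN (fun g hg => (hmem.mp hg).1)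
      (fun g hg x hx => (Subgroup.mem_normalizer_iff.mp (hmem.mp hg).2.choose x).mp hx)
      (fun g hg => by
        obtain ⟨-, hgn, s, hs, hsx⟩ := hmem.mp hg
        refine ⟨s, hs, fun x hx => ?_⟩
        rw [extendFun_apply φ hx,
          extendFun_apply φ ((Subgroup.mem_normalizer_iff.mp hgn x).mp hx)]
        exact hsx ⟨x, hx⟩)
    obtain ⟨ψ, hψ, hψx⟩ := minSystem_mor (hT := hT).mpr hf'
    refine ⟨ψ, hψ, fun x hx hx' => Subtype.ext ?_⟩
    rw [hψx, ← extendFun_apply φ hx]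
    exact hfx hx
  union P hP hPS φ h := by
    refine ⟨le_rfl, hF.morMin_iSup hT hP fun n => ?_⟩
    refine (h n).2.congr fun x hx => ?_
    rw [extendFun_apply _ (le_iSup P n hx), extendFun_apply _ hx]
    rfl

theorem Saturated.hasIndexPrimeTo_minSystem (hF : F.Saturated p) (hT : IsTorusIn p S T) :
    (F.minSystem hT).HasIndexPrimeTo p F where
  le := minSystem_le
  saturated := hF.minSystem hT
  residual_le P hP := by
    intro α hα
    have hres : F.Res p P (extendFun α.toMonoidHom) :=
      ⟨hP, α, hα, fun x => (extendFun_coe α.toMonoidHom x).symm⟩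
    exact ⟨hP, .of_estar (hF.estar_of_res hT hres)⟩

theorem Saturated.minimalIndexPrimeTo_eq (hF : F.Saturated p) (hT : IsTorusIn p S T) :
    F.minimalIndexPrimeTo p = F.minSystem hT := by
  refine le_antisymm (fun P Q φ hφ => hφ.2 _ (hF.hasIndexPrimeTo_minSystem hT))
    fun P Q φ hφ => ⟨minSystem_le _ _ hφ, fun E hE => ?_⟩
  exact (hE.mor_of_morMin hF hT hφ.2).hom_mem hφ.1 φ fun x => (extendFun_coe φ x).symm

/-! ### Normality of the minimal subsystem -/

/-- The minimal subsystem is invariant under conjugation by morphisms of `F`. -/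
theorem Saturated.morMin_conj (hF : F.Saturated p) (hT : IsTorusIn p S T) {P Q : Subgroup G}
    {γ f g : G → G} (hγ : F.Mor Q γ) (hPQ : P ≤ Q) (hf : F.MorMin p P f) (hfQ : ∀ x ∈ P, f x ∈ Q)
    (hg : ∀ x ∈ P, g (γ x) = γ (f x)) : F.MorMin p (img γ P) g := by
  obtain ⟨a, φ, ha, hφ, hγx⟩ := hF.frattini hT hγ
  have hφP := hφ.mono hPQ
  obtain ⟨φ', hφ', h1⟩ := hφP.exists_inv
  have hm : ∀ y ∈ img φ P, φ' y ∈ P := fun y hy => by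
    obtain ⟨x, hx, rfl⟩ := hφP.mor.mem_img.mp hy
    rwa [h1 x hx]
  have h2 : F.MorMin p (img φ P) (φ ∘ f ∘ φ') :=
    ((MorMin.of_estar hφ').comp hT hf hm).comp hT (.of_estar hφ) fun y hy => hfQ _ (hm y hy)
  obtain ⟨k, hk, hkx⟩ := h2.transport hT ha
  have h3 : img γ P = img a (img φ P) := by
    rw [← hφP.mor.img_comp ha fun x hx => hφP.mor.mem hx]
    exact img_congr fun x hx => hγx x (hPQ hx)
  rw [h3]
  refine hk.congr fun y hy => ?_
  rw [← h3] at hy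
  obtain ⟨x, hx, rfl⟩ := (hγ.mono hPQ).mem_img.mp hy
  rw [hg x hx, hγx x (hPQ hx), hkx _ (mem_img_of_mem φ hx)]
  simp only [Function.comp_apply]
  rw [h1 x hx, hγx _ (hfQ x hx)]

theorem imageOf_eq_img {P Q : Subgroup G} (hPQ : P ≤ Q) {γ : Q →* S} (hγ : γ ∈ F.Hom Q S) :
    imageOf γ P = img (extendFun γ) P := by
  have hm : F.Mor Q (extendFun γ) := ⟨γ, hγ, fun x => (extendFun_coe γ x).symm⟩
  ext y
  rw [(hm.mono hPQ).mem_img]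
  constructor
  · rintro ⟨x, hx, rfl⟩
    exact ⟨x, hx, extendFun_coe γ x⟩
  · rintro ⟨x, hx, rfl⟩
    exact ⟨⟨x, hPQ hx⟩, hx, (extendFun_apply γ (hPQ hx)).symm⟩

theorem Saturated.isNormalIn_minSystem (hF : F.Saturated p) (hT : IsTorusIn p S T) :
    (F.minSystem hT).IsNormalIn p F where
  subsystem := ⟨le_rfl, minSystem_le⟩
  stronglyClosed := ⟨le_rfl, fun _ _ φ _ => (φ _).2⟩
  saturated := hF.minSystem hT
  invariant P Q hPQ hQ γ hγ := by
    have hm : F.Mor Q (extendFun γ) := ⟨γ, hγ, fun x => (extendFun_coe γ x).symm⟩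
    have hinj := F.injective hγ
    have heQ : ∀ x : Q, ((imageEquiv γ hinj le_rfl x : imageOf γ Q) : G) = extendFun γ x :=
      fun x => (extendFun_coe γ x).symm
    have heP : ∀ x : P, ((imageEquiv γ hinj hPQ x : imageOf γ P) : G) = extendFun γ x :=
      fun x => (extendFun_apply γ (hPQ x.2)).symm
    refine ⟨fun f hf => ⟨?_, ?_⟩, fun f _ f' _ hff' => ?_, fun h hh => ?_⟩
    · rw [imageOf_eq_img le_rfl hγ]
      exact hm.img_le
    · refine (hF.morMin_conj hT hm hPQ hf.2 (fun x hx => ?_) fun x hx => ?_).mono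
        (imageOf_eq_img hPQ hγ).le
      · rw [extendFun_apply f hx]
        exact (f _).2
      · have h1 := heP ⟨x, hx⟩
        simp only at h1
        rw [extendFun_apply f hx, ← h1, extendFun_coe, ← heQ]
        change ((imageEquiv γ hinj le_rfl (f ((imageEquiv γ hinj hPQ).symm
          (imageEquiv γ hinj hPQ ⟨x, hx⟩))) : imageOf γ Q) : G) = _
        rw [MulEquiv.symm_apply_apply]
    · ext x
      have h1 := DFunLike.congr_fun hff' (imageEquiv γ hinj hPQ x)
      change imageEquiv γ hinj le_rfl (f ((imageEquiv γ hinj hPQ).symm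
          (imageEquiv γ hinj hPQ x))) = imageEquiv γ hinj le_rfl (f' ((imageEquiv γ hinj hPQ).symm
          (imageEquiv γ hinj hPQ x))) at h1
      rw [MulEquiv.symm_apply_apply] at h1
      exact congrArg Subtype.val ((imageEquiv γ hinj le_rfl).injective h1)
    · let f : P →* Q := (imageEquiv γ hinj le_rfl).symm.toMonoidHom.comp
        (h.comp (imageEquiv γ hinj hPQ).toMonoidHom)
      refine ⟨f, ⟨hQ, ?_⟩, ?_⟩
      · obtain ⟨k, hk, hkγ, -⟩ := hm.exists_inv
        have h2 := hh.2.mono (imageOf_eq_img hPQ hγ).ge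
        have h3 : img k (img (extendFun γ) P) = P :=
          (hk.mono (img_mono _ hPQ)).img_eq (fun y hy => by
            obtain ⟨x, hx, rfl⟩ := (hm.mono hPQ).mem_img.mp hy
            rwa [hkγ x (hPQ hx)]) fun x hx => ⟨_, mem_img_of_mem _ hx, hkγ x (hPQ hx)⟩
        have h4 := hF.morMin_conj hT hk (img_mono _ hPQ) h2 (fun y hy => ?_)
          (g := extendFun f) fun y hy => ?_
        · rwa [h3] at h4
        · rw [← imageOf_eq_img hPQ hγ] at hy
          rw [extendFun_apply h hy, ← imageOf_eq_img le_rfl hγ]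
          exact (h _).2
        · obtain ⟨x, hx, rfl⟩ := (hm.mono hPQ).mem_img.mp hy
          have h5 := heP ⟨x, hx⟩
          simp only at h5
          rw [hkγ x (hPQ hx), extendFun_apply f hx, ← h5, extendFun_coe]
          have h6 := heQ (f ⟨x, hx⟩)
          have h7 : imageEquiv γ hinj le_rfl (f ⟨x, hx⟩) = h (imageEquiv γ hinj hPQ ⟨x, hx⟩) :=
            MulEquiv.apply_symm_apply _ _
          rw [h7] at h6
          rw [h6, hkγ _ (f ⟨x, hx⟩).2]
      · ext y
        change ((imageEquiv γ hinj le_rfl ((imageEquiv γ hinj le_rfl).symm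
          (h (imageEquiv γ hinj hPQ ((imageEquiv γ hinj hPQ).symm y)))) : imageOf γ Q) : G) = _
        rw [MulEquiv.apply_symm_apply, MulEquiv.apply_symm_apply]
  extension f hf := by
    -- For S' = S the automorphism is its own extension; it preserves Z(S) = C_S(S), so f(g) g⁻¹
    -- lies there for g in C_S(S).
    have hsup : S ⊔ centralizerIn S S = S := sup_eq_left.mpr centralizerIn_le
    have hm : F.Mor S (extendFun f.toMonoidHom) := hf.2.mor
    have hm' : F.Mor (S ⊔ centralizerIn S S) (extendFun f.toMonoidHom) := by rwa [hsup]
    obtain ⟨α, hα, hαx⟩ := hm'.exists_aut (by rw [hsup]; exact hm.img_self hT)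
    refine ⟨α, hα, fun x => ?_, fun g => ?_⟩
    · rw [hαx]
      exact extendFun_coe f.toMonoidHom x
    · rw [hαx]
      refine mul_mem ?_ (inv_mem g.2)
      have h1 := hm.img_centralizerIn_le le_rfl centralizerIn_le (mem_img_of_mem _ g.2)
      rwa [hm.img_self hT] at h1

end FusionSystem

/-! ### The main theorem -/

theorem mainTheorem4 {G : Type*} [Group G] (p : ℕ) [Fact p.Prime] (S : Subgroup G)
    (hS : IsDiscretePToral p S) (F : FusionSystem S) (hF : F.Saturated p) :
    IsLeast {E : FusionSystem S | E.HasIndexPrimeTo p F} (F.minimalIndexPrimeTo p) ∧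
      (F.minimalIndexPrimeTo p).IsNormalIn p F := by
  obtain ⟨T, hT⟩ := hS.exists_isTorusIn
  refine ⟨⟨?_, fun E hE P Q φ hφ => hφ.2 E hE⟩, ?_⟩
  · rw [hF.minimalIndexPrimeTo_eq hT]
    exact hF.hasIndexPrimeTo_minSystem hT
  · rw [hF.minimalIndexPrimeTo_eq hT]
    exact hF.isNormalIn_minSystem hT

end
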